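/- **Setting.** Let $Q$ be an acyclic quiver of extended Dynkin type $\widetilde A_{n-1}$ ($n\ge 2$), i.e. $Q$ has vertices $q_i$ and arrows $v_i$ ($i\in\mathbb Z/n$), where $v_i$ connects $q_i$ and $q_{i+1}$ in either direction, and $Q$ has no oriented cycles. Let $W_Q$ be the free group on the arrows of $Q$ and let $\widetilde Q$ be the universal cover of $Q$, with vertex set $Q_0\times W_Q$ and one arrow $(p,w)\to(q,wa)$ for every arrow $a:p\to q$ and $w\in W_Q$. A finite dimensional complex representation $X$ of $Q$ is a *string module* if it is isomorphic to the push-down $\left(\bigoplus_{w}\widetilde X_{(p,w)}\right)_{p\in Q_0}$ of a representation $\widetilde X$ of $\widetilde Q$ all of whose components have dimension $0$ or $1$. For a basis $\mathcal B=\bigsqcup_p\mathcal B_p$ of $X$ ($\mathcal B_p$ a basis of $X_p$), the *coefficient quiver* $\Gamma=\Gamma(X,\mathcal B)$ has vertex set $\Gamma_0=\mathcal B$ and an arrow $b\to c$ over $a:p\to q$ whenever $b\in\mathcal B_p$, $c\in\mathcal B_q$ and $c$ has a nonzero coefficient in $X_a(b)$. We call $\mathcal B$ a *string basis* if the elements of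 $\mathcal B$ can be listed as $b_0,\dots,b_N$ and the arrows of $\Gamma$ as $a_1,\dots,a_N$, where $a_i$ connects $b_{i-1}$ and $b_i$ in either direction and $a_i$, $a_{i+1}$ lie over different arrows of $Q$. A subset $\beta\subseteq\Gamma_0$ is *successor closed* if for every arrow $b\to c$ of $\Gamma$ with $b\in\beta$ also $c\in\beta$; it is *of type* $\underline e$ if $\#(\beta\cap\mathcal B_p)=e_p$ for all $p\in Q_0$. For a dimension vector $\underline e\in\mathbb N^{Q_0}$, the quiver Grassmannian $\mathrm{Gr}_{\underline e}(X)$ is the closed subvariety of $\prod_p\mathrm{Gr}(e_p,X_p)$ of all subrepresentations of $X$ with dimension vector $\underline e$. A *cell decomposition into affine spaces* is a finite partition of it into subsets, each of them (with its reduced structure) isomorphic to some $\mathbb A^d_{\mathbb C}$, which can be totally ordered such that each union of an initial segment is Zariski closed. **Theorem.** Let $X$ be an indecomposable string module of $Q$. Then $X$ has a string basis. For every string basis $\mathcal B$ of $X$, with coefficient quiver $\Gamma$, and every dimension vector $\underline e$ of $Q$: 1. $\mathrm{Gr}_{\underline e}(X)$ has a cell decomposition into affine spaces $\mathrm{Gr}_{\underline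 e}(X)=\bigsqcup_\beta C^X_\beta$, labelled by the successor closed subsets $\beta$ of $\Gamma_0$ of type $\underline e$, where $C^X_\beta$ contains the subrepresentation spanned by $\beta$. 2. Consequently, the cohomology with complex coefficients of $\mathrm{Gr}_{\underline e}(X)$ in the analytic topology is of finite total dimension, and the Euler characteristic $\chi(\mathrm{Gr}_{\underline e}(X))=\sum_i(-1)^i\dim_{\mathbb C} H^i(\mathrm{Gr}_{\underline e}(X);\mathbb C)$ equals the number of successor closed subsets of $\Gamma_0$ of type $\underline e$. -/

import Mathlib

universe u v w

open scoped Topology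

noncomputable section

/-! ## Spaces with functions -/

/-- A space with complex valued functions: a topology, and for every function `f` and every point
`x` the information whether `f` is regular in a neighbourhood of `x`.  Classical complex varieties
are treated as such spaces, with their Zariski topology. -/
structure FunSpace (α : Type u) where
  zariski : TopologicalSpace α
  RegularAt : (α → ℂ) → α → Prop

namespace FunSpace

/-- The polynomial functions on a complex vector space. -/
def polyFun (E : Type u) [AddCommGroup E] [Module ℂ E] : Subalgebra ℂ (E → ℂ) :=
  Algebra.adjoin ℂ (Set.range fun l : Module.Dual ℂ E => (l : E → ℂ))

/-- The affine space of a (finite dimensional) vector space `E`: the Zariski topology is generated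
by the sets `g ≠ 0` with `g` polynomial, and the regular functions are locally quotients of
polynomials. -/
def affine (E : Type u) [AddCommGroup E] [Module ℂ E] : FunSpace E where
  zariski := TopologicalSpace.generateFrom {U | ∃ g ∈ polyFun E, U = {x | g x ≠ 0}}
  RegularAt f x := ∃ g ∈ polyFun E, ∃ h ∈ polyFun E, h x ≠ 0 ∧ ∀ y, h y ≠ 0 → f y = g y / h y

/-- The structure induced on a subset (for a locally closed subset of a variety, this is its
structure of a reduced subvariety): a function is regular at `x` if it is, near `x`, the
restriction of a function on the ambient space that is regular at `x`. -/
def sub {α : Type u} (S : FunSpace α) (s : Set α) : FunSpace s where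
  zariski := S.zariski.induced Subtype.val
  RegularAt f x := ∃ g : α → ℂ, S.RegularAt g x ∧
    ∃ U : Set α, IsOpen[S.zariski] U ∧ (x : α) ∈ U ∧ ∀ y : s, (y : α) ∈ U → f y = g y

/-- The quotient structure along a map `π`: a set is open if its preimage is, and a function is
regular at `y` if its pullback is regular at all points of the fibre over `y`. -/
def quot {α : Type u} {β : Type v} (S : FunSpace α) (π : α → β) : FunSpace β where
  zariski := S.zariski.coinduced π
  RegularAt f y := ∀ x, π x = y → S.RegularAt (f ∘ π) x

/-- Isomorphisms of spaces with functions: homeomorphisms that identify the regular functions. -/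
structure Iso {α : Type u} {β : Type v} (S : FunSpace α) (T : FunSpace β) where
  toEquiv : α ≃ β
  continuous_toFun : Continuous[S.zariski, T.zariski] toEquiv
  continuous_invFun : Continuous[T.zariski, S.zariski] toEquiv.symm
  regularAt_iff : ∀ (f : β → ℂ) (x : α),
    T.RegularAt f (toEquiv x) ↔ S.RegularAt (f ∘ toEquiv) x

/-- A cell decomposition into affine spaces: a finite partition into subsets `C i`, each one
isomorphic to some affine space `ℂ ^ d`, that can be ordered in such a way that the union of the
cells up to a given one is always Zariski closed. -/
structure IsCellDecomposition {α : Type u} (S : FunSpace α) {ι : Type v} (C : ι → Set α) :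
    Prop where
  finite : Finite ι
  disjoint : Pairwise fun i j => Disjoint (C i) (C j)
  cover : ⋃ i, C i = Set.univ
  filtration : ∃ r : ι → ℕ, Function.Injective r ∧
    ∀ k : ℕ, IsClosed[S.zariski] (⋃ i, ⋃ (_ : r i ≤ k), C i)
  isAffineSpace : ∀ i, ∃ d : ℕ, Nonempty (Iso (S.sub (C i)) (affine (Fin d → ℂ)))

end FunSpace

/-! ## Euler characteristic

The cohomology with complex coefficients is computed by the Alexander-Spanier complex.  On compact
Hausdorff spaces this is Čech cohomology and the sheaf cohomology of the constant sheaf; if the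
space is moreover triangulable, such as a complex projective variety in its analytic topology, it is
singular cohomology. -/

namespace AlexanderSpanier

/-- Functions on `(n + 1)`-tuples of points. -/
abbrev Fn (Y : Type u) (n : ℕ) : Type u := (Fin (n + 1) → Y) → ℂ

/-- The functions on `(n + 1)`-tuples that are locally zero, i.e. that vanish on the tuples of
points of `U` for a suitable neighbourhood `U` of any given point. -/
def locallyZero (Y : Type u) [TopologicalSpace Y] (n : ℕ) : Submodule ℂ (Fn Y n) where
  carrier := {φ | ∀ y : Y, ∃ U : Set Y, IsOpen U ∧ y ∈ U ∧
    ∀ x : Fin (n + 1) → Y, (∀ i, x i ∈ U) → φ x = 0}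
  zero_mem' _ := ⟨Set.univ, isOpen_univ, trivial, fun _ _ => rfl⟩
  add_mem' {φ ψ} hφ hψ y := by
    obtain ⟨U, hU, hyU, h1⟩ := hφ y
    obtain ⟨V, hV, hyV, h2⟩ := hψ y
    refine ⟨U ∩ V, hU.inter hV, ⟨hyU, hyV⟩, fun x hx => ?_⟩
    simp [h1 x fun i => (hx i).1, h2 x fun i => (hx i).2]
  smul_mem' c φ hφ y := by
    obtain ⟨U, hU, hyU, h1⟩ := hφ y
    exact ⟨U, hU, hyU, fun x hx => by simp [h1 x hx]⟩

/-- The coboundary `(δ φ) (x₀, …, xₙ₊₁) = ∑ᵢ (-1)ⁱ φ (x₀, …, x̂ᵢ, …, xₙ₊₁)`. -/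
def coboundary (Y : Type u) (n : ℕ) : Fn Y n →ₗ[ℂ] Fn Y (n + 1) where
  toFun φ x := ∑ i : Fin (n + 2), (-1 : ℂ) ^ (i : ℕ) * φ (fun j => x (i.succAbove j))
  map_add' φ ψ := by
    ext x
    simp [mul_add, Finset.sum_add_distrib]
  map_smul' c φ := by
    ext x
    simp [Finset.mul_sum, mul_left_comm]

theorem coboundary_coboundary (Y : Type u) (n : ℕ) (φ : Fn Y n) :
    coboundary Y (n + 1) (coboundary Y n φ) = 0 := by
  ext x
  simp only [coboundary, LinearMap.coe_mk, AddHom.coe_mk, Finset.mul_sum, Pi.zero_apply]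
  rw [← Finset.sum_product']
  refine Finset.sum_involution (fun p _ => (p.1.succAbove p.2, p.2.predAbove p.1)) ?_ ?_ ?_ ?_
  · rintro ⟨i, j⟩ -
    have h := Fin.neg_one_pow_succAbove_add_predAbove (R := ℂ) i j
    simp only [Fin.succAbove_succAbove_succAbove_predAbove, ← mul_assoc, ← pow_add, h]
    ring
  · rintro ⟨i, j⟩ - - h
    exact Fin.succAbove_ne i j (congrArg Prod.fst h)
  · exact fun _ _ => Finset.mem_univ _
  · rintro ⟨i, j⟩ -
    simp [Fin.succAbove_succAbove_predAbove, Fin.predAbove_predAbove_succAbove]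

theorem locallyZero_le (Y : Type u) [TopologicalSpace Y] (n : ℕ) :
    locallyZero Y n ≤ (locallyZero Y (n + 1)).comap (coboundary Y n) := by
  intro φ hφ y
  obtain ⟨U, hU, hyU, h⟩ := hφ y
  refine ⟨U, hU, hyU, fun x hx => ?_⟩
  exact Finset.sum_eq_zero (s := Finset.univ)
    (f := fun i : Fin (n + 2) => (-1 : ℂ) ^ (i : ℕ) * φ (fun j => x (i.succAbove j)))
    fun i _ => by rw [h _ fun j => hx _, mul_zero]

/-- The Alexander-Spanier cochain complex with complex coefficients. -/
def complex (Y : Type u) [TopologicalSpace Y] : CochainComplex (ModuleCat.{u} ℂ) ℕ :=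
  CochainComplex.of (fun n => ModuleCat.of ℂ (Fn Y n ⧸ locallyZero Y n))
    (fun n => ModuleCat.ofHom
      ((locallyZero Y n).mapQ (locallyZero Y (n + 1)) (coboundary Y n) (locallyZero_le Y n)))
    (fun n => by
      rw [← ModuleCat.ofHom_comp, ← Submodule.mapQ_comp]
      ext φ
      simp [coboundary_coboundary])

end AlexanderSpanier

/-- `χ` is the Euler characteristic of the space `Y`: the cohomology of `Y` is of finite total
dimension, and the alternating sum of the dimensions is `χ`. -/
def HasEulerChar (Y : Type u) [TopologicalSpace Y] (χ : ℤ) : Prop :=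
  (∀ n, Module.Finite ℂ ((AlexanderSpanier.complex Y).homology n)) ∧
  {n : ℕ | Nontrivial ((AlexanderSpanier.complex Y).homology n)}.Finite ∧
  (AlexanderSpanier.complex Y).homologyEulerChar = χ

/-! ## Quivers -/

namespace Quiver

/-- The arrow `a` connects the vertices `p` and `q`, in one direction or the other. -/
def Total.Joins {V : Type u} [Quiver.{v} V] (a : Quiver.Total V) (p q : V) : Prop :=
  (a.left = p ∧ a.right = q) ∨ (a.left = q ∧ a.right = p)

/-- There are no oriented cycles. -/
def IsAcyclic (V : Type u) [Quiver.{v} V] : Prop :=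
  ∀ (p : V) (c : Quiver.Path p p), c.length = 0

/-- Extended Dynkin type `Ã_{n-1}` for some `n ≥ 2`: there are `n` vertices `qᵢ` and `n` arrows
`vᵢ`, indexed by the integers modulo `n`, and `vᵢ` connects `qᵢ` and `qᵢ₊₁`, in any direction. -/
def IsExtendedDynkinA (V : Type u) [Quiver.{v} V] : Prop :=
  ∃ n : ℕ, 2 ≤ n ∧ ∃ (q : ZMod n ≃ V) (a : ZMod n ≃ Quiver.Total V),
    ∀ i, (a i).Joins (q i) (q (i + 1))

/-- The vertices of the universal cover of a quiver: pairs of a vertex and an element of the free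
group on the arrows. -/
structure UniversalCover (V : Type u) [Quiver.{v} V] where
  base : V
  word : FreeGroup (Quiver.Total V)

/-- For every arrow `a : p ⟶ q` and every `g` there is one arrow `(p, g) ⟶ (q, g * a)`. -/
instance (V : Type u) [Quiver.{v} V] : Quiver.{v} (UniversalCover V) where
  Hom x y := {a : x.base ⟶ y.base // y.word = x.word * FreeGroup.of ⟨x.base, y.base, a⟩}

end Quiver

/-! ## Representations -/

/-- Complex representations of a quiver. -/
structure QuiverRep (V : Type u) [Quiver.{v} V] where
  obj : V → Type w
  [addCommGroup : ∀ p, AddCommGroup (obj p)]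
  [module : ∀ p, Module ℂ (obj p)]
  map : ∀ {p q : V}, (p ⟶ q) → obj p →ₗ[ℂ] obj q

namespace QuiverRep

attribute [instance] QuiverRep.addCommGroup QuiverRep.module

variable {V : Type u} [Quiver.{v} V]

/-- Isomorphisms of representations. -/
structure Iso (X : QuiverRep.{u, v, w} V) (Y : QuiverRep V) where
  equiv : ∀ p, X.obj p ≃ₗ[ℂ] Y.obj p
  comm : ∀ {p q : V} (a : p ⟶ q) (x : X.obj p), equiv q (X.map a x) = Y.map a (equiv p x)

/-- The families of subspaces that form a subrepresentation. -/
def IsSubrep (X : QuiverRep.{u, v, w} V) (U : ∀ p, Submodule ℂ (X.obj p)) : Prop :=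
  ∀ {p q : V} (a : p ⟶ q), ∀ x ∈ U p, X.map a x ∈ U q

/-- `X` is nonzero, and not the direct sum of two nonzero subrepresentations. -/
def IsIndecomposable (X : QuiverRep.{u, v, w} V) : Prop :=
  (∃ p, Nontrivial (X.obj p)) ∧
  ∀ U W : ∀ p, Submodule ℂ (X.obj p), X.IsSubrep U → X.IsSubrep W → (∀ p, IsCompl (U p) (W p)) →
    (∀ p, U p = ⊥) ∨ (∀ p, W p = ⊥)

open Classical in
/-- The push-down of a representation `Y` of the universal cover, `X_p = ⨁_g Y_(p, g)`. -/
def pushdown (Y : QuiverRep.{max u v, v, w} (Quiver.UniversalCover V)) :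
    QuiverRep.{u, v, max u v w} V where
  obj p := DirectSum (FreeGroup (Quiver.Total V)) fun g => Y.obj ⟨p, g⟩
  map {p q} a := DirectSum.toModule ℂ _ _ fun g =>
    DirectSum.lof ℂ (FreeGroup (Quiver.Total V)) (fun g => Y.obj ⟨q, g⟩)
        (g * FreeGroup.of ⟨p, q, a⟩) ∘ₗ
      Y.map (p := ⟨p, g⟩) (q := ⟨q, g * FreeGroup.of ⟨p, q, a⟩⟩) ⟨a, rfl⟩

/-- `X` is a string module: it lifts to a representation of the universal cover all of whose
components are of dimension `0` or `1`. -/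
def IsStringModule (X : QuiverRep.{u, v, w} V) : Prop :=
  ∃ Y : QuiverRep.{max u v, v, w} (Quiver.UniversalCover V),
    (∀ x, Module.rank ℂ (Y.obj x) ≤ 1) ∧ Nonempty (X.Iso Y.pushdown)

/-! ## Coefficient quivers -/

/-- A basis of a representation, i.e. a basis of each of its components. -/
structure HomBasis (X : QuiverRep.{u, v, w} V) where
  index : V → Type
  basis : ∀ p, Module.Basis (index p) ℂ (X.obj p)

namespace HomBasis

variable {X : QuiverRep.{u, v, w} V}

/-- The vertices of the coefficient quiver: the basis elements. -/
structure Vertex (B : X.HomBasis) where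
  base : V
  elt : B.index base

/-- The coefficient quiver: there is an arrow `b ⟶ c` over `a` if the basis element `c` has a
nonzero coefficient in the image of `b` under `a`. -/
instance (B : X.HomBasis) : Quiver.{v} B.Vertex where
  Hom b c := {a : b.base ⟶ c.base // (B.basis c.base).repr (X.map a (B.basis b.base b.elt)) c.elt ≠ 0}

/-- The arrow of the quiver below an arrow of the coefficient quiver. -/
def proj (B : X.HomBasis) (a : Quiver.Total B.Vertex) : Quiver.Total V :=
  ⟨a.left.base, a.right.base, a.hom.1⟩

/-- The coefficient quiver is a string: its vertices form a sequence `b₀, …, b_N`, its arrows are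
`a₁, …, a_N`, with `aᵢ` between `bᵢ₋₁` and `bᵢ`, in any direction, and the arrows below `aᵢ` and
`aᵢ₊₁` are different (so that over a quiver of type `Ã` the string winds around the cycle in a
constant sense). -/
def IsString (B : X.HomBasis) : Prop :=
  ∃ (N : ℕ) (b : Fin (N + 1) ≃ B.Vertex) (a : Fin N ≃ Quiver.Total B.Vertex),
    (∀ i, (a i).Joins (b i.castSucc) (b i.succ)) ∧
    ∀ i j : Fin N, (j : ℕ) = i + 1 → B.proj (a i) ≠ B.proj (a j)

/-- `β` is closed under successors in the coefficient quiver. -/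
def SuccessorClosed (B : X.HomBasis) (β : Set B.Vertex) : Prop :=
  ∀ b c : B.Vertex, Nonempty (b ⟶ c) → b ∈ β → c ∈ β

/-- `β` has exactly `e p` elements over every vertex `p`. -/
def IsOfType (B : X.HomBasis) (e : V → ℕ) (β : Set B.Vertex) : Prop :=
  ∀ p, {b ∈ β | b.base = p}.ncard = e p

/-- The successor closed subsets of type `e`. -/
def SuccessorClosedOfType (B : X.HomBasis) (e : V → ℕ) : Type u :=
  {β : Set B.Vertex // B.SuccessorClosed β ∧ B.IsOfType e β}

/-- The subspaces spanned by the basis elements in `β`. -/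
def coordSpan (B : X.HomBasis) (β : Set B.Vertex) (p : V) : Submodule ℂ (X.obj p) :=
  Submodule.span ℂ (B.basis p '' {i | (⟨p, i⟩ : B.Vertex) ∈ β})

end HomBasis

/-! ## Quiver Grassmannians -/

variable (X : QuiverRep.{u, v, w} V) (e : V → ℕ)

/-- The product of the Grassmannians `Gr(e_p, X_p)`. -/
def ProdGr : Type (max u w) :=
  {U : ∀ p, Submodule ℂ (X.obj p) // ∀ p, Module.finrank ℂ (U p) = e p}

/-- Tuples of vectors, `e p` of them at every vertex `p`. -/
abbrev Tuples : Type (max u w) := ∀ p, Fin (e p) → X.obj p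

/-- The frames: the tuples that are linearly independent at every vertex. -/
def frames : Set (X.Tuples e) := {Φ | ∀ p, LinearIndependent ℂ (Φ p)}

/-- The subspaces spanned by a frame. -/
def spanFrame (Φ : X.frames e) : X.ProdGr e :=
  ⟨fun p => Submodule.span ℂ (Set.range (Φ.1 p)), fun p => by
    simpa using finrank_span_eq_card (Φ.2 p)⟩

/-- The product of Grassmannians as a variety, the quotient of the variety of frames by the
action of the product of the general linear groups. -/
def prodGrVar : FunSpace (X.ProdGr e) := ((FunSpace.affine _).sub (X.frames e)).quot (X.spanFrame e)

/-- The analytic topology of the product of Grassmannians, again as a quotient of the space of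
frames; the finite dimensional space of tuples carries its usual topology. -/
instance : TopologicalSpace (X.ProdGr e) :=
  TopologicalSpace.coinduced (X.spanFrame e)
    ((moduleTopology ℂ (X.Tuples e)).induced Subtype.val)

/-- The quiver Grassmannian `Gr_e(X)`, as a closed subset of the product of Grassmannians. -/
def quiverGr : Set (X.ProdGr e) := {U | X.IsSubrep U.1}

/-- The quiver Grassmannian as a (reduced) variety. -/
def quiverGrVar : FunSpace (X.quiverGr e) := (X.prodGrVar e).sub (X.quiverGr e)

end QuiverRep

end

/-!
A string basis of `X` is labelled by `1, …, M` along the string, so that the arrows of the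
coefficient quiver connect consecutive labels, and the vertices of the cycle below them are passed
in a constant sense. In a subrepresentation `U`, every vector has a leading coordinate, the one with
the smallest label. The labels of the leading coordinates, the pivots of `U`, form a successor
closed set of type `e`, since an arrow shifts all labels at its source by one in the same direction;
see `StringCoords.closed_of_isSubrep` and `StringCoords.card_fiber_pivots`. The cell of `β` consists
of the subrepresentations with set of pivots `β`.

A point of the cell of `β` has a unique normal frame of vectors `u_b = b + ∑ x (b, c) c`, for
`b ∈ β`, with `c > b` outside `β` over the same vertex. The condition that these span a
subrepresentation is a system of polynomial equations, `Supported.isSubrep_iff`. Each of them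
compares the coefficients at two positions `(i, j)` and `(i + 1, j + 1)`, with further terms of
smaller difference `c - b`, `StringCell.isSol_iff`. If the arrow of the quiver at the end of the
string points away from the string, then all equations can be solved for the second coefficient,
without ever hitting a position where the coefficient is zero by definition. Otherwise the order of
the labels is reversed, and then all equations can be solved for the first coefficient. So the
system is triangular, and its solutions are parametrized polynomially by the remaining coefficients,
`StringCell.nonempty_param_of_right` and `StringCell.nonempty_param_of_left`. Since the normal frame
of `U` depends rationally on an arbitrary frame of `U`, this parametrization is an isomorphism of
varieties, `FunSpace.Slice.iso`, and also a homeomorphism in the analytic topology. The points that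
have a normal frame for `β`, whether or not `β` is their set of pivots, form an open chart, and the
charts show that the cells can be ordered lexicographically, `isClosed_iUnion_cell`.

For the Euler characteristic, cochains with compact support are used. The homotopy invariance of the
Alexander-Spanier complex, in the form of a prism operator, shows that a closed subspace and its
complement give rise to a long exact sequence, see `AlexanderSpanier.suppRel_acyclic`, and that a
half space has no cohomology with compact supports. Hence that of a cell `ℂ ^ d` is concentrated in
degree `2 d`. As all cells have even dimension, the long exact sequences of the filtration split,
and every cell contributes a class of even degree, `AlexanderSpanier.hasHc_of_cells`. The quiver
Grassmannian is compact, so this is its cohomology.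

The existence of a string basis comes from the lift of `X` to the universal cover. The components of
the cover are lines, on which the vertices of the cycle are passed periodically. As `X` is
indecomposable, the support of the lift is an interval of such a line, and all maps between
consecutive vertices of the interval are nonzero, `QuiverRep.exists_walk`.
-/

noncomputable section

/-! ### Cohomology of pairs of subcomplexes -/

namespace RelCoh

variable {F : ℕ → Type*} [∀ n, AddCommGroup (F n)] [∀ n, Module ℂ (F n)]
  (d : ∀ n, F n →ₗ[ℂ] F (n + 1))

/-- The cochains of the subcomplex `S` whose coboundary lies in `T`. -/
def cocyc (S T : ∀ n, Submodule ℂ (F n)) (n : ℕ) : Submodule ℂ (F n) :=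
  S n ⊓ (T (n + 1)).comap (d n)

/-- The coboundaries of the subcomplex `S`. -/
def bdry (S : ∀ n, Submodule ℂ (F n)) : ∀ n, Submodule ℂ (F n)
  | 0 => ⊥
  | n + 1 => (S n).map (d n)

/-- The coboundaries of `S` modulo `T`. -/
def cobd (S T : ∀ n, Submodule ℂ (F n)) (n : ℕ) : Submodule ℂ (F n) :=
  T n ⊔ bdry d S n

/-- The cohomology of the quotient complex `S / T`, for subcomplexes `T ≤ S` of an ambient
cochain complex.  The definition avoids the quotient complex: it divides the relative cocycles by
the coboundaries of `S` modulo `T`. -/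
abbrev Coh (S T : ∀ n, Submodule ℂ (F n)) (n : ℕ) :=
  cocyc d S T n ⧸ (cobd d S T n).submoduleOf (cocyc d S T n)

/-- The cohomology of `S / T` is finite dimensional, of dimension `h n` in degree `n`. -/
def HasCoh (S T : ∀ n, Submodule ℂ (F n)) (h : ℕ → ℕ) : Prop :=
  ∀ n, Module.Finite ℂ (Coh d S T n) ∧ Module.finrank ℂ (Coh d S T n) = h n

variable {d} {S R T : ∀ n, Submodule ℂ (F n)}

theorem mem_cobd_zero {x : F 0} : x ∈ cobd d S T 0 ↔ x ∈ T 0 := by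
  simp [cobd, bdry]

theorem mem_cobd_succ {n : ℕ} {x : F (n + 1)} :
    x ∈ cobd d S T (n + 1) ↔ ∃ y ∈ S n, x - d n y ∈ T (n + 1) := by
  simp only [cobd, bdry, Submodule.mem_sup, Submodule.mem_map]
  constructor
  · rintro ⟨t, ht, _, ⟨y, hy, rfl⟩, rfl⟩
    exact ⟨y, hy, by simpa using ht⟩
  · rintro ⟨y, hy, ht⟩
    exact ⟨_, ht, _, ⟨y, hy, rfl⟩, by simp⟩

theorem cobd_mono (hRS : ∀ n, R n ≤ S n) (n : ℕ) : cobd d R T n ≤ cobd d S T n := by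
  cases n with
  | zero => intro x; simp [mem_cobd_zero]
  | succ n =>
    intro x
    simp only [mem_cobd_succ]
    rintro ⟨y, hy, h⟩
    exact ⟨y, hRS _ hy, h⟩

theorem cobd_mono_right (hTR : ∀ n, T n ≤ R n) (n : ℕ) : cobd d S T n ≤ cobd d S R n :=
  sup_le_sup_right (hTR n) _

theorem subsingleton_of_le {n : ℕ} (h : cocyc d S T n ≤ cobd d S T n) :
    Subsingleton (Coh d S T n) :=
  Submodule.Quotient.subsingleton_iff.2 (Submodule.submoduleOf_eq_top.2 h)

theorem le_of_finrank_zero {h : ℕ → ℕ} (H : HasCoh d S T h) {n : ℕ} (hn : h n = 0) :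
    cocyc d S T n ≤ cobd d S T n := by
  have := (H n).1
  have h2 := (H n).2
  rw [hn] at h2
  have := Module.finrank_zero_iff.1 h2
  exact Submodule.submoduleOf_eq_top.1 (Submodule.Quotient.subsingleton_iff.1 this)

section Quotient

variable {M N P : Type*} [AddCommGroup M] [AddCommGroup N] [AddCommGroup P] [Module ℂ M]
  [Module ℂ N] [Module ℂ P] {p : Submodule ℂ M} {q : Submodule ℂ N} {r : Submodule ℂ P}
  {f : M →ₗ[ℂ] N} {g : N →ₗ[ℂ] P} {hf : p ≤ q.comap f} {hg : q ≤ r.comap g}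

theorem mapQ_injective (h : ∀ x, f x ∈ q → x ∈ p) : Function.Injective (p.mapQ q f hf) := by
  rw [injective_iff_map_eq_zero]
  intro x
  obtain ⟨x, rfl⟩ := Submodule.Quotient.mk_surjective _ x
  rw [Submodule.mapQ_apply, Submodule.Quotient.mk_eq_zero, Submodule.Quotient.mk_eq_zero]
  exact h x

theorem mapQ_surjective (h : ∀ y, ∃ x, f x - y ∈ q) : Function.Surjective (p.mapQ q f hf) := by
  intro y
  obtain ⟨y, rfl⟩ := Submodule.Quotient.mk_surjective _ y
  obtain ⟨x, hx⟩ := h y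
  exact ⟨Submodule.Quotient.mk x, by rwa [Submodule.mapQ_apply, Submodule.Quotient.eq]⟩

theorem mapQ_exact (h : ∀ y, g y ∈ r ↔ ∃ x, f x - y ∈ q) :
    Function.Exact (p.mapQ q f hf) (q.mapQ r g hg) := by
  intro y
  obtain ⟨y, rfl⟩ := Submodule.Quotient.mk_surjective _ y
  rw [Submodule.mapQ_apply, Submodule.Quotient.mk_eq_zero, h]
  constructor
  · rintro ⟨x, hx⟩
    exact ⟨Submodule.Quotient.mk x, by rwa [Submodule.mapQ_apply, Submodule.Quotient.eq]⟩
  · rintro ⟨x, hx⟩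
    obtain ⟨x, rfl⟩ := Submodule.Quotient.mk_surjective _ x
    exact ⟨x, by rwa [Submodule.mapQ_apply, Submodule.Quotient.eq] at hx⟩

end Quotient

theorem finite_and_finrank_of_exact {A B C : Type*} [AddCommGroup A] [AddCommGroup B]
    [AddCommGroup C] [Module ℂ A] [Module ℂ B] [Module ℂ C] [Module.Finite ℂ A]
    [Module.Finite ℂ C] (f : A →ₗ[ℂ] B) (g : B →ₗ[ℂ] C) (hf : Function.Injective f)
    (hg : Function.Surjective g) (hfg : Function.Exact f g) :
    Module.Finite ℂ B ∧ Module.finrank ℂ B = Module.finrank ℂ A + Module.finrank ℂ C := by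
  have hk : LinearMap.ker g = LinearMap.range f := LinearMap.exact_iff.1 hfg
  have h1 : Module.Finite ℂ (LinearMap.ker g) := by
    rw [hk]; infer_instance
  have h2 : Module.Finite ℂ (B ⧸ LinearMap.ker g) :=
    Module.Finite.equiv (g.quotKerEquivOfSurjective hg).symm
  have : Module.Finite ℂ B := Module.Finite.of_submodule_quotient (LinearMap.ker g)
  refine ⟨this, ?_⟩
  rw [← LinearMap.finrank_range_add_finrank_ker g, hk, LinearMap.finrank_range_of_inj hf,
    LinearMap.range_eq_top.2 hg, finrank_top, add_comm]

/-- The map induced by the inclusion of a subcomplex. -/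
def inclCoh (hRS : ∀ n, R n ≤ S n) (n : ℕ) : Coh d R T n →ₗ[ℂ] Coh d S T n :=
  Submodule.mapQ _ _
    (Submodule.inclusion (fun _ hx => ⟨hRS _ hx.1, hx.2⟩ : cocyc d R T n ≤ cocyc d S T n))
    (fun _ hx => cobd_mono hRS n hx)

/-- The inclusion is injective if its source vanishes, or if the group before it in the long exact
sequence of the triple vanishes. -/
theorem inclCoh_injective (hTR : ∀ n, T n ≤ R n) (hRS : ∀ n, R n ≤ S n)
    (dd : ∀ n x, d (n + 1) (d n x) = 0) (n : ℕ)
    (hinj : cocyc d R T n ≤ cobd d R T n ∨ ∀ m, m + 1 = n → cocyc d S R m ≤ cobd d S R m) :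
    Function.Injective (inclCoh (d := d) (T := T) hRS n) := by
  rcases hinj with hinj | hinj
  · have := subsingleton_of_le hinj
    exact Function.injective_of_subsingleton _
  refine mapQ_injective ?_
  rintro ⟨x, hx⟩
  change x ∈ cobd d S T n → x ∈ cobd d R T n
  cases n with
  | zero => simp [mem_cobd_zero]
  | succ m =>
    rw [mem_cobd_succ]
    rintro ⟨y, hy, hxy⟩
    have hyc : y ∈ cocyc d S R m := by
      refine ⟨hy, ?_⟩
      have := (R (m + 1)).sub_mem hx.1 (hTR _ hxy)
      simpa using this
    have hyb := hinj m rfl hyc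
    rw [mem_cobd_succ]
    cases m with
    | zero => exact ⟨y, mem_cobd_zero.1 hyb, hxy⟩
    | succ m =>
      obtain ⟨z, hz, hyz⟩ := mem_cobd_succ.1 hyb
      exact ⟨_, hyz, by simpa [dd] using hxy⟩

/-- A piece of the long exact sequence of a triple `T ≤ R ≤ S`, in a degree in which it is a short
exact sequence. -/
theorem triple_finrank (hTR : ∀ n, T n ≤ R n) (hRS : ∀ n, R n ≤ S n)
    (dd : ∀ n x, d (n + 1) (d n x) = 0) (n : ℕ)
    (hinj : cocyc d R T n ≤ cobd d R T n ∨ ∀ m, m + 1 = n → cocyc d S R m ≤ cobd d S R m)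
    (hsurj : cocyc d R T (n + 1) ≤ cobd d R T (n + 1) ∨ cocyc d S R n ≤ cobd d S R n)
    [Module.Finite ℂ (Coh d R T n)] [Module.Finite ℂ (Coh d S R n)] :
    Module.Finite ℂ (Coh d S T n) ∧ Module.finrank ℂ (Coh d S T n) =
      Module.finrank ℂ (Coh d R T n) + Module.finrank ℂ (Coh d S R n) := by
  have e1 : cocyc d R T n ≤ cocyc d S T n := fun x hx => ⟨hRS _ hx.1, hx.2⟩
  have e2 : cocyc d S T n ≤ cocyc d S R n := fun x hx => ⟨hx.1, hTR _ hx.2⟩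
  let f : Coh d R T n →ₗ[ℂ] Coh d S T n := inclCoh hRS n
  let g : Coh d S T n →ₗ[ℂ] Coh d S R n := Submodule.mapQ _ _ (Submodule.inclusion e2)
    (fun x hx => cobd_mono_right hTR n hx)
  have hf : Function.Injective f := inclCoh_injective hTR hRS dd n hinj
  have hg : Function.Surjective g := by
    rcases hsurj with h | h
    · refine mapQ_surjective ?_
      rintro ⟨x, hx⟩
      have h1 : d n x ∈ cocyc d R T (n + 1) := ⟨hx.2, by simp [dd]⟩
      obtain ⟨y, hy, hxy⟩ := mem_cobd_succ.1 (h h1)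
      have h2 : x - y ∈ cocyc d S T n :=
        ⟨(S n).sub_mem hx.1 (hRS _ hy), by simpa using hxy⟩
      refine ⟨⟨x - y, h2⟩, ?_⟩
      change x - y - x ∈ cobd d S R n
      refine Submodule.mem_sup_left ?_
      simpa using hy
    · have := subsingleton_of_le h
      exact Function.surjective_to_subsingleton g
  have hfg : Function.Exact f g := by
    refine mapQ_exact ?_
    rintro ⟨x, hx⟩
    change x ∈ cobd d S R n ↔ _
    constructor
    · intro h
      cases n with
      | zero =>
        refine ⟨⟨x, mem_cobd_zero.1 h, hx.2⟩, ?_⟩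
        change x - x ∈ cobd d S T 0
        simp
      | succ m =>
        obtain ⟨y, hy, hxy⟩ := mem_cobd_succ.1 h
        refine ⟨⟨x - d m y, hxy, ?_⟩, ?_⟩
        · simpa [dd] using hx.2
        · change x - d m y - x ∈ cobd d S T (m + 1)
          refine Submodule.mem_sup_right ⟨-y, (S m).neg_mem hy, by simp⟩
    · rintro ⟨⟨y, hyc⟩, hy⟩
      have hy' : y - x ∈ cobd d S T n := hy
      have h1 := cobd_mono_right (d := d) (S := S) hTR n hy'
      have h2 : y ∈ cobd d S R n := Submodule.mem_sup_left hyc.1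
      have := (cobd d S R n).sub_mem h2 h1
      simpa using this
  exact finite_and_finrank_of_exact f g hf hg hfg

/-- If the cohomology of `R / T` vanishes in the odd degrees and so does that of `S / R`, then the
dimensions add up. -/
theorem HasCoh.add (hTR : ∀ n, T n ≤ R n) (hRS : ∀ n, R n ≤ S n)
    (dd : ∀ n x, d (n + 1) (d n x) = 0) {h h' : ℕ → ℕ} (H : HasCoh d R T h)
    (H' : HasCoh d S R h') (ho : ∀ n, Odd n → h n = 0) (ho' : ∀ n, Odd n → h' n = 0) :
    HasCoh d S T (h + h') := by
  intro n
  have := (H n).1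
  have := (H' n).1
  rw [Pi.add_apply, ← (H n).2, ← (H' n).2]
  rcases Nat.even_or_odd n with hn | hn
  · refine triple_finrank hTR hRS dd n (Or.inr ?_) (Or.inl ?_)
    · rintro m rfl
      exact le_of_finrank_zero H' (ho' m (by grind))
    · exact le_of_finrank_zero H (ho _ hn.add_one)
  · exact triple_finrank hTR hRS dd n (Or.inl (le_of_finrank_zero H (ho n hn)))
      (Or.inr (le_of_finrank_zero H' (ho' n hn)))

/-- If the cohomology of `S / R` vanishes, then `R / T` and `S / T` have the same cohomology. -/
theorem hasCoh_iff_of_acyclic (hTR : ∀ n, T n ≤ R n) (hRS : ∀ n, R n ≤ S n)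
    (dd : ∀ n x, d (n + 1) (d n x) = 0) {h : ℕ → ℕ}
    (H' : ∀ n, cocyc d S R n ≤ cobd d S R n) : HasCoh d R T h ↔ HasCoh d S T h := by
  have key : ∀ n, Module.Finite ℂ (Coh d R T n) → Module.Finite ℂ (Coh d S T n) ∧
      Module.finrank ℂ (Coh d S T n) = Module.finrank ℂ (Coh d R T n) := by
    intro n _
    have := subsingleton_of_le (H' n)
    have h1 := triple_finrank hTR hRS dd n (Or.inr fun m _ => H' m) (Or.inr (H' n))
    rwa [Module.finrank_zero_of_subsingleton (M := Coh d S R n), add_zero] at h1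
  constructor
  · intro H n
    rw [← (H n).2]
    exact key n (H n).1
  · intro H n
    have := (H n).1
    have hf : Module.Finite ℂ (Coh d R T n) := Module.Finite.of_injective _
      (inclCoh_injective (d := d) hTR hRS dd n (Or.inr fun m _ => H' m))
    exact ⟨hf, by rw [← (key n hf).2]; exact (H n).2⟩

/-- If the cohomology of `S / T` vanishes, then the connecting map of the triple is bijective. -/
theorem HasCoh.shift (hTR : ∀ n, T n ≤ R n) (hRS : ∀ n, R n ≤ S n)
    (dd : ∀ n x, d (n + 1) (d n x) = 0) {h : ℕ → ℕ} (H : HasCoh d S R h)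
    (H' : ∀ n, cocyc d S T n ≤ cobd d S T n) :
    HasCoh d R T (fun n => Nat.casesOn n 0 h) := by
  intro n
  cases n with
  | zero =>
    have : cocyc d R T 0 ≤ cobd d R T 0 := fun x hx => by
      have := H' 0 ⟨hRS _ hx.1, hx.2⟩
      rwa [mem_cobd_zero] at this ⊢
    have := subsingleton_of_le this
    exact ⟨inferInstance, Module.finrank_zero_of_subsingleton⟩
  | succ n =>
    let f0 : cocyc d S R n →ₗ[ℂ] cocyc d R T (n + 1) :=
      ((d n).comp (cocyc d S R n).subtype).codRestrict _
        (fun x => ⟨x.2.2, by simp [dd]⟩)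
    let f : Coh d S R n →ₗ[ℂ] Coh d R T (n + 1) := Submodule.mapQ _ _ f0 (by
      rintro ⟨x, hx⟩ h
      change x ∈ cobd d S R n at h
      change d n x ∈ cobd d R T (n + 1)
      rw [mem_cobd_succ]
      cases n with
      | zero => exact ⟨x, mem_cobd_zero.1 h, by simp⟩
      | succ n =>
        obtain ⟨y, hy, hxy⟩ := mem_cobd_succ.1 h
        exact ⟨_, hxy, by simp [dd]⟩)
    have hf : Function.Bijective f := by
      constructor
      · refine mapQ_injective ?_
        rintro ⟨x, hx⟩
        change d n x ∈ cobd d R T (n + 1) → x ∈ cobd d S R n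
        rw [mem_cobd_succ]
        rintro ⟨y, hy, hxy⟩
        have h1 : x - y ∈ cocyc d S T n :=
          ⟨(S n).sub_mem hx.1 (hRS _ hy), by simpa using hxy⟩
        have h2 := cobd_mono_right (d := d) (S := S) hTR n (H' n h1)
        have h3 : y ∈ cobd d S R n := Submodule.mem_sup_left hy
        simpa using (cobd d S R n).add_mem h2 h3
      · refine mapQ_surjective ?_
        rintro ⟨x, hx⟩
        obtain ⟨y, hy, hxy⟩ := mem_cobd_succ.1 (H' (n + 1) ⟨hRS _ hx.1, hx.2⟩)
        have hyR : d n y ∈ R (n + 1) := by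
          have := (R (n + 1)).sub_mem hx.1 (hTR _ hxy)
          simpa using this
        refine ⟨⟨y, hy, hyR⟩, ?_⟩
        change d n y - x ∈ cobd d R T (n + 1)
        refine Submodule.mem_sup_left ?_
        rw [← neg_sub]
        exact (T (n + 1)).neg_mem hxy
    have := (H n).1
    let e := LinearEquiv.ofBijective f hf
    exact ⟨Module.Finite.equiv e, by rw [← e.finrank_eq]; exact (H n).2⟩

/-- A map of complexes that maps `S` to `S'`, onto modulo `T'`, such that `T` is the part of `S`
mapped to `T'`, induces isomorphisms in cohomology. -/
theorem hasCoh_iff_of_map {F' : ℕ → Type*} [∀ n, AddCommGroup (F' n)] [∀ n, Module ℂ (F' n)]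
    {d' : ∀ n, F' n →ₗ[ℂ] F' (n + 1)} {S' T' : ∀ n, Submodule ℂ (F' n)}
    (p : ∀ n, F n →ₗ[ℂ] F' n) (hp : ∀ n x, p (n + 1) (d n x) = d' n (p n x))
    (dS : ∀ n, S n ≤ (S (n + 1)).comap (d n)) (dT' : ∀ n, T' n ≤ (T' (n + 1)).comap (d' n))
    (hS : ∀ n, ∀ x ∈ S n, p n x ∈ S' n) (hT : ∀ n, ∀ x ∈ S n, x ∈ T n ↔ p n x ∈ T' n)
    (hTS : ∀ n, T n ≤ S n)
    (hsurj : ∀ n, ∀ y ∈ S' n, ∃ x ∈ S n, p n x - y ∈ T' n) {h : ℕ → ℕ} :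
    HasCoh d S T h ↔ HasCoh d' S' T' h := by
  have key : ∀ n, Nonempty (Coh d S T n ≃ₗ[ℂ] Coh d' S' T' n) := by
    intro n
    let f0 : cocyc d S T n →ₗ[ℂ] cocyc d' S' T' n :=
      ((p n).comp (cocyc d S T n).subtype).codRestrict _
        (fun x => ⟨hS n _ x.2.1, by
          have := (hT (n + 1) _ (dS n x.2.1)).1 x.2.2
          rw [hp] at this
          exact this⟩)
    have hcob : ∀ x ∈ S n, x ∈ cobd d S T n ↔ p n x ∈ cobd d' S' T' n := by
      intro x hx
      cases n with
      | zero =>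
        rw [mem_cobd_zero, mem_cobd_zero, hT 0 x hx]
      | succ n =>
        rw [mem_cobd_succ, mem_cobd_succ]
        constructor
        · rintro ⟨y, hy, hxy⟩
          refine ⟨p n y, hS _ _ hy, ?_⟩
          have := (hT (n + 1) _ (hTS _ hxy)).1 hxy
          simpa [hp] using this
        · rintro ⟨y', hy', hxy⟩
          obtain ⟨y, hy, hyy⟩ := hsurj n y' hy'
          refine ⟨y, hy, ?_⟩
          refine (hT (n + 1) _ ((S (n + 1)).sub_mem hx (dS n hy))).2 ?_
          have := (T' (n + 1)).sub_mem hxy (dT' n hyy)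
          simpa [hp] using this
    let f : Coh d S T n →ₗ[ℂ] Coh d' S' T' n := Submodule.mapQ _ _ f0
      (fun x hx => (hcob x.1 x.2.1).1 hx)
    refine ⟨LinearEquiv.ofBijective f ⟨?_, ?_⟩⟩
    · refine mapQ_injective ?_
      rintro ⟨x, hx⟩
      exact (hcob x hx.1).2
    · refine mapQ_surjective ?_
      rintro ⟨y, hy⟩
      obtain ⟨x, hx, hxy⟩ := hsurj n y hy.1
      have hxc : x ∈ cocyc d S T n := by
        refine ⟨hx, (hT (n + 1) _ (dS n hx)).2 ?_⟩
        have := (T' (n + 1)).add_mem (dT' n hxy) hy.2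
        simpa [hp] using this
      refine ⟨⟨x, hxc⟩, ?_⟩
      exact Submodule.mem_sup_left hxy
  constructor
  · intro H n
    obtain ⟨e⟩ := key n
    have := (H n).1
    exact ⟨Module.Finite.equiv e, by rw [← e.finrank_eq]; exact (H n).2⟩
  · intro H n
    obtain ⟨e⟩ := key n
    have := (H n).1
    exact ⟨Module.Finite.equiv e.symm, by rw [e.finrank_eq]; exact (H n).2⟩

end RelCoh

/-! ### The prism operator on cochains -/

namespace AlexanderSpanier

section Prism

variable {Y Z : Type*}

/-- The alternating sum over the faces, for cochains on tuples of any length. -/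
def altFaces (m : ℕ) (ψ : (Fin m → Y) → ℂ) (x : Fin (m + 1) → Y) : ℂ :=
  ∑ i : Fin (m + 1), (-1 : ℂ) ^ (i : ℕ) * ψ (fun j => x (i.succAbove j))

theorem altFaces_sub (m : ℕ) (ψ ψ' : (Fin m → Y) → ℂ) (x : Fin (m + 1) → Y) :
    altFaces m (fun y => ψ y - ψ' y) x = altFaces m ψ x - altFaces m ψ' x := by
  simp [altFaces, mul_sub, Finset.sum_sub_distrib]

theorem altFaces_succ (m : ℕ) (ψ : (Fin (m + 1) → Y) → ℂ) (x : Fin (m + 2) → Y) :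
    altFaces (m + 1) ψ x =
      ψ (Fin.tail x) - altFaces m (fun y => ψ (Fin.cons (x 0) y)) (Fin.tail x) := by
  rw [altFaces, Fin.sum_univ_succ, altFaces, sub_eq_add_neg, ← Finset.sum_neg_distrib]
  congr 1
  · simp only [Fin.val_zero, pow_zero, one_mul, Fin.zero_succAbove]
    rfl
  · refine Finset.sum_congr rfl fun i _ => ?_
    have : (fun j => x (i.succ.succAbove j)) =
        Fin.cons (x 0) fun j => Fin.tail x (i.succAbove j) := by
      funext j
      refine Fin.cases ?_ (fun j => ?_) j
      · simp
      · simp [Fin.tail]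
    rw [this, Fin.val_succ, pow_succ]
    ring

/-- The prism operator, the alternating sum over `i` of the values of a cochain on
`(f x₀, …, f xᵢ, g xᵢ, …, g xₘ₋₁)`. -/
def prism (f g : Y → Z) : ∀ m, ((Fin (m + 1) → Z) → ℂ) → (Fin m → Y) → ℂ
  | 0, _, _ => 0
  | m + 1, ψ, x => ψ (Fin.cons (f (x 0)) (g ∘ x)) -
      prism f g m (fun y => ψ (Fin.cons (f (x 0)) y)) (Fin.tail x)

theorem prism_sub (f g : Y → Z) (m : ℕ) (ψ ψ' : (Fin (m + 1) → Z) → ℂ) (x : Fin m → Y) :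
    prism f g m (fun y => ψ y - ψ' y) x = prism f g m ψ x - prism f g m ψ' x := by
  induction m with
  | zero => simp [prism]
  | succ m ih =>
    simp only [prism, ih (fun y => ψ (Fin.cons (f (x 0)) y))]
    ring

theorem altFaces_prism_add (f g : Y → Z) (m : ℕ) (ψ : (Fin (m + 1) → Z) → ℂ)
    (x : Fin (m + 1) → Y) :
    altFaces m (prism f g m ψ) x + prism f g (m + 1) (altFaces (m + 1) ψ) x =
      ψ (g ∘ x) - ψ (f ∘ x) := by
  induction m with
  | zero =>
    have h : ∀ y : Fin 1 → Z, altFaces 0 (fun z => ψ (Fin.cons (f (x 0)) z)) y = ψ (f ∘ x) := by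
      intro y
      simp only [altFaces, Fin.sum_univ_succ, Finset.univ_eq_empty, Finset.sum_empty, Fin.val_zero,
        pow_zero, one_mul, add_zero]
      congr 1
      funext j
      rw [Fin.fin_one_eq_zero j]
      rfl
    have h' : altFaces 0 (prism f g 0 ψ) x = 0 := by simp [altFaces, prism]
    rw [h', prism, altFaces_succ]
    simp only [prism, sub_zero, Fin.tail_cons, Fin.cons_zero, h, zero_add]
  | succ m ih =>
    have e1 : ∀ y : Fin (m + 2) → Z, altFaces (m + 2) ψ (Fin.cons (f (x 0)) y) =
        ψ y - altFaces (m + 1) (fun z => ψ (Fin.cons (f (x 0)) z)) y := by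
      intro y
      rw [altFaces_succ, Fin.tail_cons, Fin.cons_zero]
    have e2 : ∀ y : Fin m → Y, prism f g (m + 1) ψ (Fin.cons (x 0) y) =
        ψ (Fin.cons (f (x 0)) (Fin.cons (g (x 0)) (g ∘ y))) -
          prism f g m (fun z => ψ (Fin.cons (f (x 0)) z)) y := by
      intro y
      rw [prism, Fin.comp_cons, Fin.tail_cons, Fin.cons_zero]
    have e3 : (Fin.cons (f (x 0)) (f ∘ Fin.tail x) : Fin (m + 2) → Z) = f ∘ x := by
      rw [← Fin.comp_cons]
      exact congrArg (f ∘ ·) (Fin.cons_self_tail x)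
    have e4 : altFaces m (fun y => ψ (Fin.cons (f (x 0)) (Fin.cons (g (x 0)) (g ∘ y))))
        (Fin.tail x) = altFaces m (fun y => ψ (Fin.cons (f (x 0)) (Fin.cons (g (x 0)) y)))
        (Fin.tail (g ∘ x)) := rfl
    have e5 : g ∘ Fin.tail x = Fin.tail (g ∘ x) := rfl
    have h := ih (fun z => ψ (Fin.cons (f (x 0)) z)) (Fin.tail x)
    rw [e3, e5] at h
    have e6 : prism f g (m + 2) (altFaces (m + 2) ψ) x =
        altFaces (m + 2) ψ (Fin.cons (f (x 0)) (g ∘ x)) -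
          prism f g (m + 1) (fun y => altFaces (m + 2) ψ (Fin.cons (f (x 0)) y)) (Fin.tail x) := rfl
    rw [altFaces_succ, e6]
    simp only [e1, e2, altFaces_sub, prism_sub]
    rw [altFaces_succ m _ (g ∘ x), e4]
    simp only [Function.comp_apply]
    linear_combination h

/-- The values of the prism operator only involve tuples of points `f xᵢ`, `g xᵢ`, with first
entry `f x₀`. -/
theorem prism_eq_zero (f g : Y → Z) {m : ℕ} {ψ : (Fin (m + 2) → Z) → ℂ} {x : Fin (m + 1) → Y}
    (h : ∀ y : Fin (m + 2) → Z, y 0 = f (x 0) → (∀ i, ∃ j, y i = f (x j) ∨ y i = g (x j)) →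
      ψ y = 0) : prism f g (m + 1) ψ x = 0 := by
  have aux : ∀ (m : ℕ) (ψ : (Fin (m + 1) → Z) → ℂ) (x : Fin m → Y),
      (∀ y : Fin (m + 1) → Z, (∀ i, ∃ j, y i = f (x j) ∨ y i = g (x j)) → ψ y = 0) →
      prism f g m ψ x = 0 := by
    intro m
    induction m with
    | zero => intros; rfl
    | succ m ih =>
      intro ψ x h
      rw [prism, h, ih, sub_zero]
      · intro y hy
        refine h _ (Fin.cases ⟨0, Or.inl rfl⟩ fun i => ?_)
        obtain ⟨j, hj⟩ := hy i
        exact ⟨j.succ, hj⟩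
      · exact Fin.cases ⟨0, Or.inl rfl⟩ fun i => ⟨i, Or.inr rfl⟩
  rw [prism, h _ rfl (Fin.cases ⟨0, Or.inl rfl⟩ fun i => ⟨i, Or.inr rfl⟩), aux, sub_zero]
  intro y hy
  refine h _ rfl (Fin.cases ⟨0, Or.inl rfl⟩ fun i => ?_)
  obtain ⟨j, hj⟩ := hy i
  exact ⟨j.succ, hj⟩

end Prism

/-! ### Compactly supported cochains -/

section Support

variable {Y Z : Type*}

theorem coboundary_apply (n : ℕ) (φ : Fn Y n) (x : Fin (n + 2) → Y) :
    coboundary Y n φ x = altFaces (n + 1) φ x := rfl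

/-- The pullback of cochains along a map of sets. -/
def pull (f : Y → Z) (n : ℕ) : Fn Z n →ₗ[ℂ] Fn Y n := LinearMap.funLeft ℂ ℂ (fun x => f ∘ x)

theorem pull_apply (f : Y → Z) (n : ℕ) (φ : Fn Z n) (x : Fin (n + 1) → Y) :
    pull f n φ x = φ (f ∘ x) := rfl

theorem pull_coboundary (f : Y → Z) (n : ℕ) (φ : Fn Z n) :
    pull f (n + 1) (coboundary Z n φ) = coboundary Y n (pull f n φ) := rfl

/-- The prism operator as a chain homotopy. -/
def homotopy (f g : Y → Z) (n : ℕ) (φ : Fn Z (n + 1)) : Fn Y n := prism f g (n + 1) φ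

theorem homotopy_zero (f g : Y → Z) (φ : Fn Z 0) :
    homotopy f g 0 (coboundary Z 0 φ) = pull g 0 φ - pull f 0 φ := by
  funext x
  have h := altFaces_prism_add f g 0 φ x
  have h' : altFaces 0 (prism f g 0 φ) x = 0 := by simp [altFaces, prism]
  rw [h', zero_add] at h
  exact h

theorem homotopy_succ (f g : Y → Z) (n : ℕ) (φ : Fn Z (n + 1)) :
    coboundary Y n (homotopy f g n φ) + homotopy f g (n + 1) (coboundary Z (n + 1) φ) =
      pull g (n + 1) φ - pull f (n + 1) φ := by
  funext x
  exact altFaces_prism_add f g (n + 1) φ x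

open Classical in
/-- The cochain `φ`, made zero on the tuples not contained in `K`. -/
def truncate (K : Set Y) {n : ℕ} (φ : Fn Y n) : Fn Y n := fun x => if ∀ i, x i ∈ K then φ x else 0

theorem truncate_of_notMem {K : Set Y} {n : ℕ} (φ : Fn Y n) {x : Fin (n + 1) → Y} (i)
    (hi : x i ∉ K) : truncate K φ x = 0 :=
  if_neg fun h => hi (h i)

variable [TopologicalSpace Y]

/-- The cochain `φ` vanishes on the tuples of points close to `y`. -/
def ZeroAt {n : ℕ} (φ : Fn Y n) (y : Y) : Prop :=
  ∃ U : Set Y, IsOpen U ∧ y ∈ U ∧ ∀ x : Fin (n + 1) → Y, (∀ i, x i ∈ U) → φ x = 0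

theorem ZeroAt.add {n : ℕ} {φ ψ : Fn Y n} {y : Y} (hφ : ZeroAt φ y) (hψ : ZeroAt ψ y) :
    ZeroAt (φ + ψ) y := by
  obtain ⟨U, hU, hyU, h1⟩ := hφ
  obtain ⟨V, hV, hyV, h2⟩ := hψ
  exact ⟨U ∩ V, hU.inter hV, ⟨hyU, hyV⟩, fun x hx => by
    simp [h1 x fun i => (hx i).1, h2 x fun i => (hx i).2]⟩

theorem ZeroAt.smul {n : ℕ} {φ : Fn Y n} {y : Y} (c : ℂ) (hφ : ZeroAt φ y) :
    ZeroAt (c • φ) y := by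
  obtain ⟨U, hU, hyU, h1⟩ := hφ
  exact ⟨U, hU, hyU, fun x hx => by simp [h1 x hx]⟩

theorem ZeroAt.sub {n : ℕ} {φ ψ : Fn Y n} {y : Y} (hφ : ZeroAt φ y) (hψ : ZeroAt ψ y) :
    ZeroAt (φ - ψ) y := by
  rw [sub_eq_add_neg, ← neg_one_smul ℂ]
  exact hφ.add (hψ.smul _)

theorem ZeroAt.coboundary {n : ℕ} {φ : Fn Y n} {y : Y} (hφ : ZeroAt φ y) :
    ZeroAt (coboundary Y n φ) y := by
  obtain ⟨U, hU, hyU, h1⟩ := hφ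
  refine ⟨U, hU, hyU, fun x hx => ?_⟩
  rw [coboundary_apply, altFaces]
  exact Finset.sum_eq_zero fun i _ => by rw [h1 _ fun j => hx _, mul_zero]

/-- The support of a cochain: the points near which it does not vanish. -/
def csupp {n : ℕ} (φ : Fn Y n) : Set Y := {y | ¬ ZeroAt φ y}

theorem isClosed_csupp {n : ℕ} (φ : Fn Y n) : IsClosed (csupp φ) := by
  rw [← isOpen_compl_iff, isOpen_iff_forall_mem_open]
  intro y hy
  obtain ⟨U, hU, hyU, h⟩ := not_not.1 hy
  exact ⟨U, fun z hz => not_not.2 ⟨U, hU, hz, h⟩, hU, hyU⟩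

theorem isCompact_csupp {n : ℕ} {φ : Fn Y n} {K : Set Y} (hK : IsCompact K)
    (h : ∀ y ∉ K, ZeroAt φ y) : IsCompact (csupp φ) :=
  hK.of_isClosed_subset (isClosed_csupp φ) fun y hy => by_contra fun hyK => hy (h y hyK)

/-- The cochains with compact support contained in `O`. -/
def supp (O : Set Y) (n : ℕ) : Submodule ℂ (Fn Y n) where
  carrier := {φ | IsCompact (csupp φ) ∧ ∀ y ∉ O, ZeroAt φ y}
  zero_mem' := ⟨isCompact_csupp isCompact_empty fun y _ => (locallyZero Y n).zero_mem y,
    fun y _ => (locallyZero Y n).zero_mem y⟩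
  add_mem' {φ ψ} hφ hψ := by
    refine ⟨isCompact_csupp (hφ.1.union hψ.1) fun y hy => ?_, fun y hy =>
      (hφ.2 y hy).add (hψ.2 y hy)⟩
    rw [Set.mem_union, not_or] at hy
    exact (not_not.1 hy.1).add (not_not.1 hy.2)
  smul_mem' c φ hφ :=
    ⟨isCompact_csupp hφ.1 fun y hy => (not_not.1 hy).smul c, fun y hy => (hφ.2 y hy).smul c⟩

theorem mem_supp {O : Set Y} {n : ℕ} {φ : Fn Y n} :
    φ ∈ supp O n ↔ IsCompact (csupp φ) ∧ ∀ y ∉ O, ZeroAt φ y := Iff.rfl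

theorem mem_supp_univ {n : ℕ} {φ : Fn Y n} :
    φ ∈ supp Set.univ n ↔ IsCompact (csupp φ) := by
  simp [mem_supp]

theorem locallyZero_le_supp (O : Set Y) (n : ℕ) : locallyZero Y n ≤ supp O n := fun _ hφ =>
  ⟨isCompact_csupp isCompact_empty fun y _ => hφ y, fun y _ => hφ y⟩

theorem supp_le_comap (O : Set Y) (n : ℕ) : supp O n ≤ (supp O (n + 1)).comap (coboundary Y n) :=
  fun _ hφ => ⟨isCompact_csupp hφ.1 fun _ hy => (not_not.1 hy).coboundary,
    fun y hy => (hφ.2 y hy).coboundary⟩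

/-- Truncating a cochain to a neighbourhood of its support does not change it near the diagonal. -/
theorem zeroAt_truncate_sub {K K' : Set Y} (hK : K ⊆ interior K') {n : ℕ} {φ : Fn Y n}
    (h : ∀ y ∉ K, ZeroAt φ y) (y : Y) : ZeroAt (truncate K' φ - φ) y := by
  by_cases hy : y ∈ interior K'
  · refine ⟨interior K', isOpen_interior, hy, fun x hx => ?_⟩
    have : ∀ i, x i ∈ K' := fun i => interior_subset (hx i)
    simp [truncate, this]
  · obtain ⟨U, hU, hyU, h1⟩ := h y fun hyK => hy (hK hyK)
    exact ⟨U, hU, hyU, fun x hx => by simp [truncate, h1 x hx]⟩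

theorem exists_truncate [LocallyCompactSpace Y] {n : ℕ} {φ : Fn Y n} (hφ : IsCompact (csupp φ)) :
    ∃ K : Set Y, IsCompact K ∧ truncate K φ - φ ∈ locallyZero Y n := by
  obtain ⟨K, hK, hsub⟩ := exists_compact_superset hφ
  exact ⟨K, hK, zeroAt_truncate_sub hsub fun y hy => not_not.1 hy⟩

end Support

/-- The cohomology with compact supports of `Y` is finite dimensional in every degree, of dimension
`h n` in degree `n`. -/
def HasHc (Y : Type*) [TopologicalSpace Y] (h : ℕ → ℕ) : Prop :=
  RelCoh.HasCoh (coboundary Y) (supp Set.univ) (locallyZero Y) h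

end AlexanderSpanier

namespace AlexanderSpanier

open RelCoh Topology

/-! ### A closed subspace and its complement -/

/-- A closed subset of a metric space is the image of a retraction that is continuous at the points
of the subset. -/
theorem exists_retraction {Z : Type*} [MetricSpace Z] {A : Set Z} (hA : IsClosed A)
    (hne : A.Nonempty) :
    ∃ r : Z → Z, (∀ x, r x ∈ A) ∧ (∀ x ∈ A, r x = x) ∧ ∀ a ∈ A, ContinuousAt r a := by
  classical
  have h : ∀ x, ∃ y ∈ A, (x ∈ A → y = x) ∧ dist x y ≤ 2 * Metric.infDist x A := by
    intro x
    by_cases hx : x ∈ A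
    · exact ⟨x, hx, fun _ => rfl, by simp [Metric.infDist_nonneg]⟩
    by_cases h0 : 0 < Metric.infDist x A
    · obtain ⟨y, hy, hd⟩ := (Metric.infDist_lt_iff hne).1 (by linarith :
        Metric.infDist x A < 2 * Metric.infDist x A)
      exact ⟨y, hy, fun h => absurd h hx, hd.le⟩
    · refine absurd ((hA.mem_iff_infDist_zero hne).2 ?_) hx
      exact le_antisymm (not_lt.1 h0) Metric.infDist_nonneg
  choose r hrA hr hd using h
  refine ⟨r, hrA, hr, fun a ha => ?_⟩
  rw [Metric.continuousAt_iff]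
  intro ε hε
  refine ⟨ε / 3, by positivity, fun x hx => ?_⟩
  rw [hr a ha]
  have h1 := hd x
  have h2 := Metric.infDist_le_dist_of_mem (x := x) ha
  have h3 := dist_triangle_left (r x) a x
  linarith

section Pair

variable {Z A O : Type*} [TopologicalSpace Z] [TopologicalSpace A] [TopologicalSpace O]

/-- The cochains with compact support that vanish near the diagonal of `A`. -/
def suppRel (i : A → Z) (n : ℕ) : Submodule ℂ (Fn Z n) :=
  supp Set.univ n ⊓ (locallyZero A n).comap (pull i n)

theorem zeroAt_pull {i : A → Z} (hi : Continuous i) {n : ℕ} {φ : Fn Z n} {a : A}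
    (h : ZeroAt φ (i a)) : ZeroAt (pull i n φ) a := by
  obtain ⟨U, hU, hyU, h1⟩ := h
  exact ⟨i ⁻¹' U, hU.preimage hi, hyU, fun x hx => h1 _ hx⟩

theorem zeroAt_of_pull {j : O → Z} (hj : IsOpenEmbedding j) {n : ℕ} {φ : Fn Z n} {a : O}
    (h : ZeroAt (pull j n φ) a) : ZeroAt φ (j a) := by
  obtain ⟨U, hU, hyU, h1⟩ := h
  refine ⟨j '' U, hj.isOpenMap _ hU, ⟨a, hyU, rfl⟩, fun x hx => ?_⟩
  choose y hy hyx using hx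
  have : x = j ∘ y := by funext k; simp [hyx]
  rw [this]
  exact h1 y hy

theorem isCompact_csupp_pull {i : A → Z} (hi : IsClosedEmbedding i) {n : ℕ} {φ : Fn Z n}
    (h : IsCompact (csupp φ)) : IsCompact (csupp (pull i n φ)) :=
  isCompact_csupp (hi.isCompact_preimage h) fun _ ha =>
    zeroAt_pull hi.continuous (not_not.1 ha)

/-- The compactly supported cochains modulo those that vanish near the diagonal of a closed
subspace compute the cohomology with compact supports of that subspace. -/
theorem hasCoh_suppRel_iff {i : A → Z} (hi : IsClosedEmbedding i) {h : ℕ → ℕ} :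
    HasCoh (coboundary Z) (supp Set.univ) (suppRel i) h ↔ HasHc A h := by
  refine hasCoh_iff_of_map (fun n => pull i n) (fun n x => pull_coboundary i n x)
    (fun n => supp_le_comap _ n) (fun n => locallyZero_le A n) ?_ ?_ (fun n => inf_le_left) ?_
  · intro n φ hφ
    exact mem_supp_univ.2 (isCompact_csupp_pull hi hφ.1)
  · intro n φ hφ
    exact ⟨fun h => h.2, fun h => ⟨hφ, h⟩⟩
  · intro n ψ hψ
    -- extension by zero
    let φ : Fn Z n := Function.extend (fun x : Fin (n + 1) → A => i ∘ x) ψ 0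
    have hinj : Function.Injective (fun x : Fin (n + 1) → A => i ∘ x) :=
      hi.injective.comp_left
    have hφ : ∀ x, φ (i ∘ x) = ψ x := fun x => hinj.extend_apply ψ 0 x
    have hφ0 : ∀ x k, x k ∉ Set.range i → φ x = 0 := by
      intro x k hk
      refine Function.extend_apply' _ _ _ ?_
      rintro ⟨y, rfl⟩
      exact hk ⟨y k, rfl⟩
    refine ⟨φ, mem_supp_univ.2 (isCompact_csupp (hψ.1.image hi.continuous) fun z hz => ?_), ?_⟩
    · by_cases hzr : z ∈ Set.range i
      · obtain ⟨a, rfl⟩ := hzr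
        have ha : ZeroAt ψ a := by_contra fun ha => hz ⟨a, ha, rfl⟩
        obtain ⟨U, hU, haU, h1⟩ := ha
        obtain ⟨W, hW, rfl⟩ := hi.isInducing.isOpen_iff.1 hU
        refine ⟨W, hW, haU, fun x hx => ?_⟩
        by_cases hxr : ∀ k, x k ∈ Set.range i
        · choose y hy using hxr
          have : x = i ∘ y := by funext k; simp [hy]
          rw [this, hφ]
          exact h1 y fun k => by rw [Set.mem_preimage, hy]; exact hx k
        · push Not at hxr
          obtain ⟨k, hk⟩ := hxr
          exact hφ0 x k hk
      · exact ⟨(Set.range i)ᶜ, hi.isClosed_range.isOpen_compl, hzr, fun x hx => hφ0 x 0 (hx 0)⟩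
    · have : pull i n φ - ψ = 0 := by
        funext x
        simp [pull_apply, hφ]
      rw [this]
      exact Submodule.zero_mem _

/-- The cochains with compact support in an open subspace compute its cohomology with compact
supports. -/
theorem hasCoh_supp_range_iff [T2Space Z] [LocallyCompactSpace O] {j : O → Z}
    (hj : IsOpenEmbedding j) {h : ℕ → ℕ} :
    HasCoh (coboundary Z) (supp (Set.range j)) (locallyZero Z) h ↔ HasHc O h := by
  refine hasCoh_iff_of_map (fun n => pull j n) (fun n x => pull_coboundary j n x)
    (fun n => supp_le_comap _ n) (fun n => locallyZero_le O n) ?_ ?_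
    (fun n => locallyZero_le_supp _ n) ?_
  · intro n φ hφ
    refine mem_supp_univ.2 (isCompact_csupp (hj.isInducing.isCompact_preimage' hφ.1 ?_) ?_)
    · intro z hz
      by_contra hzj
      exact hz (hφ.2 z hzj)
    · exact fun a ha => zeroAt_pull hj.continuous (not_not.1 ha)
  · intro n φ hφ
    constructor
    · exact fun h a => zeroAt_pull hj.continuous (h (j a))
    · intro h z
      by_cases hz : z ∈ Set.range j
      · obtain ⟨a, rfl⟩ := hz
        exact zeroAt_of_pull hj (h a)
      · exact hφ.2 z hz
  · intro n ψ hψ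
    obtain ⟨K, hK, hKψ⟩ := exists_truncate hψ.1
    -- extension by zero of the truncated cochain
    let φ : Fn Z n := Function.extend (fun x : Fin (n + 1) → O => j ∘ x) (truncate K ψ) 0
    have hinj : Function.Injective (fun x : Fin (n + 1) → O => j ∘ x) :=
      hj.injective.comp_left
    have hφ : pull j n φ = truncate K ψ := by
      funext x
      exact hinj.extend_apply (truncate K ψ) (0 : Fn Z n) x
    have hφ0 : ∀ x k, x k ∉ j '' K → φ x = 0 := by
      intro x k hk
      by_cases hx : ∃ y : Fin (n + 1) → O, j ∘ y = x
      · obtain ⟨y, rfl⟩ := hx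
        refine (congrFun hφ y).trans ?_
        exact truncate_of_notMem ψ k fun h => hk ⟨_, h, rfl⟩
      · exact Function.extend_apply' _ _ _ hx
    have hzero : ∀ z ∉ j '' K, ZeroAt φ z := fun z hz =>
      ⟨(j '' K)ᶜ, (hK.image hj.continuous).isClosed.isOpen_compl, hz, fun x hx => hφ0 x 0 (hx 0)⟩
    refine ⟨φ, ⟨isCompact_csupp (hK.image hj.continuous) hzero, fun z hz => hzero z ?_⟩, ?_⟩
    · rintro ⟨a, -, rfl⟩
      exact hz ⟨a, rfl⟩
    · rw [hφ]
      exact hKψ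

theorem supp_le_suppRel {i : A → Z} (hi : Continuous i) {W : Set Z} (hW : Disjoint W (Set.range i))
    (n : ℕ) : supp W n ≤ suppRel i n := fun _ hφ =>
  ⟨mem_supp_univ.2 hφ.1, fun a => zeroAt_pull hi
    (hφ.2 _ fun h => Set.disjoint_left.1 hW h ⟨a, rfl⟩)⟩

/-- Cochains vanishing on `A` have the same cohomology as cochains vanishing near `A`: a
retraction to `A`, continuous at the points of `A`, gives a homotopy. -/
theorem suppRel_acyclic {Z : Type*} [MetricSpace Z] [LocallyCompactSpace Z] {i : A → Z}
    (hi : IsClosedEmbedding i) (n : ℕ) :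
    cocyc (coboundary Z) (suppRel i) (supp (Set.range i)ᶜ) n ≤
      cobd (coboundary Z) (suppRel i) (supp (Set.range i)ᶜ) n := by
  intro φ hφ
  rcases isEmpty_or_nonempty A with hA | hA
  · refine Submodule.mem_sup_left ⟨hφ.1.1.1, fun y hy => ?_⟩
    simp at hy
  obtain ⟨r, hrA, hrid, hrc⟩ := exists_retraction hi.isClosed_range (Set.range_nonempty i)
  obtain ⟨K, hK, hKφ⟩ := exists_truncate hφ.1.1.1
  have hle := supp_le_suppRel (Z := Z) hi.continuous
    (disjoint_compl_left (a := Set.range i))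
  suffices h : truncate K φ ∈ cobd (coboundary Z) (suppRel i) (supp (Set.range i)ᶜ) n by
    have h2 : truncate K φ - φ ∈ cobd (coboundary Z) (suppRel i) (supp (Set.range i)ᶜ) n :=
      Submodule.mem_sup_left (locallyZero_le_supp _ n hKφ)
    simpa using Submodule.sub_mem _ h h2
  have hφ' : truncate K φ ∈ cocyc (coboundary Z) (suppRel i) (supp (Set.range i)ᶜ) n := by
    have h1 : truncate K φ - φ ∈ cocyc (coboundary Z) (suppRel i) (supp (Set.range i)ᶜ) n :=
      ⟨hle n (locallyZero_le_supp _ n hKφ),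
        locallyZero_le_supp _ _ (locallyZero_le Z n hKφ)⟩
    simpa using Submodule.add_mem _ h1 hφ
  have hvan : ∀ x k, x k ∉ K → truncate K φ x = 0 := fun x k => truncate_of_notMem φ k
  generalize truncate K φ = ψ at hφ' hvan
  -- The homotopy `h` between the identity and `r` gives `ψ = r^* ψ - h (δ ψ) - δ (h ψ)`, where the
  -- last term is a relative coboundary and the other terms vanish near `A`.
  -- the pullback along the retraction vanishes near `A`
  have hpull : ∀ y ∈ Set.range i, ZeroAt (pull r n ψ) y := by
    rintro _ ⟨a, rfl⟩
    obtain ⟨U, hU, haU, h1⟩ := hφ'.1.2 a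
    obtain ⟨W, hW, rfl⟩ := hi.isInducing.isOpen_iff.1 hU
    have hra : r ⁻¹' W ∈ 𝓝 (i a) := by
      refine hrc _ ⟨a, rfl⟩ (hW.mem_nhds ?_)
      rw [hrid _ ⟨a, rfl⟩]
      exact haU
    obtain ⟨W', hW'W, hW', haW'⟩ := mem_nhds_iff.1 hra
    refine ⟨W', hW', haW', fun x hx => ?_⟩
    rw [pull_apply]
    choose y hy using fun k => hrA (x k)
    have : r ∘ x = i ∘ y := by funext k; simp [hy]
    rw [this]
    refine h1 y fun k => ?_
    rw [Set.mem_preimage, hy]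
    exact hW'W (hx k)
  -- the homotopy preserves vanishing near points of `A`
  have hhom : ∀ (m : ℕ) (χ : Fn Z (m + 1)), (∀ y ∈ Set.range i, ZeroAt χ y) →
      ∀ y ∈ Set.range i, ZeroAt (homotopy id r m χ) y := by
    rintro m χ hχ _ ⟨a, rfl⟩
    obtain ⟨W, hW, haW, h1⟩ := hχ _ ⟨a, rfl⟩
    have hra : r ⁻¹' W ∈ 𝓝 (i a) := by
      refine hrc _ ⟨a, rfl⟩ (hW.mem_nhds ?_)
      rw [hrid _ ⟨a, rfl⟩]
      exact haW
    obtain ⟨W', hW'W, hW', haW'⟩ := mem_nhds_iff.1 hra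
    refine ⟨W ∩ W', hW.inter hW', ⟨haW, haW'⟩, fun x hx => prism_eq_zero _ _ fun y _ hy => ?_⟩
    refine h1 y fun k => ?_
    obtain ⟨l, hl | hl⟩ := hy k
    · rw [hl]; exact (hx l).1
    · rw [hl]; exact hW'W (hx l).2
  cases n with
  | zero =>
    rw [mem_cobd_zero]
    refine ⟨hφ'.1.1.1, fun y hy => ?_⟩
    rw [Set.notMem_compl_iff] at hy
    have h0 := homotopy_zero id r ψ
    have : ψ = pull r 0 ψ - homotopy id r 0 (coboundary Z 0 ψ) := by
      rw [h0, sub_sub_cancel]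
      rfl
    rw [this]
    refine (hpull y hy).sub (hhom 0 _ (fun z hz => hφ'.2.2 z ?_) y hy)
    rwa [Set.notMem_compl_iff]
  | succ n =>
    have hD : homotopy id r n ψ ∈ suppRel i n := by
      refine ⟨mem_supp_univ.2 (isCompact_csupp hK fun y hy => ?_), fun a => ?_⟩
      · refine ⟨Kᶜ, hK.isClosed.isOpen_compl, hy, fun x hx => prism_eq_zero _ _ fun y h0 _ => ?_⟩
        refine hvan y 0 ?_
        rw [h0]
        exact hx 0
      · obtain ⟨U, hU, haU, h1⟩ := hφ'.1.2 a
        refine ⟨U, hU, haU, fun x hx => prism_eq_zero _ _ fun y _ hy => ?_⟩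
        have hy' : ∀ k, ∃ l, y k = i (x l) := by
          intro k
          obtain ⟨l, hl | hl⟩ := hy k
          · exact ⟨l, hl⟩
          · exact ⟨l, by rw [hl]; exact hrid _ ⟨_, rfl⟩⟩
        choose l hl using hy'
        have : y = i ∘ (x ∘ l) := funext hl
        rw [this]
        exact h1 _ fun k => hx _
    rw [mem_cobd_succ]
    refine ⟨-homotopy id r n ψ, Submodule.neg_mem _ hD, ?_⟩
    rw [map_neg, sub_neg_eq_add]
    refine ⟨?_, fun y hy => ?_⟩
    · exact (Submodule.add_mem _ hφ'.1.1 (supp_le_comap _ n hD.1)).1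
    · rw [Set.notMem_compl_iff] at hy
      have h1 := homotopy_succ id r n ψ
      have : ψ + coboundary Z n (homotopy id r n ψ) =
          pull r (n + 1) ψ - homotopy id r (n + 1) (coboundary Z (n + 1) ψ) := by
        rw [eq_sub_of_add_eq h1]
        change ψ + (pull r (n + 1) ψ - ψ - _) = _
        abel
      rw [this]
      refine (hpull y hy).sub (hhom (n + 1) _ (fun z hz => hφ'.2.2 z ?_) y hy)
      rwa [Set.notMem_compl_iff]

/-- If the cohomology groups with compact supports of a closed subspace and of its complement
vanish in odd degrees, then their dimensions add up. -/
theorem HasHc.add [TopologicalSpace.MetrizableSpace Z] [LocallyCompactSpace Z]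
    [LocallyCompactSpace O] {i : A → Z} {j : O → Z} (hi : IsClosedEmbedding i)
    (hj : IsOpenEmbedding j) (hij : Set.range j = (Set.range i)ᶜ) {h h' : ℕ → ℕ}
    (H : HasHc O h) (H' : HasHc A h') (ho : ∀ n, Odd n → h n = 0)
    (ho' : ∀ n, Odd n → h' n = 0) : HasHc Z (h + h') := by
  let := TopologicalSpace.metrizableSpaceMetric Z
  rw [← hasCoh_supp_range_iff hj, hij] at H
  rw [← hasCoh_suppRel_iff hi] at H'
  have hle := supp_le_suppRel (Z := Z) hi.continuous (disjoint_compl_left (a := Set.range i))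
  rw [hasCoh_iff_of_acyclic (fun n => locallyZero_le_supp _ n) hle
    (fun n x => coboundary_coboundary Z n x) (suppRel_acyclic hi)] at H
  exact HasCoh.add (fun n => (locallyZero_le_supp _ n).trans (hle n)) (fun n => inf_le_left)
    (fun n x => coboundary_coboundary Z n x) H H' ho ho'

/-- If the cohomology with compact supports of a space vanishes, then that of an open subspace is
that of the closed complement, shifted by one. -/
theorem HasHc.shift [TopologicalSpace.MetrizableSpace Z] [LocallyCompactSpace Z]
    [LocallyCompactSpace O] {i : A → Z} {j : O → Z} (hi : IsClosedEmbedding i)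
    (hj : IsOpenEmbedding j) (hij : Set.range j = (Set.range i)ᶜ) {h : ℕ → ℕ}
    (H : HasHc A h) (H' : ∀ n, cocyc (coboundary Z) (supp Set.univ) (locallyZero Z) n ≤
      cobd (coboundary Z) (supp Set.univ) (locallyZero Z) n) :
    HasHc O (fun n => Nat.casesOn n 0 h) := by
  let := TopologicalSpace.metrizableSpaceMetric Z
  rw [← hasCoh_supp_range_iff hj, hij]
  rw [← hasCoh_suppRel_iff hi] at H
  have hle := supp_le_suppRel (Z := Z) hi.continuous (disjoint_compl_left (a := Set.range i))
  rw [hasCoh_iff_of_acyclic (fun n => locallyZero_le_supp _ n) hle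
    (fun n x => coboundary_coboundary Z n x) (suppRel_acyclic hi)]
  exact HasCoh.shift (fun n => (locallyZero_le_supp _ n).trans (hle n)) (fun n => inf_le_left)
    (fun n x => coboundary_coboundary Z n x) H H'

end Pair

end AlexanderSpanier

namespace AlexanderSpanier

open RelCoh Topology

/-! ### Cohomology of Euclidean spaces -/

/-- A locally zero cochain that vanishes on all tuples outside of a compact set vanishes on all
tuples of sufficiently small diameter. -/
theorem exists_uniform_zero {Z : Type*} [MetricSpace Z] {n : ℕ} {χ : Fn Z n}
    (hχ : χ ∈ locallyZero Z n) {K : Set Z} (hK : IsCompact K)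
    (h : ∀ x, (∀ k, x k ∉ K) → χ x = 0) :
    ∃ ε > 0, ∀ x, (∀ k l, dist (x k) (x l) < ε) → χ x = 0 := by
  choose U hU hyU hzero using hχ
  obtain ⟨ε, hε, hL⟩ := lebesgue_number_lemma_of_metric (c := U) hK hU
    (fun y _ => Set.mem_iUnion.2 ⟨y, hyU y⟩)
  refine ⟨ε, hε, fun x hx => ?_⟩
  by_cases hxK : ∀ k, x k ∉ K
  · exact h x hxK
  · push Not at hxK
    obtain ⟨k, hk⟩ := hxK
    obtain ⟨y, hy⟩ := hL _ hk
    exact hzero y x fun l => hy (Metric.mem_ball.2 (hx l k))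

/-- If a proper metric space can be pushed off every compact set by iterating nonexpansive maps that
move points by arbitrarily small distances, then its cohomology with compact supports vanishes. -/
theorem acyclic_of_push {Z : Type*} [MetricSpace Z] [ProperSpace Z]
    (hT : ∀ ε > 0, ∃ T : Z → Z, (∀ x y, dist (T x) (T y) ≤ dist x y) ∧ (∀ x, dist (T x) x ≤ ε) ∧
      ∀ K : Set Z, IsCompact K → ∃ m : ℕ, ∀ x, T^[m] x ∉ K) (n : ℕ) :
    cocyc (coboundary Z) (supp Set.univ) (locallyZero Z) n ≤
      cobd (coboundary Z) (supp Set.univ) (locallyZero Z) n := by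
  intro φ hφ
  obtain ⟨K, hK, hKφ⟩ := exists_truncate hφ.1.1
  suffices h : truncate K φ ∈ cobd (coboundary Z) (supp Set.univ) (locallyZero Z) n by
    have h2 : truncate K φ - φ ∈ cobd (coboundary Z) (supp Set.univ) (locallyZero Z) n :=
      Submodule.mem_sup_left hKφ
    simpa using Submodule.sub_mem _ h h2
  have hφ' : coboundary Z n (truncate K φ) ∈ locallyZero Z (n + 1) := by
    simpa using Submodule.add_mem _ (locallyZero_le Z n hKφ) hφ.2
  have hvan : ∀ x k, x k ∉ K → truncate K φ x = 0 := fun x k => truncate_of_notMem φ k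
  generalize truncate K φ = ψ at hφ' hvan
  -- The truncated cochain `ψ` is a cocycle on tuples of diameter less than a fixed `ε`.  A map `T`
  -- that moves points by at most `ε / 2` acts on it, up to homotopy, as the identity, and a high
  -- iterate of `T` pulls it back to zero.
  obtain ⟨ε, hε, hψε⟩ := exists_uniform_zero hφ' hK (fun x hx => by
    rw [coboundary_apply, altFaces]
    exact Finset.sum_eq_zero fun i _ => by rw [hvan _ 0 (hx _), mul_zero])
  obtain ⟨T, hT1, hTd, hTK⟩ := hT (ε / 2) (by positivity)
  obtain ⟨m, hm⟩ := hTK K hK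
  have hTk : ∀ k x y, dist (T^[k] x) (T^[k] y) ≤ dist x y := by
    intro k
    induction k with
    | zero => intro x y; exact le_rfl
    | succ k ih =>
      intro x y
      rw [Function.iterate_succ_apply, Function.iterate_succ_apply]
      exact (ih _ _).trans (hT1 x y)
  have hTkd : ∀ k x, dist (T^[k] x) x ≤ k * (ε / 2) := by
    intro k
    induction k with
    | zero => intro x; simp
    | succ k ih =>
      intro x
      rw [Function.iterate_succ_apply']
      have h1 := dist_triangle (T (T^[k] x)) (T^[k] x) x
      have h2 := hTd (T^[k] x)
      have h3 := ih x
      push_cast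
      linarith
  -- consecutive iterates are homotopic near the diagonal
  have hstep : ∀ k, homotopy T^[k] T^[k + 1] n (coboundary Z n ψ) ∈ locallyZero Z n := by
    intro k y
    refine ⟨Metric.ball y (ε / 4), Metric.isOpen_ball, Metric.mem_ball_self (by positivity),
      fun x hx => prism_eq_zero _ _ fun z _ hz => hψε z fun a b => ?_⟩
    have hxx : ∀ a b, dist (x a) (x b) < ε / 2 := fun a b => by
      have h1 := Metric.mem_ball.1 (hx a)
      have h2 := Metric.mem_ball'.1 (hx b)
      have h3 := dist_triangle (x a) y (x b)
      linarith
    have h1 := fun a b => (hTk k (x a) (x b)).trans_lt (hxx a b)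
    have h2 := fun a b => (hTk (k + 1) (x a) (x b)).trans_lt (hxx a b)
    have h4 : ∀ a b, dist (T^[k + 1] (x a)) (T^[k] (x b)) < ε := fun a b => by
      have h3 := hTd (T^[k] (x a))
      rw [Function.iterate_succ_apply']
      have := dist_triangle (T (T^[k] (x a))) (T^[k] (x a)) (T^[k] (x b))
      linarith [h1 a b]
    obtain ⟨l, hl | hl⟩ := hz a <;> obtain ⟨l', hl' | hl'⟩ := hz b <;> rw [hl, hl']
    · linarith [h1 l l']
    · rw [dist_comm]; exact h4 _ _
    · exact h4 _ _
    · linarith [h2 l l']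
  have hend : pull T^[m] n ψ = 0 := by
    funext x
    exact hvan _ 0 (hm (x 0))
  have hsum : ∀ f : ℕ → Fn Z n, f 0 = ψ → f m = 0 →
      ψ = -∑ k ∈ Finset.range m, (f (k + 1) - f k) := by
    intro f h0 h1
    rw [Finset.sum_range_sub, h0, h1, zero_sub, neg_neg]
  -- `ψ` is a telescoping sum of differences of pullbacks along consecutive iterates
  have hψ := hsum (fun k => pull T^[k] n ψ) rfl hend
  cases n with
  | zero =>
    rw [mem_cobd_zero, hψ]
    refine Submodule.neg_mem _ (Submodule.sum_mem _ fun k _ => ?_)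
    rw [← homotopy_zero]
    exact hstep k
  | succ n =>
    rw [mem_cobd_succ]
    refine ⟨-∑ k ∈ Finset.range m, homotopy T^[k] T^[k + 1] n ψ,
      Submodule.neg_mem _ (Submodule.sum_mem _ fun k _ => ?_), ?_⟩
    · refine mem_supp_univ.2 (isCompact_csupp (hK.cthickening (r := k * (ε / 2))) fun y hy => ?_)
      refine ⟨_, Metric.isClosed_cthickening.isOpen_compl, hy, fun x hx => ?_⟩
      refine prism_eq_zero _ _ fun z h0 _ => hvan z 0 fun hzK => hx 0 ?_
      rw [h0] at hzK
      refine Metric.mem_cthickening_of_dist_le _ _ _ _ hzK ?_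
      rw [dist_comm]
      exact hTkd k (x 0)
    · nth_rewrite 1 [hψ]
      rw [map_neg, map_sum, neg_sub_neg, ← Finset.sum_sub_distrib]
      refine Submodule.sum_mem _ fun k _ => ?_
      rw [← homotopy_succ, sub_add_cancel_left]
      exact Submodule.neg_mem _ (hstep k)

theorem hasHc_of_unique (Y : Type*) [TopologicalSpace Y] [Unique Y] :
    HasHc Y (fun n => if n = 0 then 1 else 0) := by
  have hLZ : ∀ n, locallyZero Y n = ⊥ := by
    intro n
    rw [eq_bot_iff]
    intro φ hφ
    rw [Submodule.mem_bot]
    funext x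
    obtain ⟨U, -, hU, h⟩ := hφ default
    exact h x fun i => by rwa [Subsingleton.elim (x i) default]
  have hsupp : ∀ n, supp (Set.univ : Set Y) n = ⊤ := by
    intro n
    rw [eq_top_iff]
    intro φ _
    exact mem_supp_univ.2 (Set.toFinite _).isCompact
  have hd : ∀ n (φ : Fn Y n) x, coboundary Y n φ x =
      (∑ i : Fin (n + 2), (-1 : ℂ) ^ (i : ℕ)) * φ (fun _ => default) := by
    intro n φ x
    rw [coboundary_apply, altFaces, Finset.sum_mul]
    refine Finset.sum_congr rfl fun i _ => ?_
    congr 2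
    funext j
    exact Subsingleton.elim _ _
  have hs : ∀ n, ∑ i : Fin (n + 2), (-1 : ℂ) ^ (i : ℕ) = if Even n then 0 else 1 := by
    intro n
    rw [Fin.sum_univ_eq_sum_range (fun i => (-1 : ℂ) ^ i), neg_one_geom_sum]
    simp [Nat.even_add]
  intro n
  cases n with
  | zero =>
    have hc : cocyc (coboundary Y) (supp Set.univ) (locallyZero Y) 0 = ⊤ := by
      rw [eq_top_iff]
      intro φ _
      refine ⟨by rw [hsupp]; trivial, ?_⟩
      change coboundary Y 0 φ ∈ locallyZero Y 1
      rw [hLZ, Submodule.mem_bot]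
      funext x
      rw [hd, hs]
      simp
    have hb : (cobd (coboundary Y) (supp Set.univ) (locallyZero Y) 0) = ⊥ := by
      rw [cobd, hLZ]; simp [bdry]
    have e : Coh (coboundary Y) (supp Set.univ) (locallyZero Y) 0 ≃ₗ[ℂ] Fn Y 0 := by
      refine (Submodule.quotEquivOfEqBot _ ?_).trans ((LinearEquiv.ofEq _ _ hc).trans
        Submodule.topEquiv)
      rw [hb]
      simp [Submodule.submoduleOf]
    have : Module.Finite ℂ (Fn Y 0) := Module.Finite.pi
    refine ⟨Module.Finite.equiv e.symm, ?_⟩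
    rw [e.finrank_eq]
    simp [Fn]
  | succ n =>
    have h : cocyc (coboundary Y) (supp Set.univ) (locallyZero Y) (n + 1) ≤
        cobd (coboundary Y) (supp Set.univ) (locallyZero Y) (n + 1) := by
      intro φ hφ
      rw [mem_cobd_succ]
      have hφ0 : coboundary Y (n + 1) φ ∈ locallyZero Y (n + 2) := hφ.2
      rw [hLZ, Submodule.mem_bot] at hφ0
      rcases Nat.even_or_odd n with hn | hn
      · refine ⟨0, Submodule.zero_mem _, ?_⟩
        have h1 := congrFun hφ0 (fun _ => default)
        rw [hd, hs, if_neg (by simpa [Nat.even_add_one] using hn), one_mul] at h1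
        rw [map_zero, sub_zero, hLZ, Submodule.mem_bot]
        funext x
        rw [Subsingleton.elim x (fun _ => default)]
        exact h1
      · refine ⟨fun _ => φ (fun _ => default), by rw [hsupp]; trivial, ?_⟩
        rw [hLZ, Submodule.mem_bot]
        funext x
        rw [Pi.sub_apply, hd, hs, if_neg (by simpa using hn), one_mul,
          Subsingleton.elim x (fun _ => default)]
        simp
    have := subsingleton_of_le h
    exact ⟨inferInstance, Module.finrank_zero_of_subsingleton⟩

/-- Euclidean space of dimension `k` has cohomology with compact supports in degree `k` only.  By
induction: the half space `ℝ ^ k × [0, ∞)` has none, since it can be pushed to infinity, and its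
interior and its boundary are Euclidean spaces. -/
theorem hasHc_euclidean (k : ℕ) : HasHc (Fin k → ℝ) (fun n => if n = k then 1 else 0) := by
  induction k with
  | zero => exact hasHc_of_unique _
  | succ k ih =>
    -- the boundary of the half space, and its interior, parametrized by means of `exp`
    let i : (Fin k → ℝ) → (Fin k → ℝ) × Set.Ici (0 : ℝ) := fun x => (x, ⟨0, Set.self_mem_Ici⟩)
    let j : (Fin (k + 1) → ℝ) → (Fin k → ℝ) × Set.Ici (0 : ℝ) :=
      fun x => (Fin.tail x, ⟨Real.exp (x 0), (Real.exp_pos _).le⟩)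
    have hi : IsClosedEmbedding i := by
      refine IsClosedEmbedding.of_continuous_injective_isClosedMap (by fun_prop)
        (fun x y h => congrArg Prod.fst h) ?_
      intro S hS
      have : i '' S = Prod.fst ⁻¹' S ∩ Prod.snd ⁻¹' {⟨0, Set.self_mem_Ici⟩} := by
        ext ⟨x, t⟩
        constructor
        · rintro ⟨y, hy, h⟩
          obtain ⟨rfl, rfl⟩ := Prod.mk.inj h
          exact ⟨hy, rfl⟩
        · rintro ⟨hx, ht⟩
          exact ⟨x, hx, Prod.ext rfl (Eq.symm ht)⟩
      rw [this]
      exact (hS.preimage continuous_fst).inter (isClosed_singleton.preimage continuous_snd)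
    have hrange : Set.range j = (Set.range i)ᶜ := by
      ext ⟨x, t, ht⟩
      constructor
      · rintro ⟨y, h⟩ ⟨z, hz⟩
        have h1 := congrArg (fun p => (p.2 : ℝ)) (h.trans hz.symm)
        exact (Real.exp_pos _).ne' h1
      · intro h
        have ht0 : 0 < t := lt_of_le_of_ne ht fun h0 => h ⟨x, by simp [i, h0]⟩
        refine ⟨Fin.cons (Real.log t) x, ?_⟩
        simp [j, Real.exp_log ht0]
    have hj : IsOpenEmbedding j := by
      let q : (Fin k → ℝ) × Set.Ici (0 : ℝ) → Fin (k + 1) → ℝ := fun p => Fin.cons p.2 p.1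
      have hq : Continuous q := by fun_prop
      have hqj : q ∘ j = Pi.map (Fin.cons Real.exp fun _ => id : Fin (k + 1) → ℝ → ℝ) := by
        funext x l
        refine Fin.cases ?_ (fun l => ?_) l <;> simp [q, j, Fin.tail]
      refine ⟨IsEmbedding.of_comp (by fun_prop) hq ?_, ?_⟩
      · rw [hqj]
        refine IsEmbedding.piMap fun l => ?_
        refine Fin.cases ?_ (fun l => ?_) l
        · exact Real.isOpenEmbedding_exp.isEmbedding
        · exact IsEmbedding.id
      · rw [hrange]
        exact hi.isClosed_range.isOpen_compl
    have : ProperSpace (Set.Ici (0 : ℝ)) := ProperSpace.of_isClosed isClosed_Ici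
    have := HasHc.shift hi hj hrange ih (acyclic_of_push ?_)
    · convert this using 1
      funext n
      cases n <;> simp
    · intro ε hε
      refine ⟨fun p => (p.1, ⟨p.2 + ε, add_nonneg p.2.2 hε.le⟩), ?_, ?_, ?_⟩
      · rintro ⟨x, s⟩ ⟨y, t⟩
        simp [Prod.dist_eq, Subtype.dist_eq]
      · rintro ⟨x, s⟩
        simp [Prod.dist_eq, Subtype.dist_eq, abs_of_pos hε, hε.le]
      · intro K hK
        have hc : Continuous fun p : (Fin k → ℝ) × Set.Ici (0 : ℝ) => (p.2 : ℝ) := by fun_prop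
        obtain ⟨M, hM⟩ := (hK.image hc).bddAbove
        obtain ⟨m, hm⟩ := exists_nat_gt (M / ε)
        refine ⟨m, fun x hx => ?_⟩
        have h1 := hM ⟨_, hx, rfl⟩
        have h2 : ∀ (m : ℕ) (x : (Fin k → ℝ) × Set.Ici (0 : ℝ)), (((fun p :
            (Fin k → ℝ) × Set.Ici (0 : ℝ) => ((p.1, ⟨p.2 + ε, add_nonneg p.2.2 hε.le⟩) :
              (Fin k → ℝ) × Set.Ici (0 : ℝ)))^[m] x).2 : ℝ) = x.2 + m * ε := by
          intro m
          induction m with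
          | zero => intro x; simp
          | succ m ih =>
            intro x
            rw [Function.iterate_succ_apply, ih]
            push_cast
            ring
        rw [div_lt_iff₀ hε] at hm
        replace h1 := (h2 m x).symm.trans_le h1
        linarith [x.2.2, Set.mem_Ici.1 x.2.2]

end AlexanderSpanier

namespace AlexanderSpanier

open RelCoh Topology CategoryTheory

/-! ### The Euler characteristic of a space with a filtration by cells -/

theorem nonempty_homology_equiv_coh (K : CochainComplex (ModuleCat.{u} ℂ) ℕ) (n : ℕ) :
    Nonempty (K.homology n ≃ₗ[ℂ] Coh (F := fun n => K.X n) (fun n => (K.d n (n + 1)).hom)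
      (fun _ => ⊤) (fun _ => ⊥) n) := by
  have aux : ∀ i, (ComplexShape.up ℕ).prev n = i →
      Submodule.map (K.sc' i n (n + 1)).f.hom ⊤ =
        cobd (F := fun n => K.X n) (fun n => (K.d n (n + 1)).hom) (fun _ => ⊤) (fun _ => ⊥) n →
      Nonempty (K.homology n ≃ₗ[ℂ] Coh (F := fun n => K.X n) (fun n => (K.d n (n + 1)).hom)
        (fun _ => ⊤) (fun _ => ⊥) n) := by
    intro i hi h
    let e1 : K.homology n ≅ (K.sc' i n (n + 1)).homology :=
      ShortComplex.homologyMapIso (K.isoSc' i n (n + 1) hi (CochainComplex.next ℕ n))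
    let e2 := (K.sc' i n (n + 1)).moduleCatHomologyIso
    let e3 : LinearMap.ker (K.sc' i n (n + 1)).g.hom ≃ₗ[ℂ]
        cocyc (F := fun n => K.X n) (fun n => (K.d n (n + 1)).hom) (fun _ => ⊤) (fun _ => ⊥) n :=
      LinearEquiv.ofEq _ _ (by
        change LinearMap.ker _ = ⊤ ⊓ Submodule.comap _ ⊥
        rw [top_inf_eq]
        rfl)
    refine ⟨(e1 ≪≫ e2).toLinearEquiv.trans (Submodule.Quotient.equiv _ _ e3 ?_)⟩
    ext ⟨x, hx⟩
    change _ ↔ x ∈ cobd (F := fun n => K.X n) (fun n => (K.d n (n + 1)).hom) (fun _ => ⊤)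
      (fun _ => ⊥) n
    rw [← h]
    constructor
    · rintro ⟨_, ⟨y, rfl⟩, h⟩
      exact ⟨y, trivial, congrArg Subtype.val h⟩
    · rintro ⟨y, -, h⟩
      exact ⟨_, ⟨y, rfl⟩, Subtype.ext h⟩
  cases n with
  | zero =>
    refine aux 0 CochainComplex.prev_nat_zero ?_
    have : (K.sc' 0 0 1).f = 0 := K.shape _ _ (by simp)
    rw [this]
    simp [cobd, bdry]
    rfl
  | succ n =>
    refine aux n (CochainComplex.prev_nat_succ n) ?_
    simp [cobd, bdry]
    rfl

/-- On a compact space every cochain has compact support. -/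
theorem hasCoh_complex_iff (Y : Type u) [TopologicalSpace Y] [CompactSpace Y] {h : ℕ → ℕ} :
    HasCoh (F := fun n => (complex Y).X n) (fun n => ((complex Y).d n (n + 1)).hom)
      (fun _ => ⊤) (fun _ => ⊥) h ↔ HasHc Y h := by
  symm
  have hd : ∀ n, ((complex Y).d n (n + 1)).hom =
      (locallyZero Y n).mapQ (locallyZero Y (n + 1)) (coboundary Y n) (locallyZero_le Y n) := by
    intro n
    have h : (complex Y).d n (n + 1) = ModuleCat.ofHom ((locallyZero Y n).mapQ
        (locallyZero Y (n + 1)) (coboundary Y n) (locallyZero_le Y n)) :=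
      CochainComplex.of_d (fun n => ModuleCat.of ℂ (Fn Y n ⧸ locallyZero Y n))
        (fun n => ModuleCat.ofHom ((locallyZero Y n).mapQ (locallyZero Y (n + 1)) (coboundary Y n)
          (locallyZero_le Y n))) n
    rw [h]
    rfl
  refine hasCoh_iff_of_map (F' := fun n => (complex Y).X n)
    (fun n => (locallyZero Y n).mkQ) ?_ (fun n => supp_le_comap _ n) ?_ ?_ ?_
    (fun n => locallyZero_le_supp _ n) ?_
  · intro n x
    rw [hd]
    rfl
  · simp
  · intros; trivial
  · intro n x hx
    exact (Submodule.Quotient.mk_eq_zero _).symm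
  · intro n y _
    obtain ⟨x, rfl⟩ := Submodule.Quotient.mk_surjective _ y
    refine ⟨x, mem_supp_univ.2 (isClosed_csupp x).isCompact, ?_⟩
    exact sub_self _

/-- If the cohomology has a basis with elements in even degrees only, then the Euler characteristic
is the number of its elements. -/
theorem hasEulerChar_of_hasHc {Y : Type u} [TopologicalSpace Y] [CompactSpace Y] {ι : Type*}
    [Fintype ι] (d : ι → ℕ)
    (H : HasHc Y fun n => {i | 2 * d i = n}.ncard) : HasEulerChar Y (Fintype.card ι) := by
  rw [← hasCoh_complex_iff] at H
  have key : ∀ n, Module.Finite ℂ ((complex Y).homology n) ∧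
      Module.finrank ℂ ((complex Y).homology n) = {i | 2 * d i = n}.ncard := by
    intro n
    obtain ⟨e⟩ := nonempty_homology_equiv_coh (complex Y) n
    have := (H n).1
    exact ⟨Module.Finite.equiv e.symm, by rw [e.finrank_eq]; exact (H n).2⟩
  classical
  have hsub : ∀ n, {i | 2 * d i = n}.ncard ≠ 0 → n ∈ Finset.univ.image fun i => 2 * d i := by
    intro n hn
    obtain ⟨i, hi⟩ := Set.nonempty_of_ncard_ne_zero hn
    exact Finset.mem_image.2 ⟨i, Finset.mem_univ _, hi⟩
  refine ⟨fun n => (key n).1, ?_, ?_⟩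
  · refine (Finset.finite_toSet (Finset.univ.image fun i => 2 * d i)).subset fun n hn => ?_
    have := (key n).1
    have hn' : Nontrivial ((complex Y).homology n) := hn
    refine hsub n ?_
    rw [← (key n).2]
    exact Module.finrank_pos.ne'
  · rw [HomologicalComplex.homologyEulerChar_eq_sum_finSet_of_finrankSupport_subset _
      (Finset.univ.image fun i => 2 * d i)]
    · have : ∀ n ∈ Finset.univ.image (fun i => 2 * d i),
          ((ComplexShape.up ℕ).χ n : ℤ) * Module.finrank ℂ ((complex Y).homology n) =
          ((Finset.univ.filter fun i => 2 * d i = n).card : ℤ) := by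
        intro n hn
        obtain ⟨i, -, rfl⟩ := Finset.mem_image.1 hn
        rw [(key _).2, Set.ncard_eq_toFinset_card']
        simp
      rw [Finset.sum_congr rfl this, ← Nat.cast_sum, ← Finset.card_eq_sum_card_image,
        Finset.card_univ]
    · intro n hn
      refine Finset.mem_coe.2 (hsub n ?_)
      rw [← (key n).2]
      exact hn

theorem hasHc_of_isEmpty (Y : Type*) [TopologicalSpace Y] [IsEmpty Y] : HasHc Y fun _ => 0 := by
  intro n
  have : cocyc (coboundary Y) (supp Set.univ) (locallyZero Y) n ≤
      cobd (coboundary Y) (supp Set.univ) (locallyZero Y) n :=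
    fun φ _ => Submodule.mem_sup_left fun y => isEmptyElim y
  have := subsingleton_of_le this
  exact ⟨inferInstance, Module.finrank_zero_of_subsingleton⟩

theorem hasHc_of_homeomorph {Y Z : Type*} [TopologicalSpace Y] [TopologicalSpace Z] (f : Y ≃ₜ Z)
    {h : ℕ → ℕ} (H : HasHc Y h) : HasHc Z h := by
  have hsupp : suppRel f = locallyZero Z := by
    funext n
    refine le_antisymm (fun φ hφ z => ?_) (fun φ hφ =>
      ⟨locallyZero_le_supp _ _ hφ, fun y => zeroAt_pull f.continuous (hφ (f y))⟩)
    obtain ⟨y, rfl⟩ := f.surjective z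
    exact zeroAt_of_pull f.isOpenEmbedding (hφ.2 y)
  rw [HasHc, ← hsupp]
  exact (hasCoh_suppRel_iff f.isClosedEmbedding).2 H

/-- The cohomology of a space with a filtration by closed subsets whose successive differences are
complex affine spaces.  The degrees of the cells are even, so the long exact sequences of the
filtration split into short ones. -/
theorem hasHc_of_cells {Y : Type*} [TopologicalSpace Y] [CompactSpace Y]
    [TopologicalSpace.MetrizableSpace Y] {ι : Type*} [Finite ι] (C : ι → Set Y) (d : ι → ℕ)
    (hdisj : Pairwise fun i j => Disjoint (C i) (C j)) (hcover : ⋃ i, C i = Set.univ)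
    (r : ι → ℕ) (hr : Function.Injective r)
    (hclosed : ∀ k : ℕ, IsClosed (⋃ i, ⋃ (_ : r i ≤ k), C i))
    (e : ∀ i, C i ≃ₜ (Fin (2 * d i) → ℝ)) :
    HasHc Y fun n => {i | 2 * d i = n}.ncard := by
  let F : ℕ → Set Y := fun k => ⋃ i, ⋃ (_ : r i < k), C i
  have hmem : ∀ k y, y ∈ F k ↔ ∃ i, r i < k ∧ y ∈ C i := by
    intro k y
    simp [F]
  have hF : ∀ k, IsClosed (F k) := by
    intro k
    cases k with
    | zero => simp [F]
    | succ k => simpa [F, Nat.lt_succ_iff] using hclosed k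
  have key : ∀ k, HasHc (F k) fun n => {i | r i < k ∧ 2 * d i = n}.ncard := by
    intro k
    induction k with
    | zero =>
      have : IsEmpty (F 0) := ⟨fun y => by simpa [F] using y.2⟩
      simpa using hasHc_of_isEmpty (F 0)
    | succ k ih =>
      by_cases hk : ∃ i, r i = k
      · obtain ⟨i, rfl⟩ := hk
        have hsub : F (r i) ⊆ F (r i + 1) := by
          intro y hy
          rw [hmem] at hy ⊢
          obtain ⟨l, hl, hy⟩ := hy
          exact ⟨l, hl.trans (Nat.lt_succ_self _), hy⟩
        have hi : IsClosedEmbedding (Set.inclusion hsub) :=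
          ⟨IsEmbedding.inclusion hsub, by
            rw [Set.range_inclusion]
            exact (hF _).preimage continuous_subtype_val⟩
        have hCsub : C i ⊆ F (r i + 1) := fun y hy => (hmem _ _).2 ⟨i, Nat.lt_succ_self _, hy⟩
        let j : (Fin (2 * d i) → ℝ) → F (r i + 1) := Set.inclusion hCsub ∘ (e i).symm
        have hij : Set.range j = (Set.range (Set.inclusion hsub))ᶜ := by
          rw [(e i).symm.surjective.range_comp, Set.range_inclusion, Set.range_inclusion]
          ext ⟨y, hy⟩
          simp only [Set.mem_ofPred_eq, Set.mem_compl_iff]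
          rw [hmem] at hy ⊢
          constructor
          · rintro h ⟨l, hl, hyl⟩
            exact Set.disjoint_left.1 (hdisj (by rintro rfl; exact hl.false : l ≠ i)) hyl h
          · intro h
            obtain ⟨l, hl, hyl⟩ := hy
            rcases (Nat.lt_succ_iff.1 hl).lt_or_eq with h1 | h1
            · exact absurd ⟨l, h1, hyl⟩ h
            · rwa [← hr h1]
        have hj : IsOpenEmbedding j :=
          ⟨(IsEmbedding.inclusion hCsub).comp (e i).symm.isEmbedding, by
            rw [hij]; exact hi.isClosed_range.isOpen_compl⟩
        have : CompactSpace (F (r i + 1)) := isCompact_iff_compactSpace.1 (hF _).isCompact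
        have h := HasHc.add hi hj hij (hasHc_euclidean _) ih
          (fun n hn => if_neg (by rintro rfl; exact Nat.not_odd_iff_even.2 (by simp) hn)) ?_
        · convert h using 1
          funext n
          have : {l | r l < r i + 1 ∧ 2 * d l = n} =
              {l | l = i ∧ 2 * d i = n} ∪ {l | r l < r i ∧ 2 * d l = n} := by
            ext l
            simp only [Set.mem_ofPred_eq, Set.mem_union, Nat.lt_succ_iff_lt_or_eq]
            constructor
            · rintro ⟨h1 | h1, h2⟩
              · exact Or.inr ⟨h1, h2⟩
              · obtain rfl := hr h1
                exact Or.inl ⟨rfl, h2⟩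
            · rintro (⟨rfl, h2⟩ | ⟨h1, h2⟩)
              · exact ⟨Or.inr rfl, h2⟩
              · exact ⟨Or.inl h1, h2⟩
          rw [this, Set.ncard_union_eq]
          · rw [Pi.add_apply]
            congr 1
            by_cases hn : n = 2 * d i
            · simp [hn]
            · simp [hn, Ne.symm hn]
          · rw [Set.disjoint_left]
            rintro l ⟨rfl, -⟩ ⟨h, -⟩
            exact h.false
        · intro n hn
          rw [Set.ncard_eq_zero]
          ext l
          simp only [Set.mem_ofPred_eq, Set.mem_empty_iff_false, iff_false, not_and]
          rintro - rfl
          exact Nat.not_odd_iff_even.2 (by simp) hn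
      · have h1 : ∀ i, r i < k + 1 ↔ r i < k := fun i => by
          have : r i ≠ k := fun h => hk ⟨i, h⟩
          omega
        have h2 : F (k + 1) = F k := by
          ext y
          simp [hmem, h1]
        rw [h2]
        simpa only [h1] using ih
  obtain ⟨k, hk⟩ := (Set.finite_range r).bddAbove
  have hk' : ∀ i, r i < k + 1 := fun i => Nat.lt_succ_iff.2 (hk ⟨i, rfl⟩)
  have h1 : F (k + 1) = Set.univ := by
    simp [F, hk', hcover]
  have h2 := key (k + 1)
  simp only [hk', true_and] at h2
  rw [h1] at h2
  exact hasHc_of_homeomorph (Homeomorph.Set.univ Y) h2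

end AlexanderSpanier

/-! ### Polynomial maps and slices of quotients -/

namespace FunSpace

section Poly

variable {E F : Type*} [AddCommGroup E] [Module ℂ E] [AddCommGroup F] [Module ℂ F]

theorem dual_mem_polyFun (l : Module.Dual ℂ E) : (fun x => l x) ∈ polyFun E :=
  Algebra.subset_adjoin ⟨l, rfl⟩

theorem const_mem_polyFun (c : ℂ) : (fun _ : E => c) ∈ polyFun E :=
  (polyFun E).algebraMap_mem c

/-- Polynomial maps between vector spaces. -/
def IsPolyMap (φ : E → F) : Prop := ∀ l : Module.Dual ℂ F, (fun x => l (φ x)) ∈ polyFun E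

theorem IsPolyMap.comp_mem {φ : E → F} (hφ : IsPolyMap φ) {g : F → ℂ} (hg : g ∈ polyFun F) :
    g ∘ φ ∈ polyFun E := by
  induction hg using Algebra.adjoin_induction with
  | mem x hx =>
    obtain ⟨l, rfl⟩ := hx
    exact hφ l
  | algebraMap r => exact const_mem_polyFun r
  | add x y _ _ hx hy => exact (polyFun E).add_mem hx hy
  | mul x y _ _ hx hy => exact (polyFun E).mul_mem hx hy

theorem isOpen_ne_zero {g : E → ℂ} (hg : g ∈ polyFun E) :
    IsOpen[(affine E).zariski] {x | g x ≠ 0} :=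
  TopologicalSpace.isOpen_generateFrom_of_mem ⟨g, hg, rfl⟩

/-- The sets `g ≠ 0` with `g` polynomial form a basis of the Zariski topology. -/
theorem exists_ne_zero_subset {U : Set E} (hU : IsOpen[(affine E).zariski] U) {x : E}
    (hx : x ∈ U) : ∃ g ∈ polyFun E, g x ≠ 0 ∧ ∀ y, g y ≠ 0 → y ∈ U := by
  induction hU generalizing x with
  | basic s hs =>
    obtain ⟨g, hg, rfl⟩ := hs
    exact ⟨g, hg, hx, fun y hy => hy⟩
  | univ => exact ⟨1, (polyFun E).one_mem, one_ne_zero, fun _ _ => trivial⟩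
  | inter s t _ _ ihs iht =>
    obtain ⟨g, hg, hgx, h1⟩ := ihs hx.1
    obtain ⟨k, hk, hkx, h2⟩ := iht hx.2
    exact ⟨g * k, (polyFun E).mul_mem hg hk, mul_ne_zero hgx hkx, fun y hy =>
      ⟨h1 y (left_ne_zero_of_mul hy), h2 y (right_ne_zero_of_mul hy)⟩⟩
  | sUnion S _ ih =>
    obtain ⟨s, hs, hxs⟩ := hx
    obtain ⟨g, hg, hgx, h⟩ := ih s hs hxs
    exact ⟨g, hg, hgx, fun y hy => ⟨s, hs, h y hy⟩⟩

theorem IsPolyMap.continuous {φ : E → F} (hφ : IsPolyMap φ) :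
    Continuous[(affine E).zariski, (affine F).zariski] φ := by
  refine continuous_generateFrom_iff.2 ?_
  rintro _ ⟨g, hg, rfl⟩
  exact isOpen_ne_zero (hφ.comp_mem hg)

/-- The functions that are given by a quotient of polynomials on the set `D ≠ 0`. -/
def ratFun (D : E → ℂ) : Subalgebra ℂ (E → ℂ) where
  carrier := {f | ∃ P ∈ polyFun E, ∃ Q ∈ polyFun E, ∀ x, D x ≠ 0 → Q x ≠ 0 ∧ f x = P x / Q x}
  algebraMap_mem' r :=
    ⟨_, const_mem_polyFun r, 1, (polyFun E).one_mem, fun x _ => ⟨one_ne_zero, by simp⟩⟩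
  add_mem' := by
    rintro f g ⟨P, hP, Q, hQ, h⟩ ⟨P', hP', Q', hQ', h'⟩
    refine ⟨P * Q' + Q * P', (polyFun E).add_mem ((polyFun E).mul_mem hP hQ')
      ((polyFun E).mul_mem hQ hP'), Q * Q', (polyFun E).mul_mem hQ hQ', fun x hx => ?_⟩
    obtain ⟨h1, h2⟩ := h x hx
    obtain ⟨h3, h4⟩ := h' x hx
    refine ⟨mul_ne_zero h1 h3, ?_⟩
    simp only [Pi.add_apply, Pi.mul_apply, h2, h4]
    exact div_add_div _ _ h1 h3
  mul_mem' := by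
    rintro f g ⟨P, hP, Q, hQ, h⟩ ⟨P', hP', Q', hQ', h'⟩
    refine ⟨P * P', (polyFun E).mul_mem hP hP', Q * Q', (polyFun E).mul_mem hQ hQ',
      fun x hx => ?_⟩
    obtain ⟨h1, h2⟩ := h x hx
    obtain ⟨h3, h4⟩ := h' x hx
    refine ⟨mul_ne_zero h1 h3, ?_⟩
    simp only [Pi.mul_apply, h2, h4]
    exact div_mul_div_comm _ _ _ _

theorem mem_ratFun_of_mem_polyFun {D f : E → ℂ} (hf : f ∈ polyFun E) : f ∈ ratFun D :=
  ⟨f, hf, 1, (polyFun E).one_mem, fun x _ => ⟨one_ne_zero, by simp⟩⟩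

/-- The map `Ψ` is given by quotients of polynomials on the set `D ≠ 0`. -/
def IsRatMap (D : E → ℂ) (Ψ : E → F) : Prop :=
  ∀ l : Module.Dual ℂ F, (fun x => l (Ψ x)) ∈ ratFun D

theorem IsRatMap.comp_mem {D : E → ℂ} {Ψ : E → F} (hΨ : IsRatMap D Ψ) {g : F → ℂ}
    (hg : g ∈ polyFun F) : g ∘ Ψ ∈ ratFun D := by
  induction hg using Algebra.adjoin_induction with
  | mem x hx =>
    obtain ⟨l, rfl⟩ := hx
    exact hΨ l
  | algebraMap r => exact (ratFun D).algebraMap_mem r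
  | add x y _ _ hx hy => exact (ratFun D).add_mem hx hy
  | mul x y _ _ hx hy => exact (ratFun D).mul_mem hx hy

end Poly

/-- A polynomial parametrization `γ` of a subset `C` of `Y ⊆ G`, where `G` is a quotient `π`
of a subset `s` of a vector space, together with its inverse: the map `norm` chooses a preferred
preimage in `s` of a point of `G`, given by a rational map `Ψ` with denominator `D` on `s`, and
the parameters depend linearly on the preferred preimage. -/
structure Slice {E G : Type*} [AddCommGroup E] [Module ℂ E] {s : Set E} (π : s → G) {Y : Set G}
    (C : Set Y) (d : ℕ) where
  /-- The common denominator. -/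
  D : E → ℂ
  D_mem : D ∈ polyFun E
  /-- The map to the preferred preimages. -/
  Ψ : E → E
  Ψ_rat : IsRatMap D Ψ
  /-- The domain of definition of the choice of preferred preimages. -/
  O : Set G
  mem_O : ∀ Φ : s, π Φ ∈ O ↔ D Φ ≠ 0
  /-- The preferred preimages. -/
  norm : G → E
  norm_eq : ∀ Φ : s, D Φ ≠ 0 → norm (π Φ) = Ψ Φ
  subset_O : ∀ U ∈ C, U.1 ∈ O
  /-- The parametrization. -/
  γ : (Fin d → ℂ) → E
  γ_poly : IsPolyMap γ
  γ_mem : ∀ t, γ t ∈ s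
  γ_mem_Y : ∀ t, π ⟨γ t, γ_mem t⟩ ∈ Y
  γ_mem_C : ∀ t, ⟨_, γ_mem_Y t⟩ ∈ C
  /-- The parameters of a preferred preimage. -/
  ρ : E →ₗ[ℂ] Fin d → ℂ
  left_inv : ∀ U ∈ C, π ⟨γ (ρ (norm U)), γ_mem _⟩ = U.1
  right_inv : ∀ t, ρ (norm (π ⟨γ t, γ_mem t⟩)) = t

namespace Slice

variable {E G : Type*} [AddCommGroup E] [Module ℂ E] {s : Set E} {π : s → G} {Y : Set G}
  {C : Set Y} {d : ℕ} (σ : Slice π C d)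

/-- The bijection of `C` with the parameter space. -/
def equiv : C ≃ (Fin d → ℂ) where
  toFun U := σ.ρ (σ.norm U.1.1)
  invFun t := ⟨⟨_, σ.γ_mem_Y t⟩, σ.γ_mem_C t⟩
  left_inv U := Subtype.ext (Subtype.ext (σ.left_inv U.1 U.2))
  right_inv t := σ.right_inv t

theorem rho_poly : IsPolyMap σ.ρ := fun l => dual_mem_polyFun (l.comp σ.ρ)

/-- The quotient structure on `G`. -/
abbrev quotVar (π : s → G) : FunSpace G := ((affine E).sub s).quot π

theorem isOpen_quot {W : Set G} {V : Set E} (hV : IsOpen[(affine E).zariski] V)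
    (h : ∀ Φ : s, π Φ ∈ W ↔ (Φ : E) ∈ V) : IsOpen[(quotVar π).zariski] W := by
  change IsOpen[((affine E).zariski.induced Subtype.val).coinduced π] W
  rw [isOpen_coinduced]
  have : π ⁻¹' W = Subtype.val ⁻¹' V := Set.ext h
  rw [this]
  exact ⟨V, hV, rfl⟩

theorem isOpen_param_ne_zero {g : (Fin d → ℂ) → ℂ} (hg : g ∈ polyFun (Fin d → ℂ)) :
    IsOpen[(quotVar π).zariski] {U | U ∈ σ.O ∧ g (σ.ρ (σ.norm U)) ≠ 0} := by
  obtain ⟨P, hP, Q, hQ, h⟩ := σ.Ψ_rat.comp_mem (σ.rho_poly.comp_mem hg)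
  refine isOpen_quot (isOpen_ne_zero ((polyFun E).mul_mem σ.D_mem hP)) fun Φ => ?_
  rw [Set.mem_ofPred_eq, σ.mem_O, Set.mem_ofPred_eq, Pi.mul_apply, mul_ne_zero_iff]
  refine and_congr_right fun hD => ?_
  rw [σ.norm_eq Φ hD]
  obtain ⟨h1, h2⟩ := h Φ hD
  change ((g ∘ σ.ρ) ∘ σ.Ψ) Φ ≠ 0 ↔ _
  rw [h2, div_ne_zero_iff, and_iff_left h1]

theorem continuous_invFun : Continuous[(affine (Fin d → ℂ)).zariski,
    (((quotVar π).sub Y).sub C).zariski] σ.equiv.symm := by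
  refine continuous_induced_rng.2 (continuous_induced_rng.2 ?_)
  have h1 : Continuous[(affine (Fin d → ℂ)).zariski, ((affine E).sub s).zariski]
      (fun t => (⟨σ.γ t, σ.γ_mem t⟩ : s)) := continuous_induced_rng.2 σ.γ_poly.continuous
  exact @Continuous.comp _ _ _ (affine (Fin d → ℂ)).zariski ((affine E).sub s).zariski
    (quotVar π).zariski _ _ continuous_coinduced_rng h1

theorem continuous_toFun : Continuous[(((quotVar π).sub Y).sub C).zariski,
    (affine (Fin d → ℂ)).zariski] σ.equiv := by
  refine continuous_generateFrom_iff.2 ?_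
  rintro _ ⟨g, hg, rfl⟩
  have h := σ.isOpen_param_ne_zero hg
  refine ⟨_, ⟨_, h, rfl⟩, ?_⟩
  ext U
  exact and_iff_right (σ.subset_O U.1 U.2)

/-- The parametrized set is isomorphic to the affine space. -/
def iso : Iso (((quotVar π).sub Y).sub C) (affine (Fin d → ℂ)) where
  toEquiv := σ.equiv
  continuous_toFun := σ.continuous_toFun
  continuous_invFun := σ.continuous_invFun
  regularAt_iff f U := by
    constructor
    -- A quotient of polynomials in the parameters extends to the function `k` on `G`, whose
    -- pullback to `s` is rational since `norm` is.
    · rintro ⟨g, hg, h, hh, hU, hf⟩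
      obtain ⟨P, hP, Q, hQ, h1⟩ := σ.Ψ_rat.comp_mem (σ.rho_poly.comp_mem hg)
      obtain ⟨P', hP', Q', hQ', h2⟩ := σ.Ψ_rat.comp_mem (σ.rho_poly.comp_mem hh)
      let k : G → ℂ := fun U => g (σ.ρ (σ.norm U)) / h (σ.ρ (σ.norm U))
      refine ⟨fun U => k U.1, ⟨k, ?_, Set.univ, @isOpen_univ _ ((quotVar π).zariski), trivial,
        fun _ _ => rfl⟩, _, ⟨_, σ.isOpen_param_ne_zero hh, rfl⟩, ⟨σ.subset_O U.1 U.2, hU⟩,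
        fun V hV => hf _ hV.2⟩
      intro Φ hΦ
      have hD : σ.D Φ ≠ 0 := by
        rw [← σ.mem_O, hΦ]
        exact σ.subset_O U.1 U.2
      have hmem1 := (polyFun E).mul_mem ((polyFun E).mul_mem hP hQ') σ.D_mem
      have hmem2 := (polyFun E).mul_mem ((polyFun E).mul_mem hQ hP') σ.D_mem
      have hP'0 : P' Φ ≠ 0 := by
        intro h0
        have h3 := (h2 Φ hD).2
        rw [h0, zero_div, Function.comp_apply, ← σ.norm_eq Φ hD, hΦ] at h3
        exact hU h3
      refine ⟨fun Φ => (P * Q' * σ.D) Φ / (Q * P' * σ.D) Φ, ⟨_, hmem1, _, hmem2,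
        mul_ne_zero (mul_ne_zero (h1 Φ hD).1 hP'0) hD, fun _ _ => rfl⟩, _, isOpen_ne_zero hmem2,
        mul_ne_zero (mul_ne_zero (h1 Φ hD).1 hP'0) hD, fun Φ' hΦ' => ?_⟩
      have hD' : σ.D Φ' ≠ 0 := right_ne_zero_of_mul hΦ'
      obtain ⟨e1, e2⟩ := h1 Φ' hD'
      obtain ⟨e3, e4⟩ := h2 Φ' hD'
      simp only [Function.comp_apply] at e2 e4
      simp only [Function.comp_apply, k, σ.norm_eq Φ' hD', e2, e4, Pi.mul_apply]
      field_simp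
    -- Conversely, the pullback of a regular function along the polynomial map `γ` is a quotient of
    -- polynomials near the given point.  The factor `k1 * k2 * k3` of numerator and denominator
    -- cuts out the neighbourhood on which this is valid.
    · rintro ⟨g1, ⟨g2, hg2, W2, hW2, hUW2, h2⟩, W1, hW1, hUW1, h1⟩
      obtain ⟨t, rfl⟩ := σ.equiv.symm.surjective U
      rw [Equiv.apply_symm_apply]
      obtain ⟨g3, ⟨P, hP, Q, hQ, hQ0, h4⟩, W3, hW3, hUW3, h3⟩ := hg2 ⟨σ.γ t, σ.γ_mem t⟩ rfl
      have hopen1 := continuous_def.1 (continuous_induced_rng.1 σ.continuous_invFun) _ hW1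
      have hopen2 := continuous_def.1
        (continuous_induced_rng.1 (continuous_induced_rng.1 σ.continuous_invFun)) _ hW2
      have hopen3 := continuous_def.1 σ.γ_poly.continuous _ hW3
      obtain ⟨k1, hk1, ht1, hs1⟩ := exists_ne_zero_subset hopen1 hUW1
      obtain ⟨k2, hk2, ht2, hs2⟩ := exists_ne_zero_subset hopen2 hUW2
      obtain ⟨k3, hk3, ht3, hs3⟩ := exists_ne_zero_subset hopen3 hUW3
      have hk := Subalgebra.mul_mem _ (Subalgebra.mul_mem _ hk1 hk2) hk3
      refine ⟨_, Subalgebra.mul_mem _ (σ.γ_poly.comp_mem hP) hk, _,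
        Subalgebra.mul_mem _ (σ.γ_poly.comp_mem hQ) hk,
        mul_ne_zero hQ0 (mul_ne_zero (mul_ne_zero ht1 ht2) ht3), fun y hy => ?_⟩
      have hy' := right_ne_zero_of_mul hy
      have hy3 : k3 y ≠ 0 := right_ne_zero_of_mul hy'
      have hy2 : k2 y ≠ 0 := right_ne_zero_of_mul (left_ne_zero_of_mul hy')
      have hy1 : k1 y ≠ 0 := left_ne_zero_of_mul (left_ne_zero_of_mul hy')
      have e1 := h1 (σ.equiv.symm y) (hs1 y hy1)
      have e2 := h2 (σ.equiv.symm y).1 (hs2 y hy2)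
      have e3 := h3 ⟨σ.γ y, σ.γ_mem y⟩ (hs3 y hy3)
      have e4 := h4 (σ.γ y) (left_ne_zero_of_mul hy)
      simp only [Function.comp_apply, Equiv.apply_symm_apply] at e1
      rw [e1, e2]
      refine (e3.trans e4).trans ?_
      exact (mul_div_mul_right _ _ hy').symm

/-- The parametrized set is homeomorphic to the parameter space in the quotient of any topology in
which the polynomials and the parametrization are continuous. -/
theorem nonempty_homeomorph [TopologicalSpace E] (hE : ∀ g ∈ polyFun E, Continuous g)
    (hγ : Continuous σ.γ) :
    letI : TopologicalSpace G := .coinduced π inferInstance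
    Nonempty (C ≃ₜ (Fin d → ℂ)) := by
  let : TopologicalSpace G := .coinduced π inferInstance
  refine ⟨{ σ.equiv with continuous_toFun := ?_, continuous_invFun := ?_ }⟩
  · have hO : IsOpen σ.O := by
      rw [isOpen_coinduced]
      have : π ⁻¹' σ.O = Subtype.val ⁻¹' {Φ | σ.D Φ ≠ 0} := Set.ext σ.mem_O
      rw [this]
      exact (isOpen_ne.preimage (hE _ σ.D_mem)).preimage continuous_subtype_val
    have key : ContinuousOn (fun U => σ.ρ (σ.norm U)) σ.O := by
      rw [continuousOn_pi]
      intro i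
      obtain ⟨P, hP, Q, hQ, h⟩ := σ.Ψ_rat ((LinearMap.proj i).comp σ.ρ)
      rw [continuousOn_iff']
      intro W hW
      refine ⟨σ.O ∩ (fun U => σ.ρ (σ.norm U) i) ⁻¹' W, ?_, by ext; simp [and_comm]⟩
      have hc : ContinuousOn (fun Φ => P Φ / Q Φ) {Φ | σ.D Φ ≠ 0} :=
        (hE P hP).continuousOn.div (hE Q hQ).continuousOn fun Φ hΦ => (h Φ hΦ).1
      have hopen := hc.isOpen_inter_preimage (isOpen_ne.preimage (hE _ σ.D_mem)) hW
      rw [isOpen_coinduced]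
      convert hopen.preimage (continuous_subtype_val (p := (· ∈ s))) using 1
      ext Φ
      refine (and_congr_left' (σ.mem_O Φ)).trans (and_congr_right fun hD => ?_)
      have e : (LinearMap.proj i ∘ₗ σ.ρ) (σ.Ψ Φ) = _ := (h Φ hD).2
      rw [← σ.norm_eq Φ hD] at e
      exact iff_of_eq (congrArg (· ∈ W) e)
    exact (key.comp_continuous (continuous_subtype_val.comp continuous_subtype_val)
      fun U => σ.subset_O U.1 U.2)
  · refine Continuous.subtype_mk (Continuous.subtype_mk ?_ _) _
    have h1 : Continuous (fun t => (⟨σ.γ t, σ.γ_mem t⟩ : s)) := hγ.subtype_mk _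
    exact continuous_coinduced_rng.comp h1

end Slice

end FunSpace

/-! ### The analytic topology of Grassmannians -/

namespace Matrix

variable {m ι : Type*} [Fintype ι] [DecidableEq m]

theorem isCompact_orthonormal_rows :
    IsCompact {M : Matrix m ι ℂ | M * Mᴴ = 1} := by
  have h : IsCompact (Set.univ.pi fun _ => Set.univ.pi fun _ => Metric.closedBall 0 1 :
      Set (m → ι → ℂ)) :=
    isCompact_univ_pi fun _ => isCompact_univ_pi fun _ => isCompact_closedBall _ _
  refine IsCompact.of_isClosed_subset (X := Matrix m ι ℂ) h ?_ ?_
  · exact isClosed_eq (continuous_id.matrix_mul continuous_id.matrix_conjTranspose)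
      continuous_const
  · intro M hM k _ i _
    have h1 : (M * Mᴴ) k k = 1 := by
      have : M * Mᴴ = 1 := hM
      rw [this, one_apply_eq]
    simp only [mul_apply, conjTranspose_apply] at h1
    have h2 : ∑ j, ‖M k j‖ ^ 2 = 1 := by
      have : ((∑ j, ‖M k j‖ ^ 2 : ℝ) : ℂ) = 1 := by
        rw [← h1]
        push_cast
        refine Finset.sum_congr rfl fun j _ => ?_
        exact (Complex.mul_conj' _).symm
      exact_mod_cast this
    rw [mem_closedBall_zero_iff]
    have h3 := Finset.single_le_sum (f := fun j => ‖M k j‖ ^ 2) (fun j _ => by positivity)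
      (Finset.mem_univ i)
    rw [h2] at h3
    exact (sq_le_one_iff₀ (norm_nonneg _)).1 h3

variable [Fintype m]

/-- The orthogonal projection to the row space of a matrix with independent rows. -/
def rowProj (M : Matrix m ι ℂ) : Matrix ι ι ℂ := Mᴴ * (M * Mᴴ)⁻¹ * M

open scoped ComplexOrder in
theorem isUnit_mul_conjTranspose {M : Matrix m ι ℂ} (hM : LinearIndependent ℂ M.row) :
    IsUnit (M * Mᴴ) := by
  classical
  exact (PosDef.mul_conjTranspose_self M (vecMul_injective_iff.2 hM)).isUnit

theorem mul_rowProj {M : Matrix m ι ℂ} (hM : LinearIndependent ℂ M.row) : M * rowProj M = M := by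
  have h : IsUnit (M * Mᴴ).det := (isUnit_iff_isUnit_det _).1 (isUnit_mul_conjTranspose hM)
  rw [rowProj, Matrix.mul_assoc, ← Matrix.mul_assoc, ← Matrix.mul_assoc, mul_nonsing_inv _ h,
    Matrix.one_mul]

theorem mem_span_iff_vecMul_rowProj {M : Matrix m ι ℂ} (hM : LinearIndependent ℂ M.row)
    (w : ι → ℂ) :
    w ∈ Submodule.span ℂ (Set.range M.row) ↔ w ᵥ* rowProj M = w := by
  have hr : ∀ c : m → ℂ, c ᵥ* M ∈ Submodule.span ℂ (Set.range M.row) := by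
    intro c
    rw [vecMul_eq_sum]
    exact Submodule.sum_mem _ fun i _ => Submodule.smul_mem _ _ (Submodule.subset_span ⟨i, rfl⟩)
  constructor
  · intro h
    obtain ⟨c, rfl⟩ := (Submodule.mem_span_range_iff_exists_fun ℂ).1 h
    have : ∑ i, c i • M.row i = c ᵥ* M := (vecMul_eq_sum _ _).symm
    rw [this, vecMul_vecMul, mul_rowProj hM]
  · intro h
    rw [← h, rowProj, ← vecMul_vecMul]
    exact hr _

theorem rowProj_isHermitian (M : Matrix m ι ℂ) : (rowProj M)ᴴ = rowProj M := by
  simp [rowProj, conjTranspose_mul, conjTranspose_nonsing_inv, Matrix.mul_assoc]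

theorem rowProj_mul {m' : Type*} [Fintype m'] [DecidableEq m'] {M : Matrix m ι ℂ}
    {M' : Matrix m' ι ℂ} (hM' : LinearIndependent ℂ M'.row)
    (h : Submodule.span ℂ (Set.range M.row) ≤ Submodule.span ℂ (Set.range M'.row)) :
    rowProj M * rowProj M' = rowProj M := by
  have h1 : M * rowProj M' = M := by
    ext i j
    have := (mem_span_iff_vecMul_rowProj hM' (M i)).1 (h (Submodule.subset_span ⟨i, rfl⟩))
    exact congrFun this j
  rw [rowProj, Matrix.mul_assoc, h1]

theorem rowProj_eq_of_span_eq {m' : Type*} [Fintype m'] [DecidableEq m'] {M : Matrix m ι ℂ}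
    {M' : Matrix m' ι ℂ} (hM : LinearIndependent ℂ M.row) (hM' : LinearIndependent ℂ M'.row)
    (h : Submodule.span ℂ (Set.range M.row) = Submodule.span ℂ (Set.range M'.row)) :
    rowProj M = rowProj M' := by
  have h1 := rowProj_mul hM' h.le
  have h2 := rowProj_mul hM h.ge
  rw [← rowProj_isHermitian M', ← h2, conjTranspose_mul, rowProj_isHermitian, rowProj_isHermitian,
    h1]

theorem continuousOn_rowProj :
    ContinuousOn (rowProj : Matrix m ι ℂ → Matrix ι ι ℂ) {M | LinearIndependent ℂ M.row} := by
  have h : ContinuousOn (fun M : Matrix m ι ℂ => (M * Mᴴ)⁻¹) {M | LinearIndependent ℂ M.row} := by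
    simp only [inv_def, Ring.inverse_eq_inv']
    have h1 : Continuous fun M : Matrix m ι ℂ => M * Mᴴ :=
      continuous_id.matrix_mul continuous_id.matrix_conjTranspose
    refine ContinuousOn.smul (ContinuousOn.inv₀ h1.matrix_det.continuousOn fun M hM => ?_)
      h1.matrix_adjugate.continuousOn
    exact ((isUnit_iff_isUnit_det _).1 (isUnit_mul_conjTranspose hM)).ne_zero
  have h1 : ContinuousOn (fun M : Matrix m ι ℂ => Mᴴ * (M * Mᴴ)⁻¹)
      {M | LinearIndependent ℂ M.row} := by
    rw [continuousOn_iff_continuous_domRestrict] at h ⊢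
    exact continuous_subtype_val.matrix_conjTranspose.matrix_mul h
  rw [continuousOn_iff_continuous_domRestrict] at h1 ⊢
  exact h1.matrix_mul continuous_subtype_val

theorem linearIndependent_of_mul_conjTranspose_eq_one {M : Matrix m ι ℂ} (h : M * Mᴴ = 1) :
    LinearIndependent ℂ M.row := by
  rw [← vecMul_injective_iff]
  refine Function.LeftInverse.injective (g := fun v => v ᵥ* Mᴴ) fun v => ?_
  simp [vecMul_vecMul, h]

/-- Every subspace has an orthonormal basis. -/
theorem exists_orthonormal_rows (U : Submodule ℂ (ι → ℂ)) {k : ℕ} (hk : Module.finrank ℂ U = k) :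
    ∃ M : Matrix (Fin k) ι ℂ, M * Mᴴ = 1 ∧ Submodule.span ℂ (Set.range M.row) = U := by
  subst hk
  let e : EuclideanSpace ℂ ι ≃ₗ[ℂ] (ι → ℂ) := WithLp.linearEquiv 2 ℂ (ι → ℂ)
  let U' : Submodule ℂ (EuclideanSpace ℂ ι) := U.comap e.toLinearMap
  have hU : U'.map e.toLinearMap = U := Submodule.map_comap_eq_of_surjective e.surjective U
  have hfin : Module.finrank ℂ U' = Module.finrank ℂ U := by
    rw [← hU]
    exact (LinearEquiv.finrank_map_eq e U').symm
  let b := (stdOrthonormalBasis ℂ U').reindex (finCongr hfin)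
  refine ⟨Matrix.of fun k => e (b k), ?_, ?_⟩
  · ext k l
    have h1 := orthonormal_iff_ite.1 b.orthonormal l k
    rw [Submodule.coe_inner, EuclideanSpace.inner_eq_star_dotProduct] at h1
    rw [one_apply, mul_apply]
    refine Eq.trans ?_ (h1.trans (by simp [eq_comm]))
    rfl
  · have h1 : Set.range (Matrix.of fun k => e (b k)).row =
        e.toLinearMap '' (U'.subtype '' Set.range b) := by
      rw [← Set.range_comp, ← Set.range_comp]
      rfl
    rw [h1, Submodule.span_image, Submodule.span_image, ← OrthonormalBasis.coe_toBasis,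
      b.toBasis.span_eq, Submodule.map_top, Submodule.range_subtype, hU]

end Matrix

namespace FunSpace

theorem continuous_of_mem_polyFun {E : Type*} [AddCommGroup E] [Module ℂ E] [TopologicalSpace E]
    [IsModuleTopology ℂ E] {g : E → ℂ} (hg : g ∈ polyFun E) : Continuous g := by
  induction hg using Algebra.adjoin_induction with
  | mem x hx =>
    obtain ⟨l, rfl⟩ := hx
    exact IsModuleTopology.continuous_of_linearMap l
  | algebraMap r => exact continuous_const
  | add x y _ _ hx hy => exact hx.add hy
  | mul x y _ _ hx hy => exact hx.mul hy

/-- The Zariski topology is coarser than the analytic one. -/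
theorem moduleTopology_le_zariski (E : Type*) [AddCommGroup E] [Module ℂ E] :
    moduleTopology ℂ E ≤ (affine E).zariski := by
  refine le_generateFrom ?_
  rintro _ ⟨g, hg, rfl⟩
  let : TopologicalSpace E := moduleTopology ℂ E
  have : IsModuleTopology ℂ E := ⟨rfl⟩
  exact isOpen_ne.preimage (continuous_of_mem_polyFun hg)

end FunSpace

namespace QuiverRep

open Topology Matrix

variable {V : Type u} [Quiver.{v} V] {X : QuiverRep.{u, v, w} V} {e : V → ℕ}

theorem zariski_isClosed_quiverGr {s : Set (X.quiverGr e)}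
    (hs : IsClosed[(X.quiverGrVar e).zariski] s) : IsClosed s := by
  have h : (inferInstance : TopologicalSpace (X.quiverGr e)) ≤ (X.quiverGrVar e).zariski :=
    induced_mono (coinduced_mono (induced_mono (FunSpace.moduleTopology_le_zariski _)))
  exact IsClosed.mono hs h

theorem spanFrame_surjective [∀ p, Module.Finite ℂ (X.obj p)] :
    Function.Surjective (X.spanFrame e) := by
  intro U
  have h : ∀ p, ∃ f : Fin (e p) → X.obj p,
      LinearIndependent ℂ f ∧ Submodule.span ℂ (Set.range f) = U.1 p := by
    intro p
    have b := Module.finBasisOfFinrankEq ℂ (U.1 p) (U.2 p)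
    refine ⟨(U.1 p).subtype ∘ b, b.linearIndependent.map' _ (Submodule.ker_subtype _), ?_⟩
    rw [Set.range_comp, Submodule.span_image, b.span_eq, Submodule.map_top,
      Submodule.range_subtype]
  choose f hf hfU using h
  exact ⟨⟨f, hf⟩, Subtype.ext (funext hfU)⟩

variable {ι : V → Type*} [∀ p, Fintype (ι p)] (bas : ∀ p, Module.Basis (ι p) ℂ (X.obj p))

variable (e) in
/-- The coordinates of a tuple of vectors. -/
def coords : X.Tuples e ≃ₗ[ℂ] (∀ p, Fin (e p) → ι p → ℂ) :=
  LinearEquiv.piCongrRight fun p => LinearEquiv.piCongrRight fun _ => (bas p).equivFun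

/-- The coordinates at a vertex, as a matrix. -/
def mat (Φ : X.Tuples e) (p : V) : Matrix (Fin (e p)) (ι p) ℂ := Matrix.of (coords e bas Φ p)

theorem mat_linearIndependent (Φ : X.frames e) (p : V) :
    LinearIndependent ℂ (mat bas Φ.1 p).row :=
  (Φ.2 p).map' (bas p).equivFun.toLinearMap (LinearEquiv.ker _)

theorem span_mat (Φ : X.frames e) (p : V) :
    Submodule.span ℂ (Set.range (mat bas Φ.1 p).row) =
      ((X.spanFrame e Φ).1 p).map (bas p).equivFun.toLinearMap := by
  have : Set.range (mat bas Φ.1 p).row = (bas p).equivFun.toLinearMap '' Set.range (Φ.1 p) := by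
    rw [← Set.range_comp]
    rfl
  rw [this, Submodule.span_image]
  rfl

theorem continuous_coords :
    Continuous[moduleTopology ℂ (X.Tuples e), inferInstance] (coords e bas) := by
  let : TopologicalSpace (X.Tuples e) := moduleTopology ℂ _
  have : IsModuleTopology ℂ (X.Tuples e) := ⟨rfl⟩
  exact IsModuleTopology.continuous_of_linearMap (coords e bas).toLinearMap

theorem continuous_coords_symm [Finite V] :
    Continuous[inferInstance, moduleTopology ℂ (X.Tuples e)] (coords e bas).symm := by
  let : TopologicalSpace (X.Tuples e) := moduleTopology ℂ _
  have : IsModuleTopology ℂ (X.Tuples e) := ⟨rfl⟩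
  have : ContinuousAdd (X.Tuples e) := IsModuleTopology.toContinuousAdd ℂ _
  exact IsModuleTopology.continuous_of_linearMap (coords e bas).symm.toLinearMap

variable [∀ p, Module.Finite ℂ (X.obj p)]

/-- The orthogonal projections to the subspaces in a point of the product of Grassmannians. -/
def grProj (U : X.ProdGr e) (p : V) : Matrix (ι p) (ι p) ℂ :=
  rowProj (mat bas (spanFrame_surjective U).choose.1 p)

theorem grProj_spanFrame (Φ : X.frames e) (p : V) :
    grProj bas (X.spanFrame e Φ) p = rowProj (mat bas Φ.1 p) := by
  refine rowProj_eq_of_span_eq (mat_linearIndependent bas _ p) (mat_linearIndependent bas _ p) ?_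
  rw [span_mat, span_mat, (spanFrame_surjective (X.spanFrame e Φ)).choose_spec]

theorem mem_iff_grProj (U : X.ProdGr e) (p : V) (x : X.obj p) :
    x ∈ U.1 p ↔ (bas p).equivFun x ᵥ* grProj bas U p = (bas p).equivFun x := by
  obtain ⟨Φ, rfl⟩ := spanFrame_surjective U
  rw [grProj_spanFrame, ← mem_span_iff_vecMul_rowProj (mat_linearIndependent bas _ p), span_mat]
  exact ((bas p).equivFun.toEquiv.injective.mem_set_image (s := ((X.spanFrame e Φ).1 p))).symm

theorem grProj_injective : Function.Injective (grProj bas : X.ProdGr e → _) := by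
  intro U U' h
  refine Subtype.ext (funext fun p => ?_)
  ext x
  rw [mem_iff_grProj bas, mem_iff_grProj bas, h]

theorem grProj_mul_self (U : X.ProdGr e) (p : V) :
    grProj bas U p * grProj bas U p = grProj bas U p := by
  obtain ⟨Φ, rfl⟩ := spanFrame_surjective U
  rw [grProj_spanFrame]
  exact rowProj_mul (mat_linearIndependent bas _ p) le_rfl

theorem continuous_grProj : Continuous (grProj bas : X.ProdGr e → _) := by
  let : TopologicalSpace (X.Tuples e) := moduleTopology ℂ _
  refine continuous_coinduced_dom.2 (continuous_pi fun p => ?_)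
  have h1 : Continuous fun Φ : X.frames e => mat bas Φ.1 p :=
    (continuous_apply p).comp ((continuous_coords bas).comp continuous_subtype_val)
  have h2 := continuousOn_rowProj.comp_continuous h1 (fun Φ => mat_linearIndependent bas Φ p)
  exact h2.congr fun Φ => (grProj_spanFrame bas Φ p).symm

/-- In terms of the orthogonal projections `P`, the subrepresentations are given by the equations
`P_p * A * P_q = P_p * A`, where `A` is the matrix of an arrow `p ⟶ q`, acting on row vectors. -/
theorem isClosed_quiverGr : IsClosed (X.quiverGr e) := by
  let bas := fun p => Module.finBasis ℂ (X.obj p)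
  let A : ∀ {p q : V}, (p ⟶ q) → Matrix (Fin (Module.finrank ℂ (X.obj p)))
    (Fin (Module.finrank ℂ (X.obj q))) ℂ := fun {p q} a =>
      (LinearMap.toMatrix (bas p) (bas q) (X.map a))ᵀ
  have hA : ∀ {p q : V} (a : p ⟶ q) (x : X.obj p),
      (bas q).equivFun (X.map a x) = (bas p).equivFun x ᵥ* A a := by
    intro p q a x
    rw [vecMul_transpose]
    exact (LinearMap.toMatrix_mulVec_repr (bas p) (bas q) (X.map a) x).symm
  have key : X.quiverGr e = ⋂ (p : V) (q : V) (a : p ⟶ q),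
      {U | grProj bas U p * A a * grProj bas U q = grProj bas U p * A a} := by
    ext U
    simp only [Set.mem_iInter]
    refine forall_congr' fun p => forall_congr' fun q => forall_congr' fun a => ?_
    constructor
    · intro h
      ext i j
      have h1 : (bas p).equivFun.symm (grProj bas U p i) ∈ U.1 p := by
        rw [mem_iff_grProj bas, LinearEquiv.apply_symm_apply]
        exact congrFun (grProj_mul_self bas U p) i
      have h2 := (mem_iff_grProj bas U q _).1 (h _ h1)
      rw [hA, LinearEquiv.apply_symm_apply] at h2
      exact congrFun h2 j
    · intro h x hx
      have h : grProj bas U p * A a * grProj bas U q = grProj bas U p * A a := h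
      rw [mem_iff_grProj bas] at hx ⊢
      rw [hA]
      calc (bas p).equivFun x ᵥ* A a ᵥ* grProj bas U q
          = (bas p).equivFun x ᵥ* grProj bas U p ᵥ* A a ᵥ* grProj bas U q := by rw [hx]
        _ = (bas p).equivFun x ᵥ* grProj bas U p ᵥ* A a := by
          rw [vecMul_vecMul, vecMul_vecMul, ← Matrix.mul_assoc, h, vecMul_vecMul]
        _ = (bas p).equivFun x ᵥ* A a := by rw [hx]
  rw [key]
  refine isClosed_iInter fun p => isClosed_iInter fun q => isClosed_iInter fun a => ?_
  have hc : ∀ p, Continuous fun U : X.ProdGr e => grProj bas U p :=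
    fun p => (continuous_apply p).comp (continuous_grProj bas)
  exact isClosed_eq (((hc p).matrix_mul continuous_const).matrix_mul (hc q))
    ((hc p).matrix_mul continuous_const)

variable [Finite V]

/-- The product of Grassmannians is the image of the compact set of orthonormal frames. -/
instance compactSpace_prodGr : CompactSpace (X.ProdGr e) := by
  let : TopologicalSpace (X.Tuples e) := moduleTopology ℂ _
  let bas := fun p => Module.finBasis ℂ (X.obj p)
  let K : Set (∀ p, Matrix (Fin (e p)) (Fin (Module.finrank ℂ (X.obj p))) ℂ) :=
    Set.univ.pi fun p => {M | M * Mᴴ = 1}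
  have hK : IsCompact K := isCompact_univ_pi fun p => isCompact_orthonormal_rows
  have hKs : ∀ A ∈ K, (coords e bas).symm A ∈ X.frames e := by
    intro A hA p
    have h1 := linearIndependent_of_mul_conjTranspose_eq_one (hA p trivial)
    exact h1.map' (bas p).equivFun.symm.toLinearMap (LinearEquiv.ker _)
  have : CompactSpace K := isCompact_iff_compactSpace.1 hK
  let f : K → X.ProdGr e := fun A => X.spanFrame e ⟨_, hKs A.1 A.2⟩
  have hf : Continuous f := by
    refine (continuous_coinduced_rng (f := X.spanFrame e)).comp (Continuous.subtype_mk ?_ _)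
    exact (continuous_coords_symm bas).comp continuous_subtype_val
  refine Function.Surjective.compactSpace (f := f) hf ?_
  intro U
  have h : ∀ p, ∃ M : Matrix (Fin (e p)) (Fin (Module.finrank ℂ (X.obj p))) ℂ, M * Mᴴ = 1 ∧
      Submodule.span ℂ (Set.range M.row) = (U.1 p).map (bas p).equivFun.toLinearMap :=
    fun p => exists_orthonormal_rows _ (by rw [LinearEquiv.finrank_map_eq]; exact U.2 p)
  choose A hA hAU using h
  refine ⟨⟨A, fun p _ => hA p⟩, Subtype.ext (funext fun p => ?_)⟩
  have h1 := span_mat bas ⟨_, hKs A fun p _ => hA p⟩ p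
  have h2 : mat bas ((coords e bas).symm A) p = A p :=
    congrFun ((coords e bas).apply_symm_apply A) p
  rw [h2, hAU p] at h1
  exact (Submodule.map_injective_of_injective (bas p).equivFun.injective h1).symm

/-- The orthogonal projections embed the product of Grassmannians into a space of matrices. -/
instance metrizableSpace_prodGr : TopologicalSpace.MetrizableSpace (X.ProdGr e) := by
  let bas := fun p => Module.finBasis ℂ (X.obj p)
  have h : IsClosedEmbedding (grProj bas : X.ProdGr e → _) :=
    (continuous_grProj bas).isClosedEmbedding (grProj_injective bas)
  have := Fintype.ofFinite V
  have : TopologicalSpace.MetrizableSpace (∀ p, Matrix (Fin (Module.finrank ℂ (X.obj p)))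
    (Fin (Module.finrank ℂ (X.obj p))) ℂ) := inferInstanceAs (TopologicalSpace.MetrizableSpace
    (∀ p, Fin (Module.finrank ℂ (X.obj p)) → Fin (Module.finrank ℂ (X.obj p)) → ℂ))
  exact h.isEmbedding.metrizableSpace

instance compactSpace_quiverGr : CompactSpace (X.quiverGr e) :=
  isCompact_iff_compactSpace.1 isClosed_quiverGr.isCompact

end QuiverRep

/-! ### Triangular systems of polynomial equations -/

section Triangular

variable {ι : Type*} (rank : ι → ℕ) (Fr : Finset ι) (P : ι → (ι → ℂ) → ℂ)

/-- The expression `P s x` is a polynomial in the variables `x s'` with `rank s' < rank s`.  This is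
stated as a closure property: if the variables of lower rank depend on a parameter through functions
in a subalgebra `A`, then so does `P s x`. -/
def IsTriangular : Prop :=
  ∀ {T : Type} (A : Subalgebra ℂ (T → ℂ)) (s : ι) (x : T → ι → ℂ),
    (∀ s', rank s' < rank s → (fun z => x z s') ∈ A) → (fun z => P s (x z)) ∈ A

variable {rank Fr P}

theorem IsTriangular.congr (hP : IsTriangular rank P) {s : ι} {x x' : ι → ℂ}
    (h : ∀ s', rank s' < rank s → x s' = x' s') : P s x = P s x' := by
  -- the functions on a two point set that take the same value at both points
  let A : Subalgebra ℂ (Bool → ℂ) :=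
    { carrier := {f | f true = f false}
      mul_mem' := fun {f g} hf hg => congrArg₂ (· * ·) hf hg
      add_mem' := fun {f g} hf hg => congrArg₂ (· + ·) hf hg
      algebraMap_mem' := fun r => rfl }
  exact hP A s (fun z => if z then x else x') h

theorem triangular_unique (hP : IsTriangular rank P) {x x' : ι → ℂ}
    (hx : ∀ s ∉ Fr, x s = P s x) (hx' : ∀ s ∉ Fr, x' s = P s x') (h : ∀ s ∈ Fr, x s = x' s) :
    x = x' := by
  funext s
  induction hr : rank s using Nat.strong_induction_on generalizing s with
  | _ r ih =>
    subst hr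
    by_cases hs : s ∈ Fr
    · exact h s hs
    · rw [hx s hs, hx' s hs]
      exact hP.congr fun s' hs' => ih _ hs' s' rfl

variable [DecidableEq ι]

variable (Fr P) in
/-- Successive approximations to the solution of the system `x s = P s x`, `s ∉ Fr`, with
prescribed values `t` on `Fr`. -/
def triangularIter (t : ι → ℂ) : ℕ → ι → ℂ
  | 0, _ => 0
  | k + 1, s => if s ∈ Fr then t s else P s (triangularIter t k)

theorem triangularIter_eq (hP : IsTriangular rank P) (t : ι → ℂ) (s : ι)
    (k l : ℕ) (hk : rank s < k) (hl : rank s < l) :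
    triangularIter Fr P t k s = triangularIter Fr P t l s := by
  induction k generalizing s l with
  | zero => omega
  | succ k ih =>
    obtain ⟨l, rfl⟩ := Nat.exists_eq_succ_of_ne_zero (Nat.ne_zero_of_lt hl)
    simp only [triangularIter]
    split_ifs with h
    · rfl
    · exact hP.congr fun s' hs' => ih s' l (by omega) (by omega)

variable (rank Fr P) in
/-- The solution of a triangular system `x s = P s x`, `s ∉ Fr`, with free variables in `Fr`. -/
def triangularSol (t : ι → ℂ) (s : ι) : ℂ := triangularIter Fr P t (rank s + 1) s

theorem triangularSol_of_mem (t : ι → ℂ) {s : ι} (hs : s ∈ Fr) :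
    triangularSol rank Fr P t s = t s := by
  simp [triangularSol, triangularIter, hs]

theorem triangularSol_of_notMem (hP : IsTriangular rank P) (t : ι → ℂ) {s : ι}
    (hs : s ∉ Fr) : triangularSol rank Fr P t s = P s (triangularSol rank Fr P t) := by
  conv_lhs => simp only [triangularSol, triangularIter, hs, if_false]
  exact hP.congr fun s' hs' => triangularIter_eq hP t s' _ _ hs' (Nat.lt_succ_self _)

theorem triangularSol_mem (hP : IsTriangular rank P) {T : Type} (A : Subalgebra ℂ (T → ℂ))
    (τ : T → ι → ℂ) (hτ : ∀ s ∈ Fr, (fun z => τ z s) ∈ A) (s : ι) :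
    (fun z => triangularSol rank Fr P (τ z) s) ∈ A := by
  induction hr : rank s using Nat.strong_induction_on generalizing s with
  | _ r ih =>
    subst hr
    by_cases hs : s ∈ Fr
    · simpa only [triangularSol_of_mem _ hs] using hτ s hs
    · simp only [triangularSol_of_notMem hP _ hs]
      exact hP A s _ fun s' hs' => ih _ hs' s' rfl

end Triangular

/-! ### The equations of a cell -/

namespace StringCell

open Finset

variable {n : ℕ} (M : ℕ) (φ : ZMod n → Prop) (lam : ℕ → ℂ) (β : Finset ℕ)

/-- The matrix with unit diagonal and off-diagonal entries `x`. -/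
def full (x : ℕ × ℕ → ℂ) (b c : ℕ) : ℂ := if b = c then 1 else x (b, c)

/-- The conditions on the coefficients `x (b, c)` under which the vectors
`u_b = b + ∑ x (b, c) c`, for `b ∈ β`, span a subrepresentation of a string module with basis
`1, …, M`, where `c` runs through the `c > b` outside `β` of the same colour.  For `φ i` there is
an arrow that maps `i` to `lam i` times `i + 1`, and otherwise there is an arrow that maps
`i + 1` to `lam i` times `i`.  The colours are the residues modulo `n`.

The subspace is given by the equations that express the coordinates outside `β` in terms of those in
`β`.  The conditions `fwd` and `bwd` are these equations for the image of `u_b` under an arrow. -/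
structure IsSol (x : ℕ × ℕ → ℂ) : Prop where
  supp : ∀ b c, x (b, c) ≠ 0 → b ∈ β ∧ c ∉ β ∧ b < c ∧ c ≤ M ∧ (c : ZMod n) = b
  fwd : ∀ b ∈ β, φ b → ∀ j : ℕ, j + 1 ≤ M → j + 1 ∉ β → (j : ZMod n) = b →
    lam j * full x b j =
      ∑ m ∈ range M, if m + 1 ∈ β then lam m * full x b m * full x (m + 1) (j + 1) else 0
  bwd : ∀ i : ℕ, i + 1 ∈ β → ¬ φ i → ∀ j : ℕ, 1 ≤ j → j ≤ M → j ∉ β → (j : ZMod n) = i →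
    lam j * full x (i + 1) (j + 1) =
      ∑ k ∈ range (M + 1), if k ∈ β then lam k * full x (i + 1) (k + 1) * full x k j else 0

/-- `β` is closed under the arrows between the basis elements. -/
def Closed : Prop :=
  ∀ i : ℕ, 1 ≤ i → i + 1 ≤ M → (φ i → i ∈ β → i + 1 ∈ β) ∧ (¬ φ i → i + 1 ∈ β → i ∈ β)

/-- The pairs `(i, j)` that index the nontrivial conditions: a condition relates the coefficients
at `(i, j)` and `(i + 1, j + 1)`, up to terms of higher order. -/
def Cond (i j : ℕ) : Prop :=
  i < j ∧ j ≤ M ∧ (j : ZMod n) = i ∧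
    ((φ i ∧ i ∈ β ∧ j + 1 ∉ β ∧ j + 1 ≤ M) ∨ (¬ φ i ∧ i + 1 ∈ β ∧ j ∉ β))

/-- The terms of higher order.  They only involve coefficients at pairs `(b, c)` with
`c - b < j - i`. -/
def rest (x : ℕ × ℕ → ℂ) (i j : ℕ) : ℂ :=
  open Classical in
  if φ i then ∑ m ∈ Ioo i j, lam m * x (i, m) * x (m + 1, j + 1)
  else - ∑ m ∈ Ioo i j, lam m * x (i + 1, m + 1) * x (m, j)

variable {M φ lam β}

theorem sum_fwd {x : ℕ × ℕ → ℂ}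
    (hx : ∀ b c, x (b, c) ≠ 0 → b ∈ β ∧ c ∉ β ∧ b < c ∧ c ≤ M ∧ (c : ZMod n) = b) {b j : ℕ}
    (hbj : b < j) (hj : j + 1 ≤ M) (hjβ : j + 1 ∉ β) :
    (∑ m ∈ range M, if m + 1 ∈ β then lam m * full x b m * full x (m + 1) (j + 1) else 0) =
      lam b * x (b + 1, j + 1) + ∑ m ∈ Ioo b j, lam m * x (b, m) * x (m + 1, j + 1) := by
  have h1 : ∀ m, m ∉ Ico b j →
      (if m + 1 ∈ β then lam m * full x b m * full x (m + 1) (j + 1) else 0) = 0 := by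
    intro m hm
    split_ifs with hmβ
    · rw [mem_Ico, not_and_or, not_le, not_lt] at hm
      rcases hm with hm | hm
      · have : full x b m = 0 := by
          rw [full, if_neg hm.ne']
          by_contra h
          exact absurd (hx _ _ h).2.2.1 (by omega)
        rw [this]
        ring
      · have : full x (m + 1) (j + 1) = 0 := by
          rw [full, if_neg (by rintro h; rw [h] at hmβ; exact hjβ hmβ)]
          by_contra h
          exact absurd (hx _ _ h).2.2.1 (by omega)
        rw [this]
        ring
    · rfl
  have h2 : ∀ m ∈ Ioo b j, (if m + 1 ∈ β then lam m * full x b m * full x (m + 1) (j + 1) else 0) =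
      lam m * x (b, m) * x (m + 1, j + 1) := by
    intro m hm
    rw [mem_Ioo] at hm
    rw [full, full, if_neg (by omega : ¬ b = m), if_neg (by omega : ¬ m + 1 = j + 1)]
    split_ifs with hmβ
    · rfl
    · have : x (m + 1, j + 1) = 0 := by
        by_contra h
        exact hmβ (hx _ _ h).1
      rw [this, mul_zero]
  rw [← sum_subset (s₁ := Ico b j) (fun m hm => by rw [mem_Ico] at hm; rw [mem_range]; omega)
    (fun m _ hm => h1 m hm), ← Ioo_insert_left hbj, sum_insert left_notMem_Ioo, sum_congr rfl h2]
  congr 1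
  rw [full, full, if_pos rfl, if_neg (by omega : ¬ b + 1 = j + 1)]
  split_ifs with hb
  · ring
  · have : x (b + 1, j + 1) = 0 := by
      by_contra h
      exact hb (hx _ _ h).1
    rw [this, mul_zero]

theorem sum_bwd {x : ℕ × ℕ → ℂ}
    (hx : ∀ b c, x (b, c) ≠ 0 → b ∈ β ∧ c ∉ β ∧ b < c ∧ c ≤ M ∧ (c : ZMod n) = b) {i j : ℕ}
    (hij : i < j) (hj : j ≤ M) (hjβ : j ∉ β) :
    (∑ k ∈ range (M + 1), if k ∈ β then lam k * full x (i + 1) (k + 1) * full x k j else 0) =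
      lam i * x (i, j) + ∑ k ∈ Ioo i j, lam k * x (i + 1, k + 1) * x (k, j) := by
  have h1 : ∀ k, k ∉ Ico i j →
      (if k ∈ β then lam k * full x (i + 1) (k + 1) * full x k j else 0) = 0 := by
    intro k hk
    split_ifs with hkβ
    · rw [mem_Ico, not_and_or, not_le, not_lt] at hk
      rcases hk with hk | hk
      · have : full x (i + 1) (k + 1) = 0 := by
          rw [full, if_neg (by omega)]
          by_contra h
          exact absurd (hx _ _ h).2.2.1 (by omega)
        rw [this]
        ring
      · have : full x k j = 0 := by
          rw [full, if_neg (by rintro rfl; exact hjβ hkβ)]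
          by_contra h
          exact absurd (hx _ _ h).2.2.1 (by omega)
        rw [this]
        ring
    · rfl
  have h2 : ∀ k ∈ Ioo i j, (if k ∈ β then lam k * full x (i + 1) (k + 1) * full x k j else 0) =
      lam k * x (i + 1, k + 1) * x (k, j) := by
    intro k hk
    rw [mem_Ioo] at hk
    rw [full, full, if_neg (by omega : ¬ i + 1 = k + 1), if_neg (by omega : ¬ k = j)]
    split_ifs with hkβ
    · rfl
    · have : x (k, j) = 0 := by
        by_contra h
        exact hkβ (hx _ _ h).1
      rw [this, mul_zero]
  rw [← sum_subset (s₁ := Ico i j) (fun m hm => by rw [mem_Ico] at hm; rw [mem_range]; omega)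
    (fun m _ hm => h1 m hm), ← Ioo_insert_left hij, sum_insert left_notMem_Ioo, sum_congr rfl h2]
  congr 1
  rw [full, full, if_pos rfl, if_neg (by omega : ¬ i = j)]
  split_ifs with hb
  · ring
  · have : x (i, j) = 0 := by
      by_contra h
      exact hb (hx _ _ h).1
    rw [this, mul_zero]

/-- The conditions in triangular form. -/
theorem isSol_iff (hβ : ∀ b ∈ β, 1 ≤ b ∧ b ≤ M) (hcl : Closed M φ β) {x : ℕ × ℕ → ℂ} :
    IsSol M φ lam β x ↔
      (∀ b c, x (b, c) ≠ 0 → b ∈ β ∧ c ∉ β ∧ b < c ∧ c ≤ M ∧ (c : ZMod n) = b) ∧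
      ∀ i j, Cond M φ β i j →
        (φ i → lam j * x (i, j) = lam i * x (i + 1, j + 1) + rest φ lam x i j) ∧
        (¬ φ i → lam i * x (i, j) = lam j * x (i + 1, j + 1) + rest φ lam x i j) := by
  constructor
  · intro h
    refine ⟨h.supp, ?_⟩
    rintro i j ⟨hij, hj, hc, hF | hB⟩
    · refine ⟨fun hφ => ?_, fun hφ => absurd hF.1 hφ⟩
      have := h.fwd i hF.2.1 hφ j hF.2.2.2 hF.2.2.1 hc
      rw [sum_fwd h.supp hij hF.2.2.2 hF.2.2.1, full, if_neg hij.ne] at this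
      rw [this, rest, if_pos hφ]
    · refine ⟨fun hφ => absurd hφ hB.1, fun hφ => ?_⟩
      have := h.bwd i hB.2.1 hφ j (by omega) hj hB.2.2 hc
      rw [sum_bwd h.supp hij hj hB.2.2, full, if_neg (by omega)] at this
      rw [this, rest, if_neg hφ]
      ring
  · rintro ⟨hx, h⟩
    refine ⟨hx, ?_, ?_⟩
    · intro b hb hφ j hj hjβ hc
      rcases lt_trichotomy b j with hbj | rfl | hbj
      · rw [sum_fwd hx hbj hj hjβ, full, if_neg hbj.ne,
          (h b j ⟨hbj, by omega, hc, Or.inl ⟨hφ, hb, hjβ, hj⟩⟩).1 hφ, rest, if_pos hφ]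
      · exact absurd ((hcl b (hβ b hb).1 hj).1 hφ hb) hjβ
      · have hz : ∀ c, c < b → full x b c = 0 := by
          intro c hc
          rw [full, if_neg hc.ne']
          by_contra h
          exact absurd (hx _ _ h).2.2.1 (by omega)
        rw [hz j hbj, mul_zero]
        refine (sum_eq_zero fun m _ => ?_).symm
        split_ifs with hm
        · rcases lt_or_ge m b with hmb | hmb
          · rw [hz m hmb]
            ring
          · have : full x (m + 1) (j + 1) = 0 := by
              rw [full, if_neg (by omega)]
              by_contra h
              exact absurd (hx _ _ h).2.2.1 (by omega)
            rw [this, mul_zero]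
        · rfl
    · intro i hi hφ j hj1 hj hjβ hc
      rcases lt_trichotomy i j with hij | rfl | hij
      · have := (h i j ⟨hij, hj, hc, Or.inr ⟨hφ, hi, hjβ⟩⟩).2 hφ
        rw [rest, if_neg hφ] at this
        rw [sum_bwd hx hij hj hjβ, full, if_neg (by omega), this]
        ring
      · exact absurd ((hcl i hj1 (hβ _ hi).2).2 hφ hi) hjβ
      · have hz : ∀ c, c < i + 1 → full x (i + 1) c = 0 := by
          intro c hc
          rw [full, if_neg hc.ne']
          by_contra h
          exact absurd (hx _ _ h).2.2.1 (by omega)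
        rw [hz _ (by omega), mul_zero]
        refine (sum_eq_zero fun k _ => ?_).symm
        split_ifs with hk
        · rcases lt_or_ge k i with hki | hki
          · rw [hz _ (by omega)]
            ring
          · have : full x k j = 0 := by
              rw [full, if_neg (by omega)]
              by_contra h
              exact absurd (hx _ _ h).2.2.1 (by omega)
            rw [this, mul_zero]
        · rfl

/-- The set of all pairs `(b, c)` that index coefficients. -/
def coeffs (n M : ℕ) (β : Finset ℕ) : Finset (ℕ × ℕ) :=
  {s ∈ β ×ˢ range (M + 1) | s.2 ∉ β ∧ s.1 < s.2 ∧ (s.2 : ZMod n) = s.1}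

theorem mem_coeffs {s : ℕ × ℕ} : s ∈ coeffs n M β ↔
    s.1 ∈ β ∧ s.2 ∉ β ∧ s.1 < s.2 ∧ s.2 ≤ M ∧ (s.2 : ZMod n) = s.1 := by
  simp only [coeffs, mem_filter, mem_product, mem_range]
  constructor
  · rintro ⟨⟨h1, h2⟩, h3, h4, h5⟩
    exact ⟨h1, h3, h4, by omega, h5⟩
  · rintro ⟨h1, h3, h4, h2, h5⟩
    exact ⟨⟨h1, by omega⟩, h3, h4, h5⟩

theorem rest_mem {T : Type} (A : Subalgebra ℂ (T → ℂ)) (x : T → ℕ × ℕ → ℂ) {i j : ℕ} (hj : j ≤ M)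
    (h : ∀ b c, b ≤ M → c - b < j - i → (fun z => x z (b, c)) ∈ A) :
    (fun z => rest φ lam (x z) i j) ∈ A := by
  have hmul : ∀ {f g : T → ℂ} (c : ℂ), f ∈ A → g ∈ A → (fun z => c * f z * g z) ∈ A :=
    fun c hf hg => A.mul_mem (A.mul_mem (A.algebraMap_mem c) hf) hg
  have hsum : ∀ f : ℕ → T → ℂ, (∀ m ∈ Ioo i j, f m ∈ A) →
      (fun z => ∑ m ∈ Ioo i j, f m z) ∈ A := by
    intro f hf
    have := A.sum_mem hf
    convert this using 1
    funext z
    simp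
  unfold rest
  split_ifs
  · refine hsum _ fun m hm => ?_
    rw [mem_Ioo] at hm
    exact hmul _ (h _ _ (by omega) (by omega)) (h _ _ (by omega) (by omega))
  · refine A.neg_mem (hsum _ fun m hm => ?_)
    rw [mem_Ioo] at hm
    exact hmul _ (h _ _ (by omega) (by omega)) (h _ _ (by omega) (by omega))

variable (M φ lam β) in
/-- A polynomial parametrization of the solutions by the coefficients at a set of free pairs. -/
structure Param where
  /-- The positions of the free coefficients. -/
  free : Finset (ℕ × ℕ)
  free_subset : free ⊆ coeffs n M β
  /-- The solution with given values of the free coefficients; other values are ignored. -/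
  sol : (ℕ × ℕ → ℂ) → ℕ × ℕ → ℂ
  isSol : ∀ t, IsSol M φ lam β (sol t)
  sol_of_mem : ∀ t, ∀ s ∈ free, sol t s = t s
  sol_unique : ∀ x t, IsSol M φ lam β x → (∀ s ∈ free, t s = x s) → sol t = x
  /-- The solution is polynomial in the free coefficients, in the sense of `IsTriangular`. -/
  sol_mem : ∀ {T : Type} (A : Subalgebra ℂ (T → ℂ)) (τ : T → ℕ × ℕ → ℂ),
    (∀ s ∈ free, (fun z => τ z s) ∈ A) → ∀ s, (fun z => sol (τ z) s) ∈ A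

open Classical in
/-- If the condition with index `(i, j)` can be solved for the coefficient at `sv (i, j)`, in terms
of coefficients of lower rank, then the solutions are parametrized by the other coefficients. -/
theorem nonempty_param (hβ : ∀ b ∈ β, 1 ≤ b ∧ b ≤ M) (hcl : Closed M φ β) (sv : ℕ × ℕ → ℕ × ℕ)
    (hsv : Function.Injective sv) (rank : ℕ × ℕ → ℕ) (P : ℕ × ℕ → (ℕ × ℕ → ℂ) → ℂ)
    (hmem : ∀ i j, Cond M φ β i j → sv (i, j) ∈ coeffs n M β)
    (hP : ∀ i j, Cond M φ β i j → ∀ {T : Type} (A : Subalgebra ℂ (T → ℂ)) (x : T → ℕ × ℕ → ℂ),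
      (∀ s', rank s' < rank (sv (i, j)) → (fun z => x z s') ∈ A) → (fun z => P (i, j) (x z)) ∈ A)
    (hsol : ∀ i j, Cond M φ β i j → ∀ x, x (sv (i, j)) = P (i, j) x ↔
      (φ i → lam j * x (i, j) = lam i * x (i + 1, j + 1) + rest φ lam x i j) ∧
        (¬ φ i → lam i * x (i, j) = lam j * x (i + 1, j + 1) + rest φ lam x i j)) :
    Nonempty (Param M φ lam β) := by
  -- the positions of the coefficients for which some condition is solved
  let bound : ℕ × ℕ → Prop := fun s => ∃ r : ℕ × ℕ, Cond M φ β r.1 r.2 ∧ sv r = s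
  let free : Finset (ℕ × ℕ) := {s ∈ coeffs n M β | ¬ bound s}
  let Q : ℕ × ℕ → (ℕ × ℕ → ℂ) → ℂ := fun s x => if h : bound s then P h.choose x else 0
  have hQ : ∀ i j, Cond M φ β i j → ∀ x, Q (sv (i, j)) x = P (i, j) x := by
    intro i j hij x
    have h : bound (sv (i, j)) := ⟨(i, j), hij, rfl⟩
    have : h.choose = (i, j) := hsv h.choose_spec.2
    simp only [Q, dif_pos h, this]
  have hQ0 : ∀ s x, ¬ bound s → Q s x = 0 := fun s x h => dif_neg h
  have htri : IsTriangular rank Q := by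
    intro T A s x hx
    by_cases h : bound s
    · obtain ⟨⟨i, j⟩, hij, rfl⟩ := h
      simpa only [hQ i j hij] using hP i j hij A x hx
    · simp only [hQ0 s _ h]
      exact A.zero_mem
  have key : ∀ x, IsSol M φ lam β x ↔ ∀ s ∉ free, x s = Q s x := by
    intro x
    rw [isSol_iff hβ hcl]
    constructor
    · rintro ⟨h1, h2⟩ s hs
      by_cases hb : bound s
      · obtain ⟨⟨i, j⟩, hij, rfl⟩ := hb
        rw [hQ i j hij, hsol i j hij]
        exact h2 i j hij
      · rw [hQ0 s x hb]
        by_contra hx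
        exact hs (mem_filter.2 ⟨mem_coeffs.2 (h1 _ _ hx), hb⟩)
    · intro h
      refine ⟨fun b c hx => (mem_coeffs (s := (b, c))).1 ?_, fun i j hij => ?_⟩
      · by_contra hs
        have hb : ¬ bound (b, c) := by
          rintro ⟨⟨i, j⟩, hij, he⟩
          exact hs (he ▸ hmem i j hij)
        exact hx ((h (b, c) fun hf => hs (mem_filter.1 hf).1).trans (hQ0 _ x hb))
      · rw [← hsol i j hij, ← hQ i j hij]
        exact h _ fun hf => (mem_filter.1 hf).2 ⟨(i, j), hij, rfl⟩
  exact ⟨{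
    free := free
    free_subset := filter_subset _ _
    sol := triangularSol rank free Q
    isSol := fun t => (key _).2 fun s hs => triangularSol_of_notMem htri t hs
    sol_of_mem := fun t s hs => triangularSol_of_mem t hs
    sol_unique := fun x t hx ht => triangular_unique htri
      (fun s hs => triangularSol_of_notMem htri t hs) ((key x).1 hx)
      fun s hs => (triangularSol_of_mem t hs).trans (ht s hs)
    sol_mem := fun A τ hτ => triangularSol_mem htri A τ hτ }⟩

theorem rank_lt {M d d' b b' : ℕ} (hb : b' ≤ M + 1) (h : d' < d) :
    d' * (M + 2) + b' < d * (M + 2) + b := by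
  have : (d' + 1) * (M + 2) ≤ d * (M + 2) := Nat.mul_le_mul_right _ h
  rw [add_mul, one_mul] at this
  omega

/-- If the arrow of the quiver at the end of the string points away from it, the condition with
index `(i, j)` is solved for the coefficient at `(i + 1, j + 1)`.  The coefficients are ordered by
the difference `c - b`, and those with the same difference by `b`. -/
theorem nonempty_param_of_right (hlam : ∀ i, lam i ≠ 0) (hβ : ∀ b ∈ β, 1 ≤ b ∧ b ≤ M)
    (hcl : Closed M φ β) (hφ : φ M) : Nonempty (Param M φ lam β) := by
  classical
  refine nonempty_param hβ hcl (fun s => (s.1 + 1, s.2 + 1)) ?_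
    (fun s => (s.2 - s.1) * (M + 2) + s.1)
    (fun s x => if φ s.1 then (lam s.1)⁻¹ * (lam s.2 * x s - rest φ lam x s.1 s.2)
      else (lam s.2)⁻¹ * (lam s.1 * x s - rest φ lam x s.1 s.2)) ?_ ?_ ?_
  · rintro ⟨i, j⟩ ⟨i', j'⟩ h
    simpa using h
  · rintro i j ⟨hij, hj, hc, ⟨h1, h2, h3, h4⟩ | ⟨h1, h2, h3⟩⟩
    · exact mem_coeffs.2 ⟨(hcl i (hβ i h2).1 (by omega)).1 h1 h2, h3, by simpa using hij, h4,
        by push_cast; rw [hc]⟩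
    -- `(i + 1, j + 1)` is an admissible position: `j = M` is excluded by the assumption on `φ M`
    · have hjM : j ≠ M := by
        rintro rfl
        rw [hc] at hφ
        exact h1 hφ
      refine mem_coeffs.2 ⟨h2, fun h => h3 ?_, by simpa using hij, by omega,
        by push_cast; rw [hc]⟩
      exact (hcl j (by omega) (by omega)).2 (by rwa [hc]) h
  · rintro i j ⟨hij, hj, -, -⟩ T A x hx
    have hr : (fun z => rest φ lam (x z) i j) ∈ A := by
      refine rest_mem A x hj fun b c hb hbc => hx _ ?_
      rw [Nat.add_sub_add_right]
      exact rank_lt (by omega) hbc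
    have h1 : (fun z => x z (i, j)) ∈ A := by
      refine hx _ ?_
      rw [Nat.add_sub_add_right]
      exact Nat.lt_succ_self _
    dsimp only
    split_ifs
    · exact A.mul_mem (A.algebraMap_mem _) (A.sub_mem (A.mul_mem (A.algebraMap_mem _) h1) hr)
    · exact A.mul_mem (A.algebraMap_mem _) (A.sub_mem (A.mul_mem (A.algebraMap_mem _) h1) hr)
  · intro i j _ x
    dsimp only
    split_ifs with h
    · rw [eq_inv_mul_iff_mul_eq₀ (hlam _), eq_sub_iff_add_eq, eq_comm]
      exact ⟨fun H => ⟨fun _ => H, fun h' => absurd h h'⟩, fun H => H.1 h⟩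
    · rw [eq_inv_mul_iff_mul_eq₀ (hlam _), eq_sub_iff_add_eq, eq_comm]
      exact ⟨fun H => ⟨fun h' => absurd h' h, fun _ => H⟩, fun H => H.2 h⟩

/-- If the arrow of the quiver at the beginning of the string points towards it, the condition
with index `(i, j)` is solved for the coefficient at `(i, j)`.  The coefficients are ordered by the
difference `c - b`, and those with the same difference by decreasing `b`. -/
theorem nonempty_param_of_left (hlam : ∀ i, lam i ≠ 0) (hβ : ∀ b ∈ β, 1 ≤ b ∧ b ≤ M)
    (hcl : Closed M φ β) (hφ : φ 0) : Nonempty (Param M φ lam β) := by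
  classical
  refine nonempty_param hβ hcl id Function.injective_id
    (fun s => (s.2 - s.1) * (M + 2) + (M + 1 - s.1))
    (fun s x => if φ s.1 then
        (lam s.2)⁻¹ * (lam s.1 * x (s.1 + 1, s.2 + 1) + rest φ lam x s.1 s.2)
      else (lam s.1)⁻¹ * (lam s.2 * x (s.1 + 1, s.2 + 1) + rest φ lam x s.1 s.2)) ?_ ?_ ?_
  · rintro i j ⟨hij, hj, hc, ⟨h1, h2, h3, h4⟩ | ⟨h1, h2, h3⟩⟩
    · refine mem_coeffs.2 ⟨h2, fun h => h3 ?_, hij, hj, hc⟩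
      exact (hcl j (hβ j h).1 h4).1 (by simpa only [id, hc] using h1) h
    -- `(i, j)` is an admissible position: `i = 0` is excluded by the assumption on `φ 0`
    · have hi : i ≠ 0 := by
        rintro rfl
        rw [Nat.cast_zero] at h1
        exact h1 hφ
      exact mem_coeffs.2 ⟨(hcl i (by omega) (by omega)).2 h1 h2, h3, hij, hj, hc⟩
  · rintro i j ⟨hij, hj, -, -⟩ T A x hx
    have hr : (fun z => rest φ lam (x z) i j) ∈ A :=
      rest_mem A x hj fun b c hb hbc => hx _ (rank_lt (by omega) hbc)
    have h1 : (fun z => x z (i + 1, j + 1)) ∈ A := by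
      refine hx _ ?_
      simp only [id]
      rw [Nat.add_sub_add_right]
      omega
    dsimp only
    split_ifs
    · exact A.mul_mem (A.algebraMap_mem _) (A.add_mem (A.mul_mem (A.algebraMap_mem _) h1) hr)
    · exact A.mul_mem (A.algebraMap_mem _) (A.add_mem (A.mul_mem (A.algebraMap_mem _) h1) hr)
  · intro i j _ x
    dsimp only [id]
    split_ifs with h
    · rw [eq_inv_mul_iff_mul_eq₀ (hlam _)]
      exact ⟨fun H => ⟨fun _ => H, fun h' => absurd h h'⟩, fun H => H.1 h⟩
    · rw [eq_inv_mul_iff_mul_eq₀ (hlam _)]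
      exact ⟨fun H => ⟨fun h' => absurd h' h, fun _ => H⟩, fun H => H.2 h⟩

end StringCell

/-! ### Coordinates of a string module -/

namespace QuiverRep

open Finset

variable {V : Type u} [Quiver.{v} V]

/-- Coordinates in which a representation of a quiver of type `Ã` is a string: basis vectors
`bv 1, …, bv M`, placed at the vertices `q 1, …, q M`, and the dual coordinates `co i`, where
`q` runs periodically through the vertices of the quiver.  Between `q r` and `q (r + 1)` there is
an arrow which maps `bv i` to a multiple of `bv (i + 1)` for all `i` of residue `r` if `φ r`, and
`bv (i + 1)` to a multiple of `bv i` otherwise.  The functions `co i` and `bv i` are zero at other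
vertices than `q i`, and for `i` outside `1, …, M`. -/
structure StringCoords (X : QuiverRep.{u, v, w} V) where
  n : ℕ
  M : ℕ
  q : ZMod n → V
  q_injective : Function.Injective q
  φ : ZMod n → Prop
  lam : ℕ → ℂ
  lam_ne_zero : ∀ i, lam i ≠ 0
  co : ℕ → ∀ p, X.obj p →ₗ[ℂ] ℂ
  bv : ℕ → ∀ p, X.obj p
  co_bv : ∀ i p, (i ∈ Icc 1 M ∧ q i = p) → ∀ j, co j p (bv i p) = if j = i then 1 else 0
  bv_eq_zero : ∀ i p, ¬ (i ∈ Icc 1 M ∧ q i = p) → bv i p = 0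
  sum_co : ∀ p u, ∑ i ∈ Icc 1 M, co i p u • bv i p = u
  arrow : ∀ {p p' : V} (a : p ⟶ p'), ∃ r,
    (φ r ∧ p = q r ∧ p' = q (r + 1) ∧ ∀ i : ℕ, (i : ZMod n) = r → i + 1 ≤ M → ∀ u,
      co (i + 1) p' (X.map a u) = lam i * co i p u) ∨
    (¬ φ r ∧ p = q (r + 1) ∧ p' = q r ∧ ∀ i : ℕ, (i : ZMod n) = r → 1 ≤ i → i ≤ M → ∀ u,
      co i p' (X.map a u) = lam i * co (i + 1) p u)
  exists_arrow : ∀ r, φ r → ∃ a : q r ⟶ q (r + 1),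
    ∀ i : ℕ, (i : ZMod n) = r → i + 1 ≤ M → ∀ u,
      co (i + 1) _ (X.map a u) = lam i * co i _ u
  exists_arrow' : ∀ r, ¬ φ r → ∃ a : q (r + 1) ⟶ q r,
    ∀ i : ℕ, (i : ZMod n) = r → 1 ≤ i → i ≤ M → ∀ u,
      co i _ (X.map a u) = lam i * co (i + 1) _ u

namespace StringCoords

variable {X : QuiverRep.{u, v, w} V} (K : X.StringCoords)

theorem co_eq_zero {i : ℕ} {p : V} (h : ¬ (i ∈ Icc 1 K.M ∧ K.q i = p)) (u : X.obj p) :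
    K.co i p u = 0 := by
  rw [← K.sum_co p u, map_sum]
  refine sum_eq_zero fun j hj => ?_
  rw [map_smul]
  by_cases hjp : K.q j = p
  · rw [K.co_bv j p ⟨hj, hjp⟩, if_neg, smul_zero]
    rintro rfl
    exact h ⟨hj, hjp⟩
  · rw [K.bv_eq_zero j p (fun h => hjp h.2), map_zero, smul_zero]

theorem ext_co {p : V} {u u' : X.obj p}
    (h : ∀ i ∈ Icc 1 K.M, K.q i = p → K.co i p u = K.co i p u') :
    u = u' := by
  rw [← K.sum_co p u, ← K.sum_co p u']
  refine sum_congr rfl fun i hi => ?_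
  by_cases hp : K.q i = p
  · rw [h i hi hp]
  · rw [K.bv_eq_zero i p (fun h => hp h.2), smul_zero, smul_zero]

/-- The vector with given coordinates. -/
def vec (p : V) (f : ℕ → ℂ) : X.obj p := ∑ i ∈ Icc 1 K.M, f i • K.bv i p

theorem co_vec {p : V} (f : ℕ → ℂ) {c : ℕ} (hc : c ∈ Icc 1 K.M) (hcp : K.q c = p) :
    K.co c p (K.vec p f) = f c := by
  rw [vec, map_sum, sum_eq_single c]
  · rw [map_smul, K.co_bv c p ⟨hc, hcp⟩, if_pos rfl, smul_eq_mul, mul_one]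
  · intro j hj hjc
    rw [map_smul]
    by_cases hjp : K.q j = p
    · rw [K.co_bv j p ⟨hj, hjp⟩, if_neg hjc.symm, smul_zero]
    · rw [K.bv_eq_zero j p (fun h => hjp h.2), map_zero, smul_zero]
  · exact fun h => absurd hc h

theorem finite_obj (K : X.StringCoords) (p : V) : Module.Finite ℂ (X.obj p) := by
  refine Module.Finite.of_surjective
    (Fintype.linearCombination ℂ fun i : Icc 1 K.M => K.bv i p) fun u => ⟨fun i => K.co i p u, ?_⟩
  rw [Fintype.linearCombination_apply]
  exact (sum_coe_sort (Icc 1 K.M) fun i => K.co i p u • K.bv i p).trans (K.sum_co p u)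

/-! ### Pivots -/

/-- The index `i` is the smallest index of a nonzero coordinate of a vector in `U`. -/
def IsPivot (U : ∀ p, Submodule ℂ (X.obj p)) (i : ℕ) : Prop :=
  ∃ p, ∃ u ∈ U p, K.co i p u ≠ 0 ∧ ∀ j < i, K.co j p u = 0

variable {K} {U : ∀ p, Submodule ℂ (X.obj p)}

theorem of_co_ne_zero {i : ℕ} {p : V} {u : X.obj p} (h : K.co i p u ≠ 0) :
    i ∈ Icc 1 K.M ∧ K.q i = p := by
  by_contra hi
  exact h (K.co_eq_zero hi u)

theorem IsPivot.mem_Icc {i : ℕ} (h : K.IsPivot U i) : i ∈ Icc 1 K.M := by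
  obtain ⟨p, u, -, h, -⟩ := h
  exact (of_co_ne_zero h).1

theorem exists_isPivot {p : V} {u : X.obj p} (hu : u ∈ U p) {j : ℕ} (hj : K.co j p u ≠ 0) :
    ∃ i ≤ j, K.IsPivot U i ∧ K.co i p u ≠ 0 := by
  classical
  have h : ∃ i, K.co i p u ≠ 0 := ⟨j, hj⟩
  exact ⟨Nat.find h, Nat.find_min' h hj,
    ⟨p, u, hu, Nat.find_spec h, fun k hk => not_not.1 (Nat.find_min h hk)⟩, Nat.find_spec h⟩

/-- The elements of the reduced basis of a family of subspaces: one for every pivot `b`, with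
leading coefficient `1` at `b` and vanishing coordinates at the other pivots. By descending
induction, the coordinates at the larger pivots are eliminated. -/
theorem IsPivot.exists_reduced {b : ℕ} (hb : K.IsPivot U b) {p : V} (hbp : K.q b = p) :
    ∃ u ∈ U p, K.co b p u = 1 ∧ (∀ c, K.IsPivot U c → c ≠ b → K.co c p u = 0) ∧
      ∀ c < b, K.co c p u = 0 := by
  classical
  induction hk : K.M - b using Nat.strong_induction_on generalizing b with
  | _ k ih =>
    subst hk
    have hbM := Finset.mem_Icc.1 hb.mem_Icc
    have h : ∀ c, ∃ u ∈ U p, (c ∈ Ioc b K.M ∧ K.IsPivot U c ∧ K.q c = p →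
        K.co c p u = 1 ∧ (∀ d, K.IsPivot U d → d ≠ c → K.co d p u = 0) ∧
          ∀ d < c, K.co d p u = 0) := by
      intro c
      by_cases hc : c ∈ Ioc b K.M ∧ K.IsPivot U c ∧ K.q c = p
      · have hc1 := Finset.mem_Ioc.1 hc.1
        obtain ⟨u, hu, h⟩ := ih (K.M - c) (by omega) hc.2.1 hc.2.2 rfl
        exact ⟨u, hu, fun _ => h⟩
      · exact ⟨0, Submodule.zero_mem _, fun h => absurd h hc⟩
    choose f hfU hf using h
    let s : Finset ℕ := {c ∈ Ioc b K.M | K.IsPivot U c ∧ K.q c = p}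
    have hs : ∀ c ∈ s, c ∈ Ioc b K.M ∧ K.IsPivot U c ∧ K.q c = p := fun c hc => mem_filter.1 hc
    have hsb : ∀ c ∈ s, b < c := fun c hc => (Finset.mem_Ioc.1 (hs c hc).1).1
    obtain ⟨w, hw, hwb, hw'⟩ : ∃ w ∈ U p, K.co b p w = 1 ∧ ∀ c < b, K.co c p w = 0 := by
      obtain ⟨p', w, hw, hw1, hw2⟩ := hb
      obtain rfl : p' = p := (of_co_ne_zero hw1).2.symm.trans hbp
      refine ⟨(K.co b _ w)⁻¹ • w, Submodule.smul_mem _ _ hw, ?_, fun c hc => ?_⟩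
      · rw [map_smul, smul_eq_mul, inv_mul_cancel₀ hw1]
      · rw [map_smul, hw2 c hc, smul_zero]
    refine ⟨w - ∑ c ∈ s, K.co c _ w • f c, ?_, ?_, ?_, ?_⟩
    · exact Submodule.sub_mem _ hw
        (Submodule.sum_mem _ fun c _ => Submodule.smul_mem _ _ (hfU c))
    · rw [map_sub, map_sum, hwb, sum_eq_zero, sub_zero]
      intro c hc
      rw [map_smul, (hf c (hs c hc)).2.2 b (hsb c hc), smul_zero]
    · intro d hd hdb
      by_cases hds : d ∈ s
      · rw [map_sub, map_sum, sum_eq_single d, map_smul, (hf d (hs d hds)).1, smul_eq_mul, mul_one,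
          sub_self]
        · intro c hc hcd
          rw [map_smul, (hf c (hs c hc)).2.1 d hd hcd.symm, smul_zero]
        · exact fun h => absurd hds h
      · have hz : K.co d p w = 0 := by
          rcases lt_or_gt_of_ne hdb with h | h
          · exact hw' d h
          · refine K.co_eq_zero (fun h1 => hds (mem_filter.2 ⟨?_, hd, h1.2⟩)) _
            exact Finset.mem_Ioc.2 ⟨h, (Finset.mem_Icc.1 h1.1).2⟩
        rw [map_sub, map_sum, hz, sum_eq_zero, sub_zero]
        intro c hc
        rw [map_smul, (hf c (hs c hc)).2.1 d hd (fun h => hds (h ▸ hc)), smul_zero]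
    · intro d hdb
      rw [map_sub, map_sum, hw' d hdb, sum_eq_zero, sub_zero]
      intro c hc
      rw [map_smul, (hf c (hs c hc)).2.2 d (hdb.trans (hsb c hc)), smul_zero]

theorem co_map_fwd {r : ZMod K.n} {p' : V} {u : X.obj (K.q r)} {w : X.obj p'}
    (hp' : p' = K.q (r + 1))
    (h : ∀ i : ℕ, (i : ZMod K.n) = r → i + 1 ≤ K.M → K.co (i + 1) p' w = K.lam i * K.co i _ u)
    {j : ℕ} (hj : j + 1 ≤ K.M) : K.co (j + 1) p' w = K.lam j * K.co j _ u := by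
  by_cases hjr : (j : ZMod K.n) = r
  · exact h j hjr hj
  · rw [K.co_eq_zero (fun h => hjr (K.q_injective h.2)), mul_zero]
    refine K.co_eq_zero (fun h => hjr ?_) _
    have := K.q_injective (h.2.trans hp')
    rw [Nat.cast_succ] at this
    exact add_right_cancel this

theorem co_map_bwd {r : ZMod K.n} {p' : V} {u : X.obj (K.q (r + 1))} {w : X.obj p'}
    (hp' : p' = K.q r)
    (h : ∀ i : ℕ, (i : ZMod K.n) = r → 1 ≤ i → i ≤ K.M → K.co i p' w = K.lam i * K.co (i + 1) _ u)
    {j : ℕ} (hj1 : 1 ≤ j) (hj : j ≤ K.M) : K.co j p' w = K.lam j * K.co (j + 1) _ u := by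
  by_cases hjr : (j : ZMod K.n) = r
  · exact h j hjr hj1 hj
  · rw [K.co_eq_zero (fun h => hjr ?_) u, mul_zero]
    · exact K.co_eq_zero (fun h => hjr (K.q_injective (h.2.trans hp'))) _
    · have := K.q_injective h.2
      rw [Nat.cast_succ] at this
      exact add_right_cancel this

/-- The pivots of a subrepresentation are closed under successors. -/
theorem closed_of_isSubrep (hU : X.IsSubrep U) {β : Finset ℕ} (hβ : ∀ i, i ∈ β ↔ K.IsPivot U i) :
    StringCell.Closed K.M K.φ β := by
  intro i hi1 hiM
  constructor
  · intro hφ hi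
    obtain ⟨a, ha⟩ := K.exists_arrow i hφ
    obtain ⟨p, u, hu, h1, h2⟩ := (hβ i).1 hi
    obtain rfl := (of_co_ne_zero h1).2
    rw [hβ]
    refine ⟨_, X.map a u, hU a u hu, ?_, fun j hj => ?_⟩
    · rw [ha i rfl hiM]
      exact mul_ne_zero (K.lam_ne_zero i) h1
    · cases j with
      | zero => exact K.co_eq_zero (by simp) _
      | succ j =>
        rw [co_map_fwd (w := X.map a u) rfl (fun i hi hiM => ha i hi hiM u) (by omega),
          h2 j (by omega), mul_zero]
  · intro hφ hi
    obtain ⟨a, ha⟩ := K.exists_arrow' i hφ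
    obtain ⟨p, u, hu, h1, h2⟩ := (hβ _).1 hi
    have hp := (of_co_ne_zero h1).2
    rw [Nat.cast_succ] at hp
    subst hp
    rw [hβ]
    refine ⟨_, X.map a u, hU a u hu, ?_, fun j hj => ?_⟩
    · rw [ha i rfl hi1 (by omega)]
      exact mul_ne_zero (K.lam_ne_zero i) h1
    · cases j with
      | zero => exact K.co_eq_zero (by simp) _
      | succ j =>
        rw [co_map_bwd (w := X.map a u) rfl (fun i hi h1 hiM => ha i hi h1 hiM u) (by omega)
          (by omega), h2 _ (by omega), mul_zero]

end StringCoords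

end QuiverRep

/-! ### Normal frames -/

namespace QuiverRep

open Finset

variable {V : Type u} [Quiver.{v} V] {X : QuiverRep.{u, v, w} V}

namespace StringCoords

open Classical in
/-- The elements of a set of indices that lie over a given vertex. -/
def fiber (K : X.StringCoords) (s : Finset ℕ) (p : V) : Finset ℕ := s.filter fun b : ℕ => K.q b = p

theorem mem_fiber {K : X.StringCoords} {s : Finset ℕ} {p : V} {b : ℕ} :
    b ∈ K.fiber s p ↔ b ∈ s ∧ K.q b = p := by
  simp [fiber]

/-- The labels of the cells: the successor closed sets of basis vectors, with `e p` elements over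
every vertex `p`. -/
@[ext] structure Index (K : X.StringCoords) (e : V → ℕ) where
  set : Finset ℕ
  mem_Icc : ∀ b ∈ set, 1 ≤ b ∧ b ≤ K.M
  closed : StringCell.Closed K.M K.φ set
  card : ∀ p, #(K.fiber set p) = e p

namespace Index

variable {K : X.StringCoords} {e : V → ℕ} (β : K.Index e)

/-- An enumeration of the elements over a vertex. -/
def en (p : V) : Fin (e p) ≃ K.fiber β.set p := (equivFinOfCardEq (β.card p)).symm

theorem en_mem {p : V} (k : Fin (e p)) : (β.en p k : ℕ) ∈ β.set := (mem_fiber.1 (β.en p k).2).1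

theorem q_en {p : V} (k : Fin (e p)) : K.q (β.en p k : ℕ) = p := (mem_fiber.1 (β.en p k).2).2

theorem en_inj {p : V} {k l : Fin (e p)} : (β.en p k : ℕ) = β.en p l ↔ k = l :=
  Subtype.val_injective.eq_iff.trans (β.en p).injective.eq_iff

theorem exists_en {b : ℕ} (hb : b ∈ β.set) {p : V} (hp : K.q b = p) : ∃ k, (β.en p k : ℕ) = b :=
  ⟨(β.en p).symm ⟨b, mem_fiber.2 ⟨hb, hp⟩⟩, by rw [Equiv.apply_symm_apply]⟩

theorem sum_en {A : Type*} [AddCommMonoid A] (p : V) (f : ℕ → A)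
    (hf : ∀ b ∈ β.set, K.q b ≠ p → f b = 0) : ∑ k, f (β.en p k) = ∑ b ∈ β.set, f b := by
  classical
  rw [(β.en p).sum_comp fun b => f b, sum_coe_sort (K.fiber β.set p) f, fiber, sum_filter_of_ne]
  intro b hb h
  by_contra hp
  exact h (hf b hb hp)

/-- The square matrix of the coordinates in `β` of a tuple of vectors. -/
def minor (Φ : X.Tuples e) (p : V) : Matrix (Fin (e p)) (Fin (e p)) ℂ :=
  Matrix.of fun k l => K.co (β.en p l) p (Φ p k)

/-- The tuples whose coordinates in `β` form a unit matrix. -/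
def IsNormal (Φ : X.Tuples e) : Prop := ∀ p, β.minor Φ p = 1

variable {β}

theorem IsNormal.co_en {Φ : X.Tuples e} (h : β.IsNormal Φ) (p : V) (k l : Fin (e p)) :
    K.co (β.en p l) p (Φ p k) = if k = l then 1 else 0 := by
  have := congrFun (congrFun (h p) k) l
  rwa [Matrix.one_apply] at this

theorem IsNormal.co_sum {Φ : X.Tuples e} (h : β.IsNormal Φ) (p : V) (c : Fin (e p) → ℂ)
    (l : Fin (e p)) : K.co (β.en p l) p (∑ k, c k • Φ p k) = c l := by
  rw [map_sum, sum_eq_single l]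
  · rw [map_smul, h.co_en, if_pos rfl, smul_eq_mul, mul_one]
  · intro k _ hk
    rw [map_smul, h.co_en, if_neg hk, smul_zero]
  · exact fun h => absurd (mem_univ _) h

theorem IsNormal.mem_frames {Φ : X.Tuples e} (h : β.IsNormal Φ) : Φ ∈ X.frames e := by
  intro p
  rw [Fintype.linearIndependent_iff]
  intro c hc l
  rw [← h.co_sum p c l, hc, map_zero]

theorem IsNormal.spanFrame_eq {Φ : X.Tuples e} (h : β.IsNormal Φ) {U : X.ProdGr e}
    (hU : ∀ p k, Φ p k ∈ U.1 p) : X.spanFrame e ⟨Φ, h.mem_frames⟩ = U := by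
  refine Subtype.ext (funext fun p => ?_)
  have := K.finite_obj p
  refine Submodule.eq_of_le_of_finrank_eq ?_ ?_
  · exact Submodule.span_le.2 (Set.range_subset_iff.2 (hU p))
  · rw [U.2 p]
    exact (X.spanFrame e ⟨Φ, h.mem_frames⟩).2 p

theorem IsNormal.mem_iff {Φ : X.Tuples e} (h : β.IsNormal Φ) {U : X.ProdGr e}
    (hU : ∀ p k, Φ p k ∈ U.1 p) {p : V} {u : X.obj p} :
    u ∈ U.1 p ↔ ∑ k, K.co (β.en p k) p u • Φ p k = u := by
  constructor
  · intro hu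
    rw [← h.spanFrame_eq hU] at hu
    obtain ⟨c, rfl⟩ := (Submodule.mem_span_range_iff_exists_fun ℂ).1 hu
    exact sum_congr rfl fun k _ => by rw [h.co_sum]
  · intro hu
    rw [← hu]
    exact Submodule.sum_mem _ fun k _ => Submodule.smul_mem _ _ (hU p k)

theorem IsNormal.unique {Φ Φ' : X.Tuples e} (h : β.IsNormal Φ) (h' : β.IsNormal Φ')
    {U : X.ProdGr e} (hU : ∀ p k, Φ p k ∈ U.1 p) (hU' : ∀ p k, Φ' p k ∈ U.1 p) : Φ = Φ' := by
  funext p k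
  rw [← (h'.mem_iff hU').1 (hU p k), sum_eq_single k]
  · rw [h.co_en, if_pos rfl, one_smul]
  · intro l _ hl
    rw [h.co_en, if_neg hl.symm, zero_smul]
  · exact fun h => absurd (mem_univ _) h

variable (β)

/-- The open set of points with a normal frame. -/
def chart : Set (X.ProdGr e) := {U | ∃ Φ : X.Tuples e, β.IsNormal Φ ∧ ∀ p k, Φ p k ∈ U.1 p}

open Classical in
/-- The normal frame of a point of the chart. -/
def norm (U : X.ProdGr e) : X.Tuples e := if h : U ∈ β.chart then h.choose else 0

variable {β}

theorem norm_eq {Φ : X.Tuples e} (h : β.IsNormal Φ) {U : X.ProdGr e}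
    (hU : ∀ p k, Φ p k ∈ U.1 p) : β.norm U = Φ := by
  have hc : U ∈ β.chart := ⟨Φ, h, hU⟩
  rw [norm, dif_pos hc]
  exact hc.choose_spec.1.unique h hc.choose_spec.2 hU

variable (β)

/-- The tuple with the same span and normal coordinates. -/
def normalize (Φ : X.Tuples e) : X.Tuples e := fun p k => ∑ j, (β.minor Φ p)⁻¹ k j • Φ p j

theorem minor_sum (Φ : X.Tuples e) (p : V) (c : Matrix (Fin (e p)) (Fin (e p)) ℂ)
    {Φ' : X.Tuples e} (h : ∀ k, Φ' p k = ∑ j, c k j • Φ p j) :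
    β.minor Φ' p = c * β.minor Φ p := by
  ext k l
  simp [minor, h, Matrix.mul_apply]

theorem isNormal_normalize {Φ : X.Tuples e} (h : ∀ p, (β.minor Φ p).det ≠ 0) :
    β.IsNormal (β.normalize Φ) := by
  intro p
  rw [β.minor_sum Φ p (β.minor Φ p)⁻¹ fun k => rfl]
  exact Matrix.nonsing_inv_mul _ (Ne.isUnit (h p))

theorem normalize_mem (Φ : X.frames e) (p : V) (k : Fin (e p)) :
    β.normalize Φ.1 p k ∈ (X.spanFrame e Φ).1 p :=
  Submodule.sum_mem _ fun _ _ => Submodule.smul_mem _ _ (Submodule.subset_span ⟨_, rfl⟩)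

theorem spanFrame_mem_chart (Φ : X.frames e) :
    X.spanFrame e Φ ∈ β.chart ↔ ∀ p, (β.minor Φ.1 p).det ≠ 0 := by
  constructor
  · rintro ⟨Φ', h, hΦ'⟩ p
    have h1 : ∀ k, ∃ c : Fin (e p) → ℂ, ∑ j, c j • Φ.1 p j = Φ' p k := fun k =>
      (Submodule.mem_span_range_iff_exists_fun ℂ).1 (hΦ' p k)
    choose c hc using h1
    have h2 := β.minor_sum Φ.1 p (Matrix.of c) (Φ' := Φ') fun k => (hc k).symm
    rw [h p] at h2
    have h3 := congrArg Matrix.det h2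
    rw [Matrix.det_one, Matrix.det_mul] at h3
    intro h0
    rw [h0, mul_zero] at h3
    exact one_ne_zero h3
  · exact fun h => ⟨_, β.isNormal_normalize h, β.normalize_mem Φ⟩

variable [Fintype V]

/-- The equation of the complement of the chart. -/
def disc (Φ : X.Tuples e) : ℂ := ∏ p, (β.minor Φ p).det

theorem disc_ne_zero_iff {Φ : X.Tuples e} : β.disc Φ ≠ 0 ↔ ∀ p, (β.minor Φ p).det ≠ 0 := by
  simp [disc, prod_ne_zero_iff]

end Index

end StringCoords

end QuiverRep

namespace FunSpace

theorem det_mem {E : Type*} {m : Type*} [Fintype m] [DecidableEq m] (A : Subalgebra ℂ (E → ℂ))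
    (f : E → Matrix m m ℂ) (hf : ∀ i j, (fun x => f x i j) ∈ A) : (fun x => (f x).det) ∈ A := by
  have : (fun x => (f x).det) = ∑ τ : Equiv.Perm m,
      ((Equiv.Perm.sign τ : ℤ) : ℂ) • ∏ i, fun x => f x (τ i) i := by
    funext x
    rw [Matrix.det_apply']
    simp
  rw [this]
  exact A.sum_mem fun τ _ => A.smul_mem (A.prod_mem fun i _ => hf _ _) _

theorem adjugate_mem {E : Type*} {m : Type*} [Fintype m] [DecidableEq m] (A : Subalgebra ℂ (E → ℂ))
    (f : E → Matrix m m ℂ) (hf : ∀ i j, (fun x => f x i j) ∈ A) (i j : m) :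
    (fun x => (f x).adjugate i j) ∈ A := by
  simp only [Matrix.adjugate_apply]
  refine det_mem A _ fun k l => ?_
  simp only [Matrix.updateRow_apply]
  split_ifs
  · exact A.algebraMap_mem _
  · exact hf k l

end FunSpace

namespace QuiverRep

open Finset FunSpace

variable {V : Type u} [Quiver.{v} V] {X : QuiverRep.{u, v, w} V}

/-- A linear form on tuples, as a sum over the entries. -/
theorem dual_tuples_apply [Fintype V] [DecidableEq V] {e : V → ℕ} (l : Module.Dual ℂ (X.Tuples e))
    (Φ : X.Tuples e) : l Φ = ∑ p, ∑ k, l (Pi.single p (Pi.single k (Φ p k))) := by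
  conv_lhs => rw [← univ_sum_single Φ]
  rw [map_sum]
  refine sum_congr rfl fun p _ => ?_
  conv_lhs => rw [← univ_sum_single (Φ p)]
  exact map_sum (l.comp (LinearMap.single ℂ _ p)) _ _

namespace StringCoords.Index

variable {K : X.StringCoords} {e : V → ℕ} (β : K.Index e)

theorem minor_mem (p : V) (k l : Fin (e p)) :
    (fun Φ : X.Tuples e => β.minor Φ p k l) ∈ polyFun (X.Tuples e) :=
  dual_mem_polyFun ((K.co (β.en p l) p).comp
    ((LinearMap.proj k).comp (LinearMap.proj (R := ℂ) (φ := fun p => Fin (e p) → X.obj p) p)))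

variable [Fintype V]

theorem disc_mem : (β.disc : X.Tuples e → ℂ) ∈ polyFun (X.Tuples e) := by
  have : (β.disc : X.Tuples e → ℂ) = ∏ p, fun Φ => (β.minor Φ p).det := by
    funext Φ
    simp [disc]
  rw [this]
  exact (polyFun _).prod_mem fun p _ => det_mem _ _ fun i j => β.minor_mem p i j

theorem normalize_rat : IsRatMap (β.disc) (β.normalize : X.Tuples e → X.Tuples e) := by
  classical
  intro l
  have h : (fun Φ => l (β.normalize Φ)) = ∑ p, ∑ k, ∑ j,
      (fun Φ : X.Tuples e => ((β.minor Φ p).det)⁻¹) * (fun Φ => (β.minor Φ p).adjugate k j) *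
        fun Φ => l (Pi.single p (Pi.single k (Φ p j))) := by
    funext Φ
    rw [dual_tuples_apply]
    simp only [Finset.sum_apply, Pi.mul_apply]
    refine sum_congr rfl fun p _ => sum_congr rfl fun k _ => ?_
    have : ∀ x : X.obj p, l (Pi.single p (Pi.single k x)) = (l.comp ((LinearMap.single ℂ _ p).comp
      (LinearMap.single ℂ _ k))) x := fun x => rfl
    simp only [this, normalize, map_sum, map_smul, Matrix.inv_def, Ring.inverse_eq_inv',
      Matrix.smul_apply, smul_eq_mul]
  rw [h]
  refine Subalgebra.sum_mem _ fun p _ => Subalgebra.sum_mem _ fun k _ =>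
    Subalgebra.sum_mem _ fun j _ => Subalgebra.mul_mem _ (Subalgebra.mul_mem _ ?_ ?_) ?_
  · refine ⟨1, (polyFun _).one_mem, _, det_mem _ _ fun i j => β.minor_mem p i j, fun Φ hΦ =>
      ⟨β.disc_ne_zero_iff.1 hΦ p, (one_div _).symm⟩⟩
  · exact mem_ratFun_of_mem_polyFun (adjugate_mem _ _ (fun i j => β.minor_mem p i j) k j)
  · exact mem_ratFun_of_mem_polyFun (dual_mem_polyFun (l.comp ((LinearMap.single ℂ _ p).comp
      ((LinearMap.single ℂ _ k).comp ((LinearMap.proj j).comp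
        (LinearMap.proj (R := ℂ) (φ := fun p => Fin (e p) → X.obj p) p))))))

theorem isOpen_chart : IsOpen[(X.prodGrVar e).zariski] β.chart :=
  Slice.isOpen_quot (isOpen_ne_zero β.disc_mem) fun Φ =>
    (β.spanFrame_mem_chart Φ).trans β.disc_ne_zero_iff.symm

end StringCoords.Index

end QuiverRep

/-! ### The cells of a quiver Grassmannian -/

namespace QuiverRep

open Finset FunSpace StringCell

variable {V : Type u} [Quiver.{v} V] {X : QuiverRep.{u, v, w} V}

namespace StringCoords

variable {K : X.StringCoords} {e : V → ℕ}

/-- The number of pivots over a vertex is the dimension. -/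
theorem card_fiber_pivots {U : ∀ p, Submodule ℂ (X.obj p)} {s : Finset ℕ}
    (hs : ∀ i, i ∈ s ↔ K.IsPivot U i) (p : V) : #(K.fiber s p) = Module.finrank ℂ (U p) := by
  have h : ∀ b : K.fiber s p, ∃ u ∈ U p, K.co b p u = 1 ∧
      (∀ c, K.IsPivot U c → c ≠ b → K.co c p u = 0) ∧ ∀ c < (b : ℕ), K.co c p u = 0 := fun b =>
    ((hs b).1 (mem_fiber.1 b.2).1).exists_reduced (mem_fiber.1 b.2).2
  choose f hfU hf1 hf0 hf using h
  have hsum : ∀ (c : K.fiber s p → ℂ) (l : K.fiber s p), K.co l p (∑ k, c k • f k) = c l := by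
    intro c l
    rw [map_sum, sum_eq_single l]
    · rw [map_smul, hf1, smul_eq_mul, mul_one]
    · intro k _ hk
      rw [map_smul, hf0 k l ((hs l).1 (mem_fiber.1 l.2).1) fun h => hk (Subtype.ext h.symm),
        smul_zero]
    · exact fun h => absurd (mem_univ _) h
  have hli : LinearIndependent ℂ f := by
    rw [Fintype.linearIndependent_iff]
    intro c hc l
    rw [← hsum c l, hc, map_zero]
  have hspan : Submodule.span ℂ (Set.range f) = U p := by
    refine le_antisymm (Submodule.span_le.2 (Set.range_subset_iff.2 hfU)) fun u hu => ?_
    let u' := ∑ k : K.fiber s p, K.co k p u • f k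
    have hu'U : u' ∈ U p := Submodule.sum_mem _ fun k _ => Submodule.smul_mem _ _ (hfU k)
    have : u = u' := by
      rw [← sub_eq_zero]
      refine K.ext_co fun j hj hjp => ?_
      rw [map_zero]
      by_contra hne
      obtain ⟨i, -, hi, hi0⟩ := exists_isPivot (Submodule.sub_mem _ hu hu'U) hne
      refine hi0 ?_
      have hip := (of_co_ne_zero hi0).2
      rw [map_sub, hsum (fun k => K.co k p u) ⟨i, mem_fiber.2 ⟨(hs i).2 hi, hip⟩⟩, sub_self]
    rw [this]
    exact Submodule.sum_mem _ fun k _ =>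
      Submodule.smul_mem _ _ (Submodule.subset_span ⟨k, rfl⟩)
  rw [← hspan, finrank_span_eq_card hli, Fintype.card_coe]

open Classical in
/-- The label of the cell of a subrepresentation is its set of pivots. -/
def pivots (K : X.StringCoords) (U : X.quiverGr e) : K.Index e where
  set := {i ∈ Icc 1 K.M | K.IsPivot U.1.1 i}
  mem_Icc b hb := Finset.mem_Icc.1 (mem_filter.1 hb).1
  closed := closed_of_isSubrep U.2 fun i => by
    rw [mem_filter]
    exact and_iff_right_of_imp fun h => h.mem_Icc
  card p := by
    rw [card_fiber_pivots (U := U.1.1), U.1.2]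
    intro i
    rw [mem_filter]
    exact and_iff_right_of_imp fun h => h.mem_Icc

theorem mem_pivots {U : X.quiverGr e} {i : ℕ} : i ∈ (K.pivots U).set ↔ K.IsPivot U.1.1 i := by
  classical
  simp only [pivots, mem_filter]
  exact and_iff_right_of_imp fun h => h.mem_Icc

namespace Index

theorem sum_succ {M : ℕ} {s : Finset ℕ} (hs : ∀ b ∈ s, 1 ≤ b ∧ b ≤ M) (f : ℕ → ℂ) :
    ∑ m ∈ s, f m = ∑ m ∈ range M, if m + 1 ∈ s then f (m + 1) else 0 := by
  rw [← sum_filter]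
  refine sum_bij' (fun m _ => m - 1) (fun m _ => m + 1) ?_ ?_ ?_ ?_ ?_
  · intro m hm
    have := hs m hm
    rw [mem_filter, mem_range, Nat.sub_add_cancel this.1]
    exact ⟨by omega, hm⟩
  · exact fun m hm => (mem_filter.1 hm).2
  · exact fun m hm => Nat.sub_add_cancel (hs m hm).1
  · exact fun m hm => Nat.add_sub_cancel _ _
  · exact fun m hm => by rw [Nat.sub_add_cancel (hs m hm).1]

theorem sum_range_succ_ite {M : ℕ} {s : Finset ℕ} (hs : ∀ b ∈ s, 1 ≤ b ∧ b ≤ M) (f : ℕ → ℂ) :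
    ∑ m ∈ s, f m = ∑ m ∈ range (M + 1), if m ∈ s then f m else 0 := by
  rw [sum_ite_mem]
  congr 1
  refine (inter_eq_right.2 fun m hm => ?_).symm
  rw [mem_range]
  have := hs m hm
  omega

variable (β : K.Index e)

/-- The frame with given coefficients. -/
def rowFrame (x : ℕ × ℕ → ℂ) : X.Tuples e := fun p k => K.vec p (full x (β.en p k))

/-- The coefficients vanish outside of the admissible positions, the elements of `coeffs`. -/
def Supported (x : ℕ × ℕ → ℂ) : Prop :=
  ∀ b c, x (b, c) ≠ 0 → b ∈ β.set ∧ c ∉ β.set ∧ b < c ∧ c ≤ K.M ∧ (c : ZMod K.n) = b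

variable {β} {x : ℕ × ℕ → ℂ}

theorem Supported.co_row (hx : β.Supported x) {b : ℕ} (hb : b ∈ β.set) {p : V} (hp : K.q b = p)
    (c : ℕ) : K.co c p (K.vec p (full x b)) = full x b c := by
  have hbM := β.mem_Icc b hb
  by_cases hc : c ∈ Icc 1 K.M ∧ K.q c = p
  · exact K.co_vec _ hc.1 hc.2
  · rw [K.co_eq_zero hc, full, if_neg]
    · by_contra h
      obtain ⟨-, -, h1, h2, h3⟩ := hx b c (Ne.symm h)
      exact hc ⟨Finset.mem_Icc.2 ⟨by omega, h2⟩, by rw [h3, hp]⟩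
    · rintro rfl
      exact hc ⟨Finset.mem_Icc.2 hbM, hp⟩

theorem Supported.full_eq (hx : β.Supported x) {b c : ℕ} (hc : c ∈ β.set) :
    full x b c = if b = c then 1 else 0 := by
  rw [full]
  split_ifs with h
  · rfl
  · by_contra h'
    exact (hx b c h').2.1 hc

theorem Supported.full_eq_zero (hx : β.Supported x) {b c : ℕ} (hc : c < b) : full x b c = 0 := by
  rw [full, if_neg hc.ne']
  by_contra h'
  exact absurd (hx b c h').2.2.1 (by omega)

theorem Supported.isNormal (hx : β.Supported x) : β.IsNormal (β.rowFrame x) := by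
  intro p
  ext k l
  rw [Matrix.one_apply]
  change K.co (β.en p l) p (K.vec p (full x (β.en p k))) = _
  rw [hx.co_row (β.en_mem k) (β.q_en k), hx.full_eq (β.en_mem l)]
  simp only [β.en_inj]

/-- The point of the product of Grassmannians with given coefficients. -/
def Supported.pt (hx : β.Supported x) : X.ProdGr e := X.spanFrame e ⟨_, hx.isNormal.mem_frames⟩

theorem Supported.row_mem_pt (hx : β.Supported x) (p : V) (k : Fin (e p)) :
    β.rowFrame x p k ∈ hx.pt.1 p := Submodule.subset_span ⟨k, rfl⟩

theorem Supported.mem_pt_iff (hx : β.Supported x) {p : V} {u : X.obj p} :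
    u ∈ hx.pt.1 p ↔ ∀ c ∈ Icc 1 K.M, K.q c = p → c ∉ β.set →
      K.co c p u = ∑ b ∈ β.set, K.co b p u * full x b c := by
  have h1 : ∀ c, K.co c p (∑ k, K.co (β.en p k) p u • β.rowFrame x p k) =
      ∑ b ∈ β.set, K.co b p u * full x b c := by
    intro c
    rw [← β.sum_en p fun b => K.co b p u * full x b c, map_sum]
    · refine sum_congr rfl fun k _ => ?_
      rw [map_smul, rowFrame, hx.co_row (β.en_mem k) (β.q_en k), smul_eq_mul]
    · intro b _ hb
      rw [K.co_eq_zero (fun h => hb h.2), zero_mul]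
  rw [hx.isNormal.mem_iff hx.row_mem_pt]
  constructor
  · intro h c _ _ _
    rw [← h1, h]
  · intro h
    refine K.ext_co fun c hc hcp => ?_
    rw [h1]
    by_cases hcβ : c ∈ β.set
    · rw [sum_eq_single c]
      · rw [full, if_pos rfl, mul_one]
      · intro b _ hb
        rw [hx.full_eq hcβ, if_neg hb, mul_zero]
      · exact fun h => absurd hcβ h
    · exact (h c hc hcp hcβ).symm

/-- The conditions on the coefficients express that the point is a subrepresentation. -/
theorem Supported.isSubrep_iff (hx : β.Supported x) :
    X.IsSubrep hx.pt.1 ↔ IsSol K.M K.φ K.lam β.set x := by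
  constructor
  · intro h
    refine ⟨hx, ?_, ?_⟩
    · intro b hb hφ j hj hjβ hjb
      obtain ⟨a, ha⟩ := K.exists_arrow b hφ
      obtain ⟨k, hk⟩ := β.exists_en hb rfl
      have h1 := h a _ (hx.row_mem_pt _ k)
      rw [rowFrame, hk] at h1
      have h2 : ∀ {j}, j + 1 ≤ K.M → K.co (j + 1) _ (X.map a (K.vec _ (full x b))) =
          K.lam j * full x b j := fun hj => by
        rw [co_map_fwd (w := X.map a _) rfl (fun i hi hiM => ha i hi hiM _) hj, hx.co_row hb rfl]
      have h3 := hx.mem_pt_iff.1 h1 (j + 1) (Finset.mem_Icc.2 ⟨by omega, hj⟩)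
        (by rw [Nat.cast_succ, hjb]) hjβ
      rw [h2 hj, sum_succ β.mem_Icc] at h3
      rw [h3]
      refine sum_congr rfl fun m hm => ?_
      rw [h2 (mem_range.1 hm)]
    · intro i hi hφ j hj1 hj hjβ hji
      obtain ⟨a, ha⟩ := K.exists_arrow' i hφ
      obtain ⟨k, hk⟩ := β.exists_en (p := K.q (i + 1)) hi (by rw [Nat.cast_succ])
      have h1 := h a _ (hx.row_mem_pt _ k)
      rw [rowFrame, hk] at h1
      have h2 : ∀ {j}, 1 ≤ j → j ≤ K.M → K.co j _ (X.map a (K.vec _ (full x (i + 1)))) =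
          K.lam j * full x (i + 1) (j + 1) := fun hj1 hj => by
        rw [co_map_bwd (w := X.map a _) rfl (fun i hi h1 hiM => ha i hi h1 hiM _) hj1 hj,
          hx.co_row hi (by rw [Nat.cast_succ])]
      have h3 := hx.mem_pt_iff.1 h1 j (Finset.mem_Icc.2 ⟨by omega, hj⟩) (by rw [hji]) hjβ
      rw [h2 hj1 hj, sum_range_succ_ite β.mem_Icc] at h3
      rw [h3]
      refine sum_congr rfl fun m hm => ?_
      split_ifs with hmβ
      · rw [h2 (β.mem_Icc m hmβ).1 (β.mem_Icc m hmβ).2]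
      · rfl
  · intro h p p' a
    suffices hs : ∀ k, X.map a (β.rowFrame x p k) ∈ hx.pt.1 p' by
      change hx.pt.1 p ≤ (hx.pt.1 p').comap (X.map a)
      exact Submodule.span_le.2 (Set.range_subset_iff.2 hs)
    intro k
    rw [rowFrame, hx.mem_pt_iff]
    intro c hc hcp hcβ
    have hcM := Finset.mem_Icc.1 hc
    have hb := β.en_mem k
    have hbp := β.q_en k
    generalize (β.en p k : ℕ) = b at *
    obtain ⟨r, ⟨hφ, rfl, rfl, ha⟩ | ⟨hφ, rfl, rfl, ha⟩⟩ := K.arrow a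
    · obtain rfl := K.q_injective hbp
      have h2 : ∀ {j}, j + 1 ≤ K.M → K.co (j + 1) _ (X.map a (K.vec _ (full x b))) =
          K.lam j * full x b j := fun hj => by
        rw [co_map_fwd (w := X.map a _) rfl (fun i hi hiM => ha i hi hiM _) hj, hx.co_row hb rfl]
      obtain ⟨j, rfl⟩ := Nat.exists_eq_succ_of_ne_zero (by omega : c ≠ 0)
      have hjb := K.q_injective hcp
      rw [Nat.cast_succ] at hjb
      rw [h2 hcM.2, h.fwd b hb hφ j hcM.2 hcβ (add_right_cancel hjb), sum_succ β.mem_Icc]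
      refine sum_congr rfl fun m hm => ?_
      rw [h2 (mem_range.1 hm)]
    · obtain ⟨i, rfl⟩ := Nat.exists_eq_succ_of_ne_zero (by have := β.mem_Icc b hb; omega : b ≠ 0)
      have hir := K.q_injective hbp
      rw [Nat.cast_succ] at hir
      obtain rfl := add_right_cancel hir
      have h2 : ∀ {j}, 1 ≤ j → j ≤ K.M → K.co j _ (X.map a (K.vec _ (full x (i + 1)))) =
          K.lam j * full x (i + 1) (j + 1) := fun hj1 hj => by
        rw [co_map_bwd (w := X.map a _) rfl (fun i hi h1 hiM => ha i hi h1 hiM _) hj1 hj,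
          hx.co_row hb hbp]
      rw [h2 hcM.1 hcM.2, h.bwd i hb hφ c hcM.1 hcM.2 hcβ (K.q_injective hcp),
        sum_range_succ_ite β.mem_Icc]
      refine sum_congr rfl fun m hm => ?_
      split_ifs with hmβ
      · rw [h2 (β.mem_Icc m hmβ).1 (β.mem_Icc m hmβ).2]
      · rfl

theorem Supported.isPivot_iff (hx : β.Supported x) {i : ℕ} :
    K.IsPivot hx.pt.1 i ↔ i ∈ β.set := by
  constructor
  · rintro ⟨p, u, hu, h1, h2⟩
    by_contra hi
    obtain ⟨hiM, hip⟩ := of_co_ne_zero h1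
    refine h1 ((hx.mem_pt_iff.1 hu i hiM hip hi).trans (sum_eq_zero fun b hb => ?_))
    rcases lt_trichotomy b i with h | rfl | h
    · rw [h2 b h, zero_mul]
    · exact absurd hb hi
    · rw [hx.full_eq_zero h, mul_zero]
  · intro hi
    obtain ⟨k, hk⟩ := β.exists_en hi rfl
    have h := hx.row_mem_pt _ k
    rw [rowFrame, hk] at h
    refine ⟨_, _, h, ?_, fun j hj => ?_⟩
    · rw [hx.co_row hi rfl, full, if_pos rfl]
      exact one_ne_zero
    · rw [hx.co_row hi rfl, hx.full_eq_zero hj]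

variable (β)

/-- The cell of the subrepresentations with given pivots. -/
def cell : Set (X.quiverGr e) := {U | K.pivots U = β}

variable {β}

theorem mem_cell {U : X.quiverGr e} : U ∈ β.cell ↔ ∀ i, K.IsPivot U.1.1 i ↔ i ∈ β.set := by
  simp only [cell, Set.mem_ofPred_eq, Index.ext_iff, Finset.ext_iff, mem_pivots]

end Index
end StringCoords
end QuiverRep

/-! ### The cell decomposition -/

namespace QuiverRep

open Finset FunSpace StringCell

variable {V : Type u} [Quiver.{v} V] {X : QuiverRep.{u, v, w} V}

namespace StringCoords

variable {K : X.StringCoords} {e : V → ℕ}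

namespace Index

variable (β : K.Index e)

/-- The coefficient at `(b, c)` of a frame, i.e. the coordinate with index `c` of the vector
belonging to `b`. -/
def coeff (s : ℕ × ℕ) : X.Tuples e →ₗ[ℂ] ℂ :=
  open Classical in
  if h : s.1 ∈ β.set then (K.co s.2 (K.q s.1)).comp
    ((LinearMap.proj ((β.en (K.q s.1)).symm ⟨s.1, mem_fiber.2 ⟨h, rfl⟩⟩)).comp
      (LinearMap.proj (R := ℂ) (φ := fun p => Fin (e p) → X.obj p) (K.q s.1)))
  else 0

theorem coeff_apply (Φ : X.Tuples e) {b : ℕ} (c : ℕ) {p : V} {k : Fin (e p)}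
    (hk : (β.en p k : ℕ) = b) : β.coeff (b, c) Φ = K.co c p (Φ p k) := by
  have hb : b ∈ β.set := hk ▸ β.en_mem k
  have hp : K.q b = p := hk ▸ β.q_en k
  subst hp
  have h1 : (β.en (K.q b)).symm ⟨b, mem_fiber.2 ⟨hb, rfl⟩⟩ = k := by
    rw [Equiv.symm_apply_eq]
    exact Subtype.ext hk.symm
  rw [coeff, dif_pos hb, ← h1]
  rfl

open Classical in
/-- The coefficients at the admissible positions. -/
def coeffFun (Φ : X.Tuples e) (s : ℕ × ℕ) : ℂ :=
  if s ∈ coeffs K.n K.M β.set then β.coeff s Φ else 0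

theorem supported_coeffFun (Φ : X.Tuples e) : β.Supported (β.coeffFun Φ) := by
  classical
  intro b c h
  rw [coeffFun] at h
  split_ifs at h with h1
  · exact mem_coeffs.1 h1
  · exact absurd rfl h

variable {β}

/-- The points in a cell have a normal frame that is given by coefficients. -/
theorem exists_supported {U : X.quiverGr e} (hU : U ∈ β.cell) :
    ∃ (x : ℕ × ℕ → ℂ) (hx : β.Supported x), hx.pt = U.1 ∧ x = β.coeffFun (β.norm U.1) ∧
      β.norm U.1 = β.rowFrame x := by
  classical
  rw [mem_cell] at hU
  have h : ∀ p k, ∃ u ∈ U.1.1 p, K.co (β.en p k) p u = 1 ∧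
      (∀ c, K.IsPivot U.1.1 c → c ≠ β.en p k → K.co c p u = 0) ∧
        ∀ c < (β.en p k : ℕ), K.co c p u = 0 := fun p k =>
    ((hU _).2 (β.en_mem k)).exists_reduced (β.q_en k)
  choose Φ hΦU h1 h0 hlt using h
  have hΦ : β.IsNormal Φ := by
    intro p
    ext k l
    rw [Matrix.one_apply]
    change K.co (β.en p l) p (Φ p k) = _
    split_ifs with hkl
    · rw [← hkl, h1]
    · exact h0 p k _ ((hU _).2 (β.en_mem l)) fun h => hkl (β.en_inj.1 h).symm
  have hnorm : β.norm U.1 = Φ := norm_eq hΦ hΦU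
  have hx := β.supported_coeffFun Φ
  have hrow : Φ = β.rowFrame (β.coeffFun Φ) := by
    funext p k
    refine K.ext_co fun c hc hcp => ?_
    rw [rowFrame, hx.co_row (β.en_mem k) (β.q_en k)]
    by_cases hcβ : c ∈ β.set
    · rw [hx.full_eq hcβ]
      split_ifs with hkc
      · rw [← hkc, h1]
      · exact h0 p k c ((hU c).2 hcβ) fun h => hkc h.symm
    · have hkc : (β.en p k : ℕ) ≠ c := fun h => hcβ (h ▸ β.en_mem k)
      rcases lt_or_gt_of_ne hkc with h | h
      · rw [full, if_neg hkc, coeffFun, if_pos, β.coeff_apply Φ c rfl]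
        exact mem_coeffs.2 ⟨β.en_mem k, hcβ, h, (Finset.mem_Icc.1 hc).2,
          K.q_injective (hcp.trans (β.q_en k).symm)⟩
      · rw [hlt p k c h, hx.full_eq_zero h]
  refine ⟨β.coeffFun Φ, hx, ?_, by rw [hnorm], by rw [hnorm]; exact hrow⟩
  refine hx.isNormal.spanFrame_eq ?_
  rw [← hrow]
  exact hΦU

theorem cell_subset_chart {U : X.quiverGr e} (hU : U ∈ β.cell) : U.1 ∈ β.chart := by
  obtain ⟨x, hx, h, -⟩ := exists_supported hU
  exact ⟨_, hx.isNormal, h ▸ hx.row_mem_pt⟩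

variable (P : Param K.M K.φ K.lam β.set)

open Classical in
/-- The free coefficients, extended by zero. -/
def extend (t : Fin (#P.free) → ℂ) (s : ℕ × ℕ) : ℂ :=
  if h : s ∈ P.free then t (P.free.equivFin ⟨s, h⟩) else 0

theorem extend_apply (t : Fin (#P.free) → ℂ) (i : Fin (#P.free)) :
    extend P t (P.free.equivFin.symm i) = t i := by
  rw [extend, dif_pos (P.free.equivFin.symm i).2, Subtype.coe_eta, Equiv.apply_symm_apply]

variable (β) in
theorem isPolyMap_rowFrame [Fintype V] {T : Type} [AddCommGroup T] [Module ℂ T]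
    {x : T → ℕ × ℕ → ℂ} (h : ∀ s, (fun t => x t s) ∈ polyFun T) :
    IsPolyMap fun t => β.rowFrame (x t) := by
  classical
  intro l
  have : (fun t => l (β.rowFrame (x t))) = ∑ p, ∑ k, ∑ i ∈ Icc 1 K.M,
      (fun t => full (x t) (β.en p k) i) *
        fun _ => l (Pi.single p (Pi.single k (K.bv i p))) := by
    funext t
    rw [dual_tuples_apply]
    simp only [Finset.sum_apply, Pi.mul_apply]
    refine sum_congr rfl fun p _ => sum_congr rfl fun k _ => ?_
    have h : ∀ y : X.obj p, l (Pi.single p (Pi.single k y)) = (l.comp ((LinearMap.single ℂ _ p).comp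
      (LinearMap.single ℂ _ k))) y := fun x => rfl
    simp only [h, rowFrame, vec, map_sum, map_smul, smul_eq_mul]
  rw [this]
  refine Subalgebra.sum_mem _ fun p _ => Subalgebra.sum_mem _ fun k _ =>
    Subalgebra.sum_mem _ fun i _ => Subalgebra.mul_mem _ ?_ (const_mem_polyFun _)
  unfold full
  split_ifs
  · exact const_mem_polyFun 1
  · exact h _

theorem supported_sol (t : ℕ × ℕ → ℂ) : β.Supported (P.sol t) := (P.isSol t).supp

/-- The parametrization of a cell by the free coefficients of the normal frames. -/
def slice [Fintype V] : Slice (X.spanFrame e) β.cell (#P.free) where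
  D := β.disc
  D_mem := β.disc_mem
  Ψ := β.normalize
  Ψ_rat := β.normalize_rat
  O := β.chart
  mem_O Φ := (β.spanFrame_mem_chart Φ).trans β.disc_ne_zero_iff.symm
  norm := β.norm
  norm_eq Φ h := norm_eq (β.isNormal_normalize (β.disc_ne_zero_iff.1 h)) (β.normalize_mem Φ)
  subset_O _ hU := cell_subset_chart hU
  γ t := β.rowFrame (P.sol (extend P t))
  γ_poly := β.isPolyMap_rowFrame fun s => P.sol_mem _ _ (fun s hs => by
    simp only [extend, dif_pos hs]
    exact dual_mem_polyFun (LinearMap.proj (R := ℂ) (φ := fun _ => ℂ) _)) s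
  γ_mem t := (supported_sol P _).isNormal.mem_frames
  γ_mem_Y t := (supported_sol P _).isSubrep_iff.2 (P.isSol _)
  γ_mem_C t := mem_cell.2 fun _ => (supported_sol P _).isPivot_iff
  ρ := LinearMap.pi fun i => β.coeff (P.free.equivFin.symm i)
  left_inv U hU := by
    obtain ⟨x, hx, h1, h2, h3⟩ := exists_supported hU
    have hsol : P.sol (extend P fun i => β.coeff (P.free.equivFin.symm i) (β.norm U.1)) = x := by
      refine P.sol_unique x _ (hx.isSubrep_iff.1 ?_) fun s hs => ?_
      · rw [h1]
        exact U.2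
      · rw [extend, dif_pos hs, Equiv.symm_apply_apply, h2, coeffFun, if_pos (P.free_subset hs)]
    refine Eq.trans ?_ h1
    refine congrArg (X.spanFrame e) (Subtype.ext ?_)
    exact congrArg β.rowFrame hsol
  right_inv t := by
    have hx := supported_sol P (extend P t)
    have h1 : β.norm hx.pt = β.rowFrame (P.sol (extend P t)) := norm_eq hx.isNormal hx.row_mem_pt
    funext i
    refine (congrArg (β.coeff (P.free.equivFin.symm i)) h1).trans ?_
    have hi := (P.free.equivFin.symm i).2
    obtain ⟨hb, hc, hbc, -⟩ := mem_coeffs.1 (P.free_subset hi)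
    obtain ⟨k, hk⟩ := β.exists_en hb rfl
    rw [← Prod.mk.eta (p := (P.free.equivFin.symm i).1), β.coeff_apply _ _ hk, rowFrame,
      hx.co_row (β.en_mem k) (β.q_en k), hk, full, if_neg hbc.ne, Prod.mk.eta,
      P.sol_of_mem _ _ hi, extend_apply]

/-! ### The order of the cells -/

/-- The binary number with the digits of the characteristic function of the label.  Labels are thus
ordered lexicographically, and smaller elements count more. -/
def rank (β : K.Index e) : ℕ := ∑ i ∈ β.set, 2 ^ (K.M - i)

theorem rank_lt {β β' : K.Index e} {i : ℕ} (hi : i ∈ β'.set) (hi' : i ∉ β.set)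
    (h : ∀ j < i, j ∈ β.set → j ∈ β'.set) : β.rank < β'.rank := by
  have h1 : β.rank = ∑ j ∈ β.set with j < i, 2 ^ (K.M - j) +
      ∑ j ∈ β.set with ¬ j < i, 2 ^ (K.M - j) := (sum_filter_add_sum_filter_not _ _ _).symm
  have h2 : ∑ j ∈ β.set with ¬ j < i, 2 ^ (K.M - j) < 2 ^ (K.M - i) := by
    have hinj : Set.InjOn (fun j => K.M - j) (({j ∈ β.set | ¬ j < i} : Finset ℕ) : Set ℕ) := by
      intro j hj l hl hjl
      have h3 := (β.mem_Icc j (mem_filter.1 hj).1).2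
      have h4 := (β.mem_Icc l (mem_filter.1 hl).1).2
      dsimp only at hjl
      omega
    rw [← sum_image (f := fun k => 2 ^ k) hinj]
    refine Nat.geomSum_lt le_rfl fun k hk => ?_
    obtain ⟨j, hj, rfl⟩ := mem_image.1 hk
    have h3 := β.mem_Icc j (mem_filter.1 hj).1
    have h4 : j ≠ i := fun h => hi' (h ▸ (mem_filter.1 hj).1)
    have h5 := (mem_filter.1 hj).2
    omega
  have h3 : ∑ j ∈ β.set with j < i, 2 ^ (K.M - j) + 2 ^ (K.M - i) ≤ β'.rank := by
    rw [add_comm, ← sum_insert (f := fun j => 2 ^ (K.M - j)) (by simp)]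
    refine sum_le_sum_of_subset fun j hj => ?_
    rcases mem_insert.1 hj with rfl | hj
    · exact hi
    · exact h j (mem_filter.1 hj).2 (mem_filter.1 hj).1
  omega

theorem exists_min_ne {β β' : K.Index e} (h : β ≠ β') :
    ∃ i, (∀ j < i, j ∈ β.set ↔ j ∈ β'.set) ∧ ¬ (i ∈ β.set ↔ i ∈ β'.set) := by
  classical
  have h1 : ∃ i, ¬ (i ∈ β.set ↔ i ∈ β'.set) := by
    by_contra! h2
    exact h (Index.ext (Finset.ext h2))
  exact ⟨Nat.find h1, fun j hj => not_not.1 (Nat.find_min h1 hj), Nat.find_spec h1⟩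

theorem rank_injective : Function.Injective (rank : K.Index e → ℕ) := by
  intro β β' hr
  by_contra hne
  obtain ⟨i, h, hi⟩ := exists_min_ne hne
  by_cases hiβ : i ∈ β.set
  · exact (rank_lt hiβ (fun h' => hi (iff_of_true hiβ h')) fun j hj => (h j hj).2).ne' hr
  · have : i ∈ β'.set := by
      by_contra h'
      exact hi (iff_of_false hiβ h')
    exact (rank_lt this hiβ fun j hj => (h j hj).1).ne hr

/-- A chart meets only cells of larger or equal rank: a point of the chart contains vectors that
have, among the coordinates in the label of the chart, a single nonzero one, and their pivots do not
come after it. -/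
theorem rank_le_of_mem_chart {U : X.quiverGr e} (hU : U.1 ∈ β.chart) :
    β.rank ≤ (K.pivots U).rank := by
  by_contra! hlt
  obtain ⟨i, h, hi⟩ := exists_min_ne (β := β) (β' := K.pivots U) fun h => hlt.ne' (by rw [← h])
  by_cases hiβ : i ∈ β.set
  · obtain ⟨Φ, hΦ, hΦU⟩ := hU
    obtain ⟨k, hk⟩ := β.exists_en hiβ rfl
    have h1 : K.co i _ (Φ _ k) = 1 := by
      have := hΦ.co_en _ k k
      rwa [hk, if_pos rfl] at this
    obtain ⟨j, hji, hj, hj0⟩ := exists_isPivot (hΦU _ k) (h1 ▸ one_ne_zero)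
    have hne : j ≠ i := by
      rintro rfl
      exact hi (iff_of_true hiβ (mem_pivots.2 hj))
    obtain ⟨l, hl⟩ := β.exists_en ((h j (by omega)).2 (mem_pivots.2 hj)) (of_co_ne_zero hj0).2
    refine hj0 ?_
    rw [← hl, hΦ.co_en, if_neg]
    rintro rfl
    exact hne (hl.symm.trans hk)
  · have : i ∈ (K.pivots U).set := by
      by_contra h'
      exact hi (iff_of_false hiβ h')
    exact (rank_lt this hiβ fun j hj => (h j hj).1).not_gt hlt

instance : Finite (K.Index e) := by
  refine Finite.of_injective (β := (Icc 1 K.M).powerset)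
    (fun β => ⟨β.set, mem_powerset.2 fun b hb => Finset.mem_Icc.2 (β.mem_Icc b hb)⟩) ?_
  intro β β' h
  exact Index.ext (congrArg Subtype.val h)

/-- The complement of the cells of rank at most `k` is a union of charts, by `rank_le_of_mem_chart`.
-/
theorem isClosed_iUnion_cell [Fintype V] (k : ℕ) :
    IsClosed[(X.quiverGrVar e).zariski] (⋃ β : K.Index e, ⋃ (_ : β.rank ≤ k), β.cell) := by
  have h : (⋃ β : K.Index e, ⋃ (_ : β.rank ≤ k), β.cell)ᶜ =
      Subtype.val ⁻¹' ⋃ β : K.Index e, ⋃ (_ : k < β.rank), β.chart := by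
    ext U
    simp only [Set.mem_compl_iff, Set.mem_iUnion, Set.mem_preimage, cell, Set.mem_ofPred_eq,
      not_exists, exists_prop, not_and]
    constructor
    · intro h
      exact ⟨K.pivots U, not_le.1 fun h' => h _ h' rfl, cell_subset_chart rfl⟩
    · rintro ⟨β, hβ, hU⟩ β' hβ' rfl
      exact absurd (rank_le_of_mem_chart hU) (by omega)
  rw [← @isOpen_compl_iff _ _ (X.quiverGrVar e).zariski, h]
  refine ⟨_, ?_, rfl⟩
  exact @isOpen_iUnion _ _ (X.prodGrVar e).zariski _ fun β =>
    @isOpen_iUnion _ _ (X.prodGrVar e).zariski _ fun _ => β.isOpen_chart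

theorem disjoint_cell : Pairwise fun β β' : K.Index e => Disjoint β.cell β'.cell := by
  intro β β' h
  rw [Set.disjoint_left]
  exact fun U hU hU' => h (Eq.trans hU.symm hU')

theorem iUnion_cell : ⋃ β : K.Index e, β.cell = Set.univ :=
  Set.eq_univ_of_forall fun U => Set.mem_iUnion.2 ⟨K.pivots U, rfl⟩

theorem nonempty_param (hK : K.φ K.M ∨ K.φ 0) : Nonempty (Param K.M K.φ K.lam β.set) := by
  rcases hK with h | h
  · exact nonempty_param_of_right K.lam_ne_zero β.mem_Icc β.closed h
  · exact nonempty_param_of_left K.lam_ne_zero β.mem_Icc β.closed h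

theorem isSol_zero : IsSol K.M K.φ K.lam β.set 0 := by
  rw [isSol_iff β.mem_Icc β.closed]
  refine ⟨fun b c h => absurd rfl h, fun i j _ => ?_⟩
  simp [rest]

end Index

open Index

theorem isCellDecomposition [Fintype V] (hK : K.φ K.M ∨ K.φ 0) :
    (X.quiverGrVar e).IsCellDecomposition fun β : K.Index e => β.cell where
  finite := inferInstance
  disjoint := disjoint_cell
  cover := iUnion_cell
  filtration := ⟨rank, rank_injective, isClosed_iUnion_cell⟩
  isAffineSpace β := by
    obtain ⟨P⟩ := nonempty_param (β := β) hK
    exact ⟨_, ⟨(slice P).iso⟩⟩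

theorem nonempty_homeomorph_cell [Fintype V] (hK : K.φ K.M ∨ K.φ 0) (β : K.Index e) :
    ∃ d : ℕ, Nonempty (β.cell ≃ₜ (Fin (2 * d) → ℝ)) := by
  obtain ⟨P⟩ := Index.nonempty_param (β := β) hK
  let : TopologicalSpace (X.Tuples e) := moduleTopology ℂ _
  have : IsModuleTopology ℂ (X.Tuples e) := ⟨rfl⟩
  have := K.finite_obj
  have hγ : Continuous (slice P).γ := by
    let bas := fun p => Module.finBasis ℂ (X.obj p)
    have h1 : Continuous fun t => coords e bas ((slice P).γ t) := by
      refine continuous_pi fun p => continuous_pi fun k => continuous_pi fun i => ?_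
      exact continuous_of_mem_polyFun ((slice P).γ_poly ((LinearMap.proj i).comp
        ((LinearMap.proj k).comp ((LinearMap.proj (R := ℂ)
          (φ := fun p => Fin (e p) → Fin (Module.finrank ℂ (X.obj p)) → ℂ) p).comp
            (coords e bas).toLinearMap))))
    have h2 := (continuous_coords_symm bas).comp h1
    simpa [Function.comp_def] using h2
  obtain ⟨f⟩ := (slice P).nonempty_homeomorph (fun g hg => continuous_of_mem_polyFun hg) hγ
  have hd : Module.finrank ℝ (Fin (#P.free) → ℂ) = Module.finrank ℝ (Fin (2 * #P.free) → ℝ) := by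
    rw [Module.finrank_pi_fintype]
    simp [Complex.finrank_real_complex, mul_comm]
  exact ⟨#P.free, ⟨f.trans (ContinuousLinearEquiv.ofFinrankEq hd).toHomeomorph⟩⟩

theorem hasEulerChar [Fintype V] (hK : K.φ K.M ∨ K.φ 0) :
    HasEulerChar (X.quiverGr e) (Nat.card (K.Index e)) := by
  have := K.finite_obj
  have := Fintype.ofFinite (K.Index e)
  choose d f using nonempty_homeomorph_cell (e := e) hK
  have h := AlexanderSpanier.hasEulerChar_of_hasHc d
    (AlexanderSpanier.hasHc_of_cells (fun β : K.Index e => β.cell) d disjoint_cell iUnion_cell rank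
      rank_injective (fun k => zariski_isClosed_quiverGr (isClosed_iUnion_cell k))
      fun β => (f β).some)
  rwa [← Nat.card_eq_fintype_card] at h

end StringCoords
end QuiverRep

/-! ### The labelling of a string basis -/

namespace Quiver.Total.Joins

variable {V : Type u} [Quiver.{v} V] {a : Quiver.Total V} {p q r s : V}

theorem symm (h : a.Joins p q) : a.Joins q p := Or.symm h

theorem right_unique (h : a.Joins p q) (h' : a.Joins p r) : q = r := by
  rcases h with ⟨rfl, rfl⟩ | ⟨rfl, rfl⟩ <;> rcases h' with ⟨h1, h2⟩ | ⟨h1, h2⟩ <;> simp_all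

theorem eq_or_eq (h : a.Joins p q) (h' : a.Joins r s) : p = r ∨ p = s := by
  rcases h with ⟨rfl, rfl⟩ | ⟨rfl, rfl⟩ <;> rcases h' with ⟨h1, h2⟩ | ⟨h1, h2⟩ <;> simp_all

end Quiver.Total.Joins

namespace QuiverRep

open Finset

variable {V : Type u} [Quiver.{v} V] {X : QuiverRep.{u, v, w} V}

namespace HomBasis

theorem joins_proj {B : X.HomBasis} {f : Quiver.Total B.Vertex} {x y : B.Vertex} (h : f.Joins x y) :
    (B.proj f).Joins x.base y.base := by
  rcases h with ⟨rfl, rfl⟩ | ⟨rfl, rfl⟩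
  · exact Or.inl ⟨rfl, rfl⟩
  · exact Or.inr ⟨rfl, rfl⟩

/-- A labelling of a string basis by the numbers `1, …, M`, and a cyclic labelling of the quiver
such that the element with label `i` lies over the vertex with label `i`. -/
structure StringIndex (B : X.HomBasis) (n M : ℕ) where
  q : ZMod n ≃ V
  arr : ZMod n ≃ Quiver.Total V
  joins : ∀ r, (arr r).Joins (q r) (q (r + 1))
  idx : B.Vertex → ℕ
  idx_injective : Function.Injective idx
  idx_mem : ∀ x, 1 ≤ idx x ∧ idx x ≤ M
  exists_idx : ∀ i, 1 ≤ i → i ≤ M → ∃ x, idx x = i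
  q_idx : ∀ x, q (idx x) = x.base
  arrow : ∀ f : Quiver.Total B.Vertex,
    (idx f.right = idx f.left + 1 ∧ B.proj f = arr (idx f.left)) ∨
      (idx f.left = idx f.right + 1 ∧ B.proj f = arr (idx f.right))
  exists_arrow : ∀ x y, idx y = idx x + 1 → ∃ f : Quiver.Total B.Vertex, f.Joins x y

/-- The first arrow of a string determines a cyclic labelling of the quiver. -/
theorem exists_labelling {n : ℕ} (q : ZMod n ≃ V) (a : ZMod n ≃ Quiver.Total V)
    (ha : ∀ i, (a i).Joins (q i) (q (i + 1))) (c : Quiver.Total V) {p p' : V} (hc : c.Joins p p') :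
    ∃ (q' : ZMod n ≃ V) (a' : ZMod n ≃ Quiver.Total V),
      (∀ i, (a' i).Joins (q' i) (q' (i + 1))) ∧ q' 1 = p ∧ a' 1 = c := by
  obtain ⟨j, rfl⟩ := a.surjective c
  rcases hc.eq_or_eq (ha j) with rfl | rfl
  · refine ⟨(Equiv.addRight (j - 1)).trans q, (Equiv.addRight (j - 1)).trans a, fun i => ?_, ?_, ?_⟩
    · have := ha (i + (j - 1))
      rwa [add_right_comm] at this
    · simp
    · simp
  · refine ⟨(Equiv.subLeft (j + 1 + 1)).trans q, (Equiv.subLeft (j + 1)).trans a,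
      fun i => ?_, ?_, ?_⟩
    · have := (ha (j + 1 - i)).symm
      simp only [Equiv.trans_apply, Equiv.subLeft_apply]
      convert this using 2 <;> ring
    · simp
    · simp

theorem IsString.exists_stringIndex {B : X.HomBasis} (hB : B.IsString)
    (hV : Quiver.IsExtendedDynkinA V) : ∃ n M, 2 ≤ n ∧ Nonempty (B.StringIndex n M) := by
  obtain ⟨n, hn, q, a, ha⟩ := hV
  obtain ⟨N, b, ar, hb, hne⟩ := hB
  have : Fact (1 < n) := ⟨hn⟩
  obtain ⟨q', a', ha', hq', hproj⟩ : ∃ (q' : ZMod n ≃ V) (a' : ZMod n ≃ Quiver.Total V),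
      (∀ i, (a' i).Joins (q' i) (q' (i + 1))) ∧ q' 1 = (b 0).base ∧
        ∀ h : 0 < N, B.proj (ar ⟨0, h⟩) = a' 1 := by
    rcases Nat.eq_zero_or_pos N with rfl | hN
    · obtain ⟨i, hi⟩ := q.surjective (b 0).base
      obtain ⟨q', a', h1, h2, -⟩ := exists_labelling q a ha (a i) (ha i)
      exact ⟨q', a', h1, h2.trans hi, fun h => absurd h (lt_irrefl _)⟩
    · obtain ⟨q', a', h1, h2, h3⟩ := exists_labelling q a ha _ (joins_proj (hb ⟨0, hN⟩))
      exact ⟨q', a', h1, h2, fun _ => h3.symm⟩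
  -- The labels of the vertices and arrows below the string increase by one in each step: an arrow
  -- different from the preceding one leaves a vertex of the cycle on the other side.
  have key : ∀ i : ℕ, ∀ hi : i < N + 1, q' ((i + 1 : ℕ) : ZMod n) = (b ⟨i, hi⟩).base ∧
      ∀ h : i < N, B.proj (ar ⟨i, h⟩) = a' ((i + 1 : ℕ) : ZMod n) := by
    intro i
    induction i with
    | zero =>
      intro _
      rw [zero_add, Nat.cast_one]
      exact ⟨hq', hproj⟩
    | succ i ih =>
      intro hi
      obtain ⟨h1, h2⟩ := ih (by omega)
      have h3 := joins_proj (hb ⟨i, by omega⟩)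
      rw [h2 (by omega)] at h3
      have h4 := ha' ((i + 1 : ℕ) : ZMod n)
      rw [h1, ← Nat.cast_succ] at h4
      have h5 : q' ((i + 1 + 1 : ℕ) : ZMod n) = (b ⟨i + 1, hi⟩).base := h4.right_unique h3
      refine ⟨h5, fun h => ?_⟩
      obtain ⟨s, hs⟩ := a'.surjective (B.proj (ar ⟨i + 1, h⟩))
      have h6 := joins_proj (hb ⟨i + 1, h⟩)
      rw [← hs] at h6 ⊢
      have h7 := h6.eq_or_eq (ha' s)
      change (b ⟨i + 1, hi⟩).base = _ ∨ (b ⟨i + 1, hi⟩).base = _ at h7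
      rw [← h5, q'.injective.eq_iff, q'.injective.eq_iff] at h7
      rcases h7 with h7 | h7
      · rw [h7]
      · rw [Nat.cast_succ] at h7
        refine absurd ?_ (hne ⟨i, by omega⟩ ⟨i + 1, h⟩ rfl)
        rw [h2 (by omega), ← hs, add_right_cancel h7]
  refine ⟨n, N + 1, hn, ⟨{
    q := q'
    arr := a'
    joins := ha'
    idx := fun x => (b.symm x : ℕ) + 1
    idx_injective := fun x y h => b.symm.injective (Fin.ext (Nat.succ_injective h))
    idx_mem := fun x => ⟨by omega, by omega⟩
    exists_idx := fun i h1 h2 => ⟨b ⟨i - 1, by omega⟩, by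
      rw [Equiv.symm_apply_apply]
      exact Nat.sub_add_cancel h1⟩
    q_idx := fun x => by
      have := (key (b.symm x) (b.symm x).2).1
      rw [this, Fin.eta, Equiv.apply_symm_apply]
    arrow := fun f => ?_
    exists_arrow := fun x y h => ?_ }⟩⟩
  · obtain ⟨i, rfl⟩ := ar.surjective f
    have h2 := (key i (by omega)).2 i.2
    rcases hb i with ⟨h3, h4⟩ | ⟨h3, h4⟩
    · left
      rw [h3, h4, Equiv.symm_apply_apply, Equiv.symm_apply_apply]
      exact ⟨rfl, h2⟩
    · right
      rw [h3, h4, Equiv.symm_apply_apply, Equiv.symm_apply_apply]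
      exact ⟨rfl, h2⟩
  · have h1 : (b.symm x : ℕ) < N := by
      have := (b.symm y).2
      omega
    refine ⟨ar ⟨b.symm x, h1⟩, ?_⟩
    convert hb ⟨b.symm x, h1⟩ using 1
    · rw [← Equiv.symm_apply_eq]
      exact Fin.ext rfl
    · rw [← Equiv.symm_apply_eq]
      exact Fin.ext (by simpa using h)

namespace StringIndex

variable {B : X.HomBasis} {n M : ℕ} (S : B.StringIndex n M)

/-- The labelling in reverse order. -/
def reverse : B.StringIndex n M where
  q := (Equiv.subLeft ((M : ZMod n) + 1)).trans S.q
  arr := (Equiv.subLeft (M : ZMod n)).trans S.arr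
  joins r := by
    have := (S.joins (M - r)).symm
    simp only [Equiv.trans_apply, Equiv.subLeft_apply]
    convert this using 2 <;> ring
  idx x := M + 1 - S.idx x
  idx_injective x y h := S.idx_injective (by
    have h1 := S.idx_mem x
    have h2 := S.idx_mem y
    dsimp only at h
    omega)
  idx_mem x := by
    have h1 := S.idx_mem x
    omega
  exists_idx i h1 h2 := by
    obtain ⟨x, hx⟩ := S.exists_idx (M + 1 - i) (by omega) (by omega)
    exact ⟨x, by omega⟩
  q_idx x := by
    have h1 := S.idx_mem x
    rw [← S.q_idx x, Equiv.trans_apply, Equiv.subLeft_apply, Nat.cast_sub (by omega)]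
    push_cast
    congr 1
    ring
  arrow f := by
    have h1 := S.idx_mem f.left
    have h2 := S.idx_mem f.right
    rcases S.arrow f with ⟨h3, h4⟩ | ⟨h3, h4⟩
    · refine Or.inr ⟨by omega, ?_⟩
      rw [h4, Equiv.trans_apply, Equiv.subLeft_apply, h3, Nat.cast_sub (by omega)]
      push_cast
      congr 1
      ring
    · refine Or.inl ⟨by omega, ?_⟩
      rw [h4, Equiv.trans_apply, Equiv.subLeft_apply, h3, Nat.cast_sub (by omega)]
      push_cast
      congr 1
      ring
  exists_arrow x y h := by
    have h1 := S.idx_mem x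
    have h2 := S.idx_mem y
    obtain ⟨f, hf⟩ := S.exists_arrow y x (by omega)
    exact ⟨f, hf.symm⟩

/-- The arrow with label `r` points towards the vertex with label `r + 1`. -/
def Forward (r : ZMod n) : Prop := (S.arr r).left = S.q r

theorem q_ne (hn : 2 ≤ n) (r : ZMod n) : S.q r ≠ S.q (r + 1) := by
  have : Fact (1 < n) := ⟨hn⟩
  intro h
  have := S.q.injective h
  simp at this

theorem forward_reverse_zero (h : ¬ S.Forward M) : S.reverse.Forward 0 := by
  have h1 : (S.arr M).left = S.q (M + 1) := by
    rcases S.joins M with h1 | h1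
    · exact absurd h1.1 h
    · exact h1.1
  simpa [Forward, reverse] using h1

end StringIndex

end HomBasis

end QuiverRep

/-! ### String coordinates from a string basis -/

namespace QuiverRep

open Finset

variable {V : Type u} [Quiver.{v} V] {X : QuiverRep.{u, v, w} V}

namespace HomBasis.StringIndex

variable {B : X.HomBasis} {n M : ℕ} (S : B.StringIndex n M)

open Classical in
/-- The coordinate belonging to the basis element with label `i`. -/
def co (i : ℕ) (p : V) : X.obj p →ₗ[ℂ] ℂ :=
  (B.basis p).constr ℂ fun j => if S.idx ⟨p, j⟩ = i then 1 else 0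

open Classical in
/-- The basis element with label `i`, if it lies over `p`. -/
def bv (i : ℕ) (p : V) : X.obj p :=
  if h : ∃ j, S.idx ⟨p, j⟩ = i then B.basis p h.choose else 0

open Classical in
theorem co_basis (i : ℕ) (p : V) (j : B.index p) :
    S.co i p (B.basis p j) = if S.idx ⟨p, j⟩ = i then 1 else 0 := by
  rw [co, Module.Basis.constr_basis]

theorem idx_inj {p : V} {j k : B.index p} : S.idx ⟨p, j⟩ = S.idx ⟨p, k⟩ ↔ j = k := by
  rw [S.idx_injective.eq_iff]
  simp

theorem co_idx (p : V) (j : B.index p) (u : X.obj p) :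
    S.co (S.idx ⟨p, j⟩) p u = (B.basis p).repr u j := by
  classical
  have : S.co (S.idx ⟨p, j⟩) p = (B.basis p).coord j := by
    refine (B.basis p).ext fun k => ?_
    simp only [S.co_basis, S.idx_inj, Module.Basis.coord_apply, Module.Basis.repr_self,
      Finsupp.single_apply]
  rw [this]
  rfl

theorem bv_idx (p : V) (j : B.index p) : S.bv (S.idx ⟨p, j⟩) p = B.basis p j := by
  have h : ∃ k, S.idx ⟨p, k⟩ = S.idx ⟨p, j⟩ := ⟨j, rfl⟩
  rw [bv, dif_pos h, S.idx_inj.1 h.choose_spec]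

theorem exists_elt {i : ℕ} {p : V} (hi : i ∈ Icc 1 M) (hp : S.q i = p) :
    ∃ j : B.index p, S.idx ⟨p, j⟩ = i := by
  obtain ⟨⟨p', j⟩, rfl⟩ := S.exists_idx i (mem_Icc.1 hi).1 (mem_Icc.1 hi).2
  obtain rfl : p' = p := (S.q_idx ⟨p', j⟩).symm.trans hp
  exact ⟨j, rfl⟩

/-- A nonzero coefficient belongs to an arrow of the coefficient quiver. -/
theorem of_co_map_ne_zero {p p' : V} (a : p ⟶ p') (j : B.index p) {k : ℕ}
    (h : S.co k p' (X.map a (B.basis p j)) ≠ 0) :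
    (k = S.idx ⟨p, j⟩ + 1 ∧ (⟨p, p', a⟩ : Quiver.Total V) = S.arr (S.idx ⟨p, j⟩)) ∨
      (S.idx ⟨p, j⟩ = k + 1 ∧ (⟨p, p', a⟩ : Quiver.Total V) = S.arr k) := by
  classical
  obtain ⟨l, rfl⟩ : ∃ l, S.idx ⟨p', l⟩ = k := by
    by_contra! hl
    refine h ?_
    have : S.co k p' = 0 := by
      refine (B.basis p').ext fun l => ?_
      rw [S.co_basis, if_neg (hl l), LinearMap.zero_apply]
    rw [this, LinearMap.zero_apply]
  rw [co_idx] at h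
  exact S.arrow ⟨⟨p, j⟩, ⟨p', l⟩, ⟨a, h⟩⟩

theorem co_map_ne_zero {p p' : V} (a : p ⟶ p') {j : B.index p} {l : B.index p'}
    {f : Quiver.Total B.Vertex} (hl : f.left = ⟨p, j⟩) (hr : f.right = ⟨p', l⟩)
    (hf : B.proj f = ⟨p, p', a⟩) : S.co (S.idx ⟨p', l⟩) p' (X.map a (B.basis p j)) ≠ 0 := by
  obtain ⟨x, y, f, h⟩ := f
  obtain rfl : x = _ := hl
  obtain rfl : y = _ := hr
  obtain rfl : f = a := by simpa [proj] using hf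
  rw [co_idx]
  exact h

/-- The arrows of the coefficient quiver are projected to arrows with the same label. -/
theorem proj_eq {x y : B.Vertex} (h : S.idx y = S.idx x + 1) :
    ∃ f : Quiver.Total B.Vertex, f.Joins x y ∧ B.proj f = S.arr (S.idx x) := by
  obtain ⟨f, hf⟩ := S.exists_arrow x y h
  refine ⟨f, hf, ?_⟩
  rcases hf with ⟨h1, h2⟩ | ⟨h1, h2⟩ <;> rcases S.arrow f with ⟨h3, h4⟩ | ⟨h3, h4⟩ <;>
    rw [h1, h2] at h3
  · rw [h4, h1]
  · omega
  · omega
  · rw [h4, h2]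

/-- The arrow with label `i` acts between the basis elements with labels `i` and `i + 1` by a
nonzero scalar. If one of these elements does not exist, any scalar will do. -/
theorem exists_scalar (hn : 2 ≤ n) (i : ℕ) : ∃ c : ℂ, c ≠ 0 ∧
    ∀ {p p' : V} (a : p ⟶ p'), S.arr i = ⟨p, p', a⟩ →
      (S.Forward i → i + 1 ≤ M → ∀ u, S.co (i + 1) p' (X.map a u) = c * S.co i p u) ∧
      (¬ S.Forward i → 1 ≤ i → i ≤ M → ∀ u, S.co i p' (X.map a u) = c * S.co (i + 1) p u) := by
  classical
  have : Fact (1 < n) := ⟨hn⟩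
  suffices h : ∃ c : ℂ, c ≠ 0 ∧
      (S.Forward i → i + 1 ≤ M → ∀ u, S.co (i + 1) _ (X.map (S.arr i).hom u) = c * S.co i _ u) ∧
      (¬ S.Forward i → 1 ≤ i → i ≤ M →
        ∀ u, S.co i _ (X.map (S.arr i).hom u) = c * S.co (i + 1) _ u) by
    obtain ⟨c, hc, h1, h2⟩ := h
    refine ⟨c, hc, fun a ha => ?_⟩
    rw [ha] at h1 h2
    exact ⟨h1, h2⟩
  have hj := S.joins i
  have hφ : S.Forward i ↔ (S.arr i).left = S.q i := Iff.rfl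
  have hne := S.q_ne hn i
  obtain ⟨⟨p, p', a⟩, harr⟩ : ∃ t, S.arr i = t := ⟨_, rfl⟩
  have hinj : ∀ k : ℕ, k + 1 = i ∨ k = i + 1 → S.arr i ≠ S.arr k := by
    intro k hk h
    have := S.arr.injective h
    rcases hk with rfl | rfl <;> simp at this
  rw [harr] at hj hφ ⊢
  simp only at hφ ⊢
  by_cases hF : S.Forward i
  · have hp := hφ.1 hF
    have hp' : p' = S.q (i + 1) := by
      rcases hj with h | h
      · exact h.2
      · exact absurd (hp.symm.trans h.1) hne
    have hz : ∀ j, S.idx ⟨p, j⟩ ≠ i → S.co (i + 1) p' (X.map a (B.basis p j)) = 0 := by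
      intro j hj
      by_contra h
      rcases S.of_co_map_ne_zero a j h with ⟨h1, -⟩ | ⟨-, h1⟩
      · omega
      · exact hinj (i + 1) (Or.inr rfl) (harr.trans h1)
    by_cases hex : ∃ j, S.idx ⟨p, j⟩ = i ∧ i + 1 ≤ M
    · obtain ⟨j, hj, hiM⟩ := hex
      obtain ⟨l, hl⟩ := S.exists_elt (i := i + 1) (p := p') (mem_Icc.2 ⟨by omega, hiM⟩)
        (by rw [Nat.cast_succ, hp'])
      obtain ⟨f, hf, hfa⟩ := S.proj_eq (x := ⟨p, j⟩) (y := ⟨p', l⟩) (by rw [hl, hj])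
      rw [hj, harr] at hfa
      have hfl : f.left = ⟨p, j⟩ ∧ f.right = ⟨p', l⟩ := by
        rcases hf with h | ⟨h, -⟩
        · exact h
        · have h1 : f.left.base = p := congrArg Quiver.Total.left hfa
          rw [h] at h1
          exact absurd (hp.symm.trans (h1.symm.trans hp')) hne
      have hc := S.co_map_ne_zero a hfl.1 hfl.2 hfa
      rw [hl] at hc
      refine ⟨_, hc, fun _ _ u => ?_, fun h => absurd hF h⟩
      refine LinearMap.congr_fun (f := (S.co (i + 1) p').comp (X.map a))
        (g := (S.co (i + 1) p' (X.map a (B.basis p j))) • S.co i p)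
        ((B.basis p).ext fun k => ?_) u
      rw [LinearMap.comp_apply, LinearMap.smul_apply, S.co_basis]
      split_ifs with hk
      · rw [S.idx_inj.1 (hk.trans hj.symm), smul_eq_mul, mul_one]
      · rw [hz k hk, smul_zero]
    · refine ⟨1, one_ne_zero, fun _ hiM u => ?_, fun h => absurd hF h⟩
      refine LinearMap.congr_fun (f := (S.co (i + 1) p').comp (X.map a))
        (g := (1 : ℂ) • S.co i p) ((B.basis p).ext fun k => ?_) u
      have hk : S.idx ⟨p, k⟩ ≠ i := fun hk => hex ⟨k, hk, hiM⟩
      rw [LinearMap.comp_apply, LinearMap.smul_apply, S.co_basis, if_neg hk, hz k hk, smul_zero]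
  · obtain ⟨hp, hp'⟩ : p = S.q (i + 1) ∧ p' = S.q i := by
      rcases hj with h | h
      · exact absurd (hφ.2 h.1) hF
      · exact h
    have hz : ∀ j, S.idx ⟨p, j⟩ ≠ i + 1 → S.co i p' (X.map a (B.basis p j)) = 0 := by
      intro j hj
      by_contra h
      rcases S.of_co_map_ne_zero a j h with ⟨h1, h2⟩ | ⟨h1, -⟩
      · exact hinj _ (Or.inl h1.symm) (harr.trans h2)
      · exact hj h1
    by_cases hex : ∃ j, S.idx ⟨p, j⟩ = i + 1 ∧ 1 ≤ i
    · obtain ⟨j, hj, hi1⟩ := hex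
      have hiM := (S.idx_mem ⟨p, j⟩).2
      obtain ⟨l, hl⟩ := S.exists_elt (i := i) (p := p') (mem_Icc.2 ⟨hi1, by omega⟩) hp'.symm
      obtain ⟨f, hf, hfa⟩ := S.proj_eq (x := ⟨p', l⟩) (y := ⟨p, j⟩) (by rw [hl, hj])
      rw [hl, harr] at hfa
      have hfl : f.left = ⟨p, j⟩ ∧ f.right = ⟨p', l⟩ := by
        rcases hf with ⟨h, -⟩ | h
        · have h1 : f.left.base = p := congrArg Quiver.Total.left hfa
          rw [h] at h1
          exact absurd (hp'.symm.trans (h1.trans hp)) hne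
        · exact h
      have hc := S.co_map_ne_zero a hfl.1 hfl.2 hfa
      rw [hl] at hc
      refine ⟨_, hc, fun h => absurd h hF, fun _ _ _ u => ?_⟩
      refine LinearMap.congr_fun (f := (S.co i p').comp (X.map a))
        (g := (S.co i p' (X.map a (B.basis p j))) • S.co (i + 1) p)
        ((B.basis p).ext fun k => ?_) u
      rw [LinearMap.comp_apply, LinearMap.smul_apply, S.co_basis]
      split_ifs with hk
      · rw [S.idx_inj.1 (hk.trans hj.symm), smul_eq_mul, mul_one]
      · rw [hz k hk, smul_zero]
    · refine ⟨1, one_ne_zero, fun h => absurd h hF, fun _ hi1 _ u => ?_⟩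
      refine LinearMap.congr_fun (f := (S.co i p').comp (X.map a))
        (g := (1 : ℂ) • S.co (i + 1) p) ((B.basis p).ext fun k => ?_) u
      have hk : S.idx ⟨p, k⟩ ≠ i + 1 := fun hk => hex ⟨k, hk, hi1⟩
      rw [LinearMap.comp_apply, LinearMap.smul_apply, S.co_basis, if_neg hk, hz k hk, smul_zero]

/-- The coefficients of a string basis with respect to a labelling. -/
def lam (hn : 2 ≤ n) (i : ℕ) : ℂ := (S.exists_scalar hn i).choose

theorem lam_spec (hn : 2 ≤ n) {r : ZMod n} {p p' : V} {a : p ⟶ p'} (h : S.arr r = ⟨p, p', a⟩)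
    {i : ℕ} (hi : (i : ZMod n) = r) :
    (S.Forward r → i + 1 ≤ M →
        ∀ u, S.co (i + 1) p' (X.map a u) = S.lam hn i * S.co i p u) ∧
      (¬ S.Forward r → 1 ≤ i → i ≤ M →
        ∀ u, S.co i p' (X.map a u) = S.lam hn i * S.co (i + 1) p u) := by
  subst hi
  exact (S.exists_scalar hn i).choose_spec.2 a h

/-- The string coordinates with respect to a labelling of a string basis. -/
def coords (hn : 2 ≤ n) : X.StringCoords where
  n := n
  M := M
  q := S.q
  q_injective := S.q.injective
  φ := S.Forward
  lam := S.lam hn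
  lam_ne_zero i := (S.exists_scalar hn i).choose_spec.1
  co := S.co
  bv := S.bv
  co_bv i p h j := by
    obtain ⟨k, rfl⟩ := S.exists_elt h.1 h.2
    rw [S.bv_idx, S.co_basis]
    simp only [eq_comm]
  bv_eq_zero i p h := by
    rw [bv, dif_neg]
    rintro ⟨j, rfl⟩
    exact h ⟨mem_Icc.2 (S.idx_mem _), S.q_idx _⟩
  sum_co p u := by
    classical
    refine LinearMap.congr_fun (f := ∑ i ∈ Icc 1 M, (S.co i p).smulRight (S.bv i p))
      (g := LinearMap.id) ((B.basis p).ext fun j => ?_) u |> Eq.trans (by simp)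
    rw [LinearMap.sum_apply, sum_eq_single (S.idx ⟨p, j⟩)]
    · rw [LinearMap.smulRight_apply, S.co_basis, if_pos rfl, one_smul, S.bv_idx,
        LinearMap.id_apply]
    · intro i _ hi
      rw [LinearMap.smulRight_apply, S.co_basis, if_neg hi.symm, zero_smul]
    · exact fun h => absurd (mem_Icc.2 (S.idx_mem _)) h
  arrow {p p'} a := by
    obtain ⟨r, hr⟩ := S.arr.surjective ⟨p, p', a⟩
    have hj := S.joins r
    refine ⟨r, ?_⟩
    by_cases hF : S.Forward r
    · have hp : p = S.q r := by
        have : (S.arr r).left = S.q r := hF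
        rwa [hr] at this
      refine Or.inl ⟨hF, hp, ?_, fun i hi => (S.lam_spec hn hr hi).1 hF⟩
      rw [hr] at hj
      rcases hj with h | h
      · exact h.2
      · exact absurd (hp.symm.trans h.1) (S.q_ne hn r)
    · have h1 : ¬ (S.arr r).left = S.q r := hF
      rw [hr] at hj h1
      rcases hj with h | h
      · exact absurd h.1 h1
      · exact Or.inr ⟨hF, h.1, h.2, fun i hi => (S.lam_spec hn hr hi).2 hF⟩
  exists_arrow r hF := by
    have h1 : (S.arr r).left = S.q r := hF
    have hj := S.joins r
    obtain ⟨⟨p, p', a⟩, hr⟩ : ∃ t, S.arr r = t := ⟨_, rfl⟩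
    rw [hr] at hj h1
    obtain ⟨rfl, rfl⟩ : p = S.q r ∧ p' = S.q (r + 1) := by
      rcases hj with h | h
      · exact h
      · exact absurd (h1.symm.trans h.1) (S.q_ne hn r)
    exact ⟨a, fun i hi => (S.lam_spec hn hr hi).1 hF⟩
  exists_arrow' r hF := by
    have h1 : ¬ (S.arr r).left = S.q r := hF
    have hj := S.joins r
    obtain ⟨⟨p, p', a⟩, hr⟩ : ∃ t, S.arr r = t := ⟨_, rfl⟩
    rw [hr] at hj h1
    obtain ⟨rfl, rfl⟩ : p = S.q (r + 1) ∧ p' = S.q r := by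
      rcases hj with h | h
      · exact absurd h.1 h1
      · exact h
    exact ⟨a, fun i hi => (S.lam_spec hn hr hi).2 hF⟩

end HomBasis.StringIndex

end QuiverRep

/-! ### Cells labelled by successor closed subsets -/

namespace FunSpace

theorem IsCellDecomposition.comp_equiv {α ι κ : Type*} {S : FunSpace α} {C : ι → Set α}
    (h : S.IsCellDecomposition C) (f : κ ≃ ι) : S.IsCellDecomposition fun k => C (f k) where
  finite := by
    have := h.finite
    exact Finite.of_equiv ι f.symm
  disjoint i j hij := h.disjoint (f.injective.ne hij)
  cover := (f.surjective.iUnion_comp C).trans h.cover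
  filtration := by
    obtain ⟨r, hr, hc⟩ := h.filtration
    refine ⟨r ∘ f, hr.comp f.injective, fun k => ?_⟩
    have := hc k
    rwa [← f.surjective.iUnion_comp] at this
  isAffineSpace k := h.isAffineSpace (f k)

end FunSpace

namespace QuiverRep

open Finset FunSpace StringCell

variable {V : Type u} [Quiver.{v} V] {X : QuiverRep.{u, v, w} V}

namespace HomBasis.StringIndex

variable {B : X.HomBasis} {n M : ℕ} (S : B.StringIndex n M) (hn : 2 ≤ n) {e : V → ℕ}

theorem nonempty_hom_of_forward (hn : 2 ≤ n) {x y : B.Vertex} (h : S.idx y = S.idx x + 1)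
    (hF : S.Forward (S.idx x)) : Nonempty (x ⟶ y) := by
  obtain ⟨f, hf, hp⟩ := S.proj_eq h
  have h1 : f.left.base = S.q (S.idx x) := (congrArg Quiver.Total.left hp).trans hF
  rcases hf with ⟨rfl, rfl⟩ | ⟨h2, -⟩
  · exact ⟨f.hom⟩
  · rw [h2, ← S.q_idx, h, Nat.cast_succ] at h1
    exact absurd h1.symm (S.q_ne hn _)

theorem nonempty_hom_of_not_forward {x y : B.Vertex} (h : S.idx y = S.idx x + 1)
    (hF : ¬ S.Forward (S.idx x)) : Nonempty (y ⟶ x) := by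
  obtain ⟨f, hf, hp⟩ := S.proj_eq h
  rcases hf with ⟨h2, -⟩ | ⟨rfl, rfl⟩
  · refine absurd ?_ hF
    have h1 : f.left.base = (S.arr (S.idx x)).left := congrArg Quiver.Total.left hp
    rw [Forward, ← h1, h2, S.q_idx]
  · exact ⟨f.hom⟩

theorem of_hom (hn : 2 ≤ n) {x y : B.Vertex} (f : x ⟶ y) :
    (S.idx y = S.idx x + 1 ∧ S.Forward (S.idx x)) ∨
      (S.idx x = S.idx y + 1 ∧ ¬ S.Forward (S.idx y)) := by
  rcases S.arrow ⟨x, y, f⟩ with ⟨h1, h2⟩ | ⟨h1, h2⟩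
  · refine Or.inl ⟨h1, ?_⟩
    rw [Forward, ← h2, S.q_idx]
    rfl
  · refine Or.inr ⟨h1, fun hF => ?_⟩
    rw [Forward, ← h2] at hF
    have h3 : x.base = S.q (S.idx y) := hF
    dsimp only at h1
    rw [← S.q_idx, h1, Nat.cast_succ] at h3
    exact S.q_ne hn _ h3.symm

theorem ncard_fiber {s : Finset ℕ} {β : Set B.Vertex} (hs : ∀ x, S.idx x ∈ s ↔ x ∈ β)
    (hsM : ∀ i ∈ s, i ∈ Icc 1 M) (p : V) :
    {b ∈ β | b.base = p}.ncard = #((S.coords hn).fiber s p) := by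
  rw [← Set.ncard_image_of_injective _ S.idx_injective, ← Set.ncard_coe_finset]
  congr 1
  ext i
  simp only [Set.mem_image, Set.mem_ofPred_eq, mem_coe, StringCoords.mem_fiber]
  constructor
  · rintro ⟨x, ⟨hx, rfl⟩, rfl⟩
    exact ⟨(hs x).2 hx, S.q_idx x⟩
  · rintro ⟨hi, hp⟩
    obtain ⟨j, rfl⟩ := S.exists_elt (hsM i hi) hp
    exact ⟨_, ⟨(hs _).1 hi, rfl⟩, rfl⟩

open Classical in
/-- The successor closed subsets of the coefficient quiver, as sets of labels. -/
def indexEquiv : B.SuccessorClosedOfType e ≃ (S.coords hn).Index e where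
  toFun β :=
    have hβ : ∀ x, S.idx x ∈ ({i ∈ Icc 1 M | ∃ x ∈ β.1, S.idx x = i} : Finset ℕ) ↔ x ∈ β.1 := by
      intro x
      rw [mem_filter, and_iff_right (mem_Icc.2 (S.idx_mem x))]
      constructor
      · rintro ⟨y, hy, h⟩
        rwa [← S.idx_injective h]
      · exact fun h => ⟨x, h, rfl⟩
    { set := {i ∈ Icc 1 M | ∃ x ∈ β.1, S.idx x = i}
      mem_Icc := fun b hb => mem_Icc.1 (mem_filter.1 hb).1
      closed := fun i hi1 hiM => by
        obtain ⟨x, rfl⟩ := S.exists_idx i hi1 (Nat.le_of_succ_le hiM)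
        obtain ⟨y, hy⟩ := S.exists_idx (S.idx x + 1) (by omega) hiM
        rw [← hy, hβ, hβ]
        exact ⟨fun hF => β.2.1 x y (S.nonempty_hom_of_forward hn hy hF),
          fun hF => β.2.1 y x (S.nonempty_hom_of_not_forward hy hF)⟩
      card := fun p => by
        rw [← S.ncard_fiber hn hβ fun i hi => (mem_filter.1 hi).1]
        exact β.2.2 p }
  invFun γ := by
    refine ⟨{x | S.idx x ∈ γ.set}, ?_, fun p => ?_⟩
    · rintro x y ⟨f⟩ hx
      have hxM := S.idx_mem x
      have hyM := S.idx_mem y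
      rcases S.of_hom hn f with ⟨h1, h2⟩ | ⟨h1, h2⟩
      · have := (γ.closed (S.idx x) hxM.1 (h1 ▸ hyM.2)).1 h2 hx
        rwa [← h1] at this
      · refine (γ.closed (S.idx y) hyM.1 (h1 ▸ hxM.2)).2 h2 ?_
        rwa [← h1]
    · rw [S.ncard_fiber hn (s := γ.set) (β := {x | S.idx x ∈ γ.set}) (fun x => Iff.rfl) fun i hi =>
        mem_Icc.2 (γ.mem_Icc i hi), γ.card]
  left_inv β := by
    refine Subtype.ext (Set.ext fun x => ?_)
    change S.idx x ∈ ({i ∈ Icc 1 M | ∃ x ∈ β.1, S.idx x = i} : Finset ℕ) ↔ x ∈ β.1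
    rw [mem_filter, and_iff_right (mem_Icc.2 (S.idx_mem x))]
    constructor
    · rintro ⟨y, hy, h⟩
      rwa [← S.idx_injective h]
    · exact fun h => ⟨x, h, rfl⟩
  right_inv γ := by
    refine StringCoords.Index.ext (Finset.ext fun i => ?_)
    change i ∈ ({i ∈ Icc 1 M | ∃ x, S.idx x ∈ γ.set ∧ S.idx x = i} : Finset ℕ) ↔ i ∈ γ.set
    rw [mem_filter]
    constructor
    · rintro ⟨-, x, hx, rfl⟩
      exact hx
    · intro hi
      have hiM := γ.mem_Icc i hi
      obtain ⟨x, rfl⟩ := S.exists_idx i hiM.1 hiM.2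
      exact ⟨mem_Icc.2 hiM, x, hi, rfl⟩

theorem mem_indexEquiv (β : B.SuccessorClosedOfType e) (x : B.Vertex) :
    S.idx x ∈ (S.indexEquiv hn β).set ↔ x ∈ β.1 := by
  have h := congrArg Subtype.val ((S.indexEquiv hn).symm_apply_apply β)
  exact Set.ext_iff.1 h x

/-- The subrepresentation spanned by the basis elements of a successor closed set has vanishing
coefficients. -/
theorem pt_zero (β : B.SuccessorClosedOfType e)
    (h : (S.indexEquiv hn β).Supported (0 : ℕ × ℕ → ℂ)) : h.pt.1 = B.coordSpan β.1 := by
  funext p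
  change Submodule.span ℂ (Set.range _) = Submodule.span ℂ _
  congr 1
  have hvec : ∀ j : B.index p, (S.coords hn).vec p (full 0 (S.idx ⟨p, j⟩)) = B.basis p j := by
    intro j
    refine Eq.trans ?_ (S.bv_idx p j)
    refine (sum_eq_single (S.idx ⟨p, j⟩) ?_ ?_).trans ?_
    · intro i _ hi
      rw [full, if_neg hi.symm, Pi.zero_apply, zero_smul]
    · exact fun h => absurd (mem_Icc.2 (S.idx_mem _)) h
    · rw [full, if_pos rfl, one_smul]
      rfl
  ext u
  constructor
  · rintro ⟨k, rfl⟩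
    have hk := (S.indexEquiv hn β).en_mem k
    obtain ⟨j, hj⟩ := S.exists_elt (mem_Icc.2 ((S.indexEquiv hn β).mem_Icc _ hk))
      ((S.indexEquiv hn β).q_en k)
    rw [← hj, S.mem_indexEquiv hn] at hk
    refine ⟨j, hk, ?_⟩
    rw [← hvec, hj]
    rfl
  · rintro ⟨j, hj, rfl⟩
    obtain ⟨k, hk⟩ := (S.indexEquiv hn β).exists_en ((S.mem_indexEquiv hn β ⟨p, j⟩).2 hj)
      (S.q_idx ⟨p, j⟩)
    refine ⟨k, ?_⟩
    rw [← hvec, ← hk]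
    rfl

theorem exists_cells (hn : 2 ≤ n) (hF : S.Forward M ∨ S.Forward 0) (e : V → ℕ) :
    (∃ C : B.SuccessorClosedOfType e → Set (X.quiverGr e),
      (X.quiverGrVar e).IsCellDecomposition C ∧
      ∀ β, ∃ U ∈ C β, U.1.1 = B.coordSpan β.1) ∧
    HasEulerChar (X.quiverGr e) (Nat.card (B.SuccessorClosedOfType e)) := by
  have : NeZero n := ⟨by omega⟩
  have : Fintype V := Fintype.ofEquiv _ S.q
  refine ⟨⟨fun β => (S.indexEquiv hn β).cell,
    ((S.coords hn).isCellDecomposition hF).comp_equiv (S.indexEquiv hn), fun β => ?_⟩, ?_⟩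
  · have h0 := (S.indexEquiv hn β).isSol_zero
    have hx : (S.indexEquiv hn β).Supported (0 : ℕ × ℕ → ℂ) := h0.supp
    exact ⟨⟨hx.pt, hx.isSubrep_iff.2 h0⟩,
      StringCoords.Index.mem_cell.2 fun _ => hx.isPivot_iff, S.pt_zero hn β hx⟩
  · rw [Nat.card_congr (S.indexEquiv hn)]
    exact (S.coords hn).hasEulerChar hF

end HomBasis.StringIndex

/-- If the arrow of the quiver at the end of the string points towards the string, then the
labelling is reversed, and this becomes the arrow at the beginning. -/
theorem HomBasis.IsString.exists_cells {B : X.HomBasis} (hB : B.IsString)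
    (hV : Quiver.IsExtendedDynkinA V) (e : V → ℕ) :
    (∃ C : B.SuccessorClosedOfType e → Set (X.quiverGr e),
      (X.quiverGrVar e).IsCellDecomposition C ∧
      ∀ β, ∃ U ∈ C β, U.1.1 = B.coordSpan β.1) ∧
    HasEulerChar (X.quiverGr e) (Nat.card (B.SuccessorClosedOfType e)) := by
  obtain ⟨n, M, hn, ⟨S⟩⟩ := hB.exists_stringIndex hV
  by_cases hF : S.Forward M
  · exact S.exists_cells hn (Or.inl hF) e
  · exact S.reverse.exists_cells hn (Or.inr (S.forward_reverse_zero hF)) e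

end QuiverRep

/-! ### Walks in the universal cover -/

namespace Quiver

variable {V : Type u} [Quiver.{v} V] {n : ℕ} (q : ZMod n ≃ V) (a : ZMod n ≃ Quiver.Total V)

namespace UniversalCover

open Classical in
/-- The element of the free group that belongs to the arrow `a r`, passed through from `q r` to
`q (r + 1)`. -/
def step (r : ZMod n) : FreeGroup (Quiver.Total V) :=
  if (a r).left = q r then FreeGroup.of (a r) else (FreeGroup.of (a r))⁻¹

/-- The walk along the cycle of the quiver, lifted to the universal cover. -/
def next : Equiv.Perm (UniversalCover V) where
  toFun x := ⟨q (q.symm x.base + 1), x.word * step q a (q.symm x.base)⟩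
  invFun x := ⟨q (q.symm x.base - 1), x.word * (step q a (q.symm x.base - 1))⁻¹⟩
  left_inv x := by simp
  right_inv x := by simp

open Classical in
/-- The winding number of a vertex: the signed number of arrows in its word, where the arrows that
point in the direction of the walk count positively. -/
def level (x : UniversalCover V) : ℤ :=
  (FreeGroup.lift (fun t : Quiver.Total V =>
    Multiplicative.ofAdd (if t.left = q (a.symm t) then (1 : ℤ) else -1)) x.word).toAdd

theorem level_next (x : UniversalCover V) : level q a (next q a x) = level q a x + 1 := by
  simp only [level, next, Equiv.coe_fn_mk, map_mul, toAdd_mul, add_right_inj, step]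
  have h1 : (a (q.symm x.base)).left = q (a.symm (a (q.symm x.base))) ↔
      (a (q.symm x.base)).left = q (q.symm x.base) := by rw [Equiv.symm_apply_apply]
  by_cases h : (a (q.symm x.base)).left = q (q.symm x.base)
  · rw [if_pos h, FreeGroup.lift_apply_of, if_pos (h1.2 h), toAdd_ofAdd]
  · rw [if_neg h, map_inv, FreeGroup.lift_apply_of, if_neg fun h' => h (h1.1 h'), toAdd_inv,
      toAdd_ofAdd, neg_neg]

theorem level_next_zpow (k : ℤ) (x : UniversalCover V) :
    level q a ((next q a ^ k) x) = level q a x + k := by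
  induction k using Int.induction_on with
  | zero => simp
  | succ k ih => rw [add_comm, zpow_add, zpow_one, Equiv.Perm.mul_apply, level_next, ih]; ring
  | pred k ih =>
    have h := level_next q a ((next q a ^ (-(k : ℤ) - 1)) x)
    rw [← Equiv.Perm.mul_apply, ← zpow_one_add, add_sub_cancel, ih] at h
    omega

/-- The walk never returns to a vertex, since each step raises the winding by one. -/
theorem next_zpow_injective (x : UniversalCover V) :
    Function.Injective fun k : ℤ => (next q a ^ k) x := by
  intro k l h
  have h1 := level_next_zpow q a k x
  have h2 := level_next_zpow q a l x
  dsimp only at h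
  rw [h, h2] at h1
  omega

variable {q a}

/-- The universal cover is a disjoint union of lines: an arrow connects consecutive vertices of a
walk. -/
theorem eq_next_of_hom (hn : 2 ≤ n) (ha : ∀ i, (a i).Joins (q i) (q (i + 1)))
    {x y : UniversalCover V} (α : x ⟶ y) :
    (y = next q a x ∧ (⟨x.base, y.base, α.1⟩ : Quiver.Total V) = a (q.symm x.base)) ∨
      (x = next q a y ∧ (⟨x.base, y.base, α.1⟩ : Quiver.Total V) = a (q.symm y.base)) := by
  have : Fact (1 < n) := ⟨hn⟩
  obtain ⟨r, hr⟩ := a.surjective ⟨x.base, y.base, α.1⟩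
  have hj := ha r
  obtain ⟨p, g⟩ := x
  obtain ⟨p', g'⟩ := y
  obtain ⟨α, hα⟩ := α
  dsimp only at hr hα ⊢
  rw [hr] at hj
  rcases hj with ⟨h1, h2⟩ | ⟨h1, h2⟩
  · left
    dsimp only at h1 h2
    subst h1 h2
    have hs : step q a r = FreeGroup.of (a r) := if_pos (by rw [hr])
    rw [← hr] at hα ⊢
    simp [next, hs, hα]
  · right
    dsimp only at h1 h2
    subst h1 h2
    have hs : step q a r = (FreeGroup.of (a r))⁻¹ := if_neg (by
      rw [hr]
      intro h
      have := q.injective h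
      simp at this)
    rw [← hr] at hα ⊢
    simp [next, hs, hα]

end UniversalCover

end Quiver

namespace QuiverRep

open Quiver

variable {V : Type u} [Quiver.{v} V]

/-! ### The support of an indecomposable string module -/

/-- A representation that is isomorphic to an indecomposable one has no nontrivial direct sum
decomposition. -/
theorem Iso.isIndecomposable {X : QuiverRep.{u, v, w} V} {Z : QuiverRep V} (e : X.Iso Z)
    (h : X.IsIndecomposable) : ∀ U W : ∀ p, Submodule ℂ (Z.obj p), Z.IsSubrep U → Z.IsSubrep W →
      (∀ p, IsCompl (U p) (W p)) → (∀ p, U p = ⊥) ∨ (∀ p, W p = ⊥) := by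
  intro U W hU hW hc
  have hcomap : ∀ U : ∀ p, Submodule ℂ (Z.obj p), Z.IsSubrep U →
      X.IsSubrep fun p => (U p).comap (e.equiv p).toLinearMap := by
    intro U hU p p' a x hx
    change e.equiv p' (X.map a x) ∈ U p'
    rw [e.comm]
    exact hU a _ hx
  have hbot : ∀ (p) (N : Submodule ℂ (Z.obj p)), N.comap (e.equiv p).toLinearMap = ⊥ → N = ⊥ := by
    intro p N hN
    rw [← Submodule.map_comap_eq_of_surjective (e.equiv p).surjective N]
    exact (congrArg (Submodule.map (e.equiv p).toLinearMap) hN).trans (Submodule.map_bot _)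
  refine (h.2 _ _ (hcomap U hU) (hcomap W hW) fun p => ?_).imp
    (fun h p => hbot p _ (h p)) fun h p => hbot p _ (h p)
  exact (Submodule.orderIsoMapComap (e.equiv p)).symm.isCompl (hc p)

variable (Y : QuiverRep.{max u v, v, w} (UniversalCover V))

namespace pushdown

open Classical in
/-- The inclusion of a component of the push-down. -/
def inc (p : V) (g : FreeGroup (Quiver.Total V)) : Y.obj ⟨p, g⟩ →ₗ[ℂ] Y.pushdown.obj p :=
  DirectSum.lof ℂ _ (fun g => Y.obj ⟨p, g⟩) g

/-- The projection to a component of the push-down. -/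
def pr (p : V) (g : FreeGroup (Quiver.Total V)) : Y.pushdown.obj p →ₗ[ℂ] Y.obj ⟨p, g⟩ :=
  DirectSum.component ℂ _ (fun g => Y.obj ⟨p, g⟩) g

theorem pr_inc_self (p : V) (g : FreeGroup (Quiver.Total V)) (y : Y.obj ⟨p, g⟩) :
    pr Y p g (inc Y p g y) = y := by
  classical
  exact DirectSum.component.lof_self (M := fun g => Y.obj ⟨p, g⟩) ℂ g y

theorem pr_inc_of_ne (p : V) {g g' : FreeGroup (Quiver.Total V)} (h : g ≠ g') (y : Y.obj ⟨p, g⟩) :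
    pr Y p g' (inc Y p g y) = 0 := by
  classical
  exact (DirectSum.component.of (M := fun g => Y.obj ⟨p, g⟩) ℂ g' g y).trans (dif_neg h)

variable {Y} in
theorem ext_pr {p : V} {f f' : Y.pushdown.obj p} (h : ∀ g, pr Y p g f = pr Y p g f') : f = f' :=
  DFinsupp.ext h

theorem linearMap_ext {p : V} {E : Type*} [AddCommMonoid E] [Module ℂ E]
    {φ ψ : Y.pushdown.obj p →ₗ[ℂ] E} (h : ∀ g y, φ (inc Y p g y) = ψ (inc Y p g y)) : φ = ψ := by
  classical
  exact DirectSum.linearMap_ext (M := fun g => Y.obj ⟨p, g⟩) ℂ fun g => LinearMap.ext (h g)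

theorem map_inc {p p' : V} (a : p ⟶ p') (g : FreeGroup (Quiver.Total V)) (y : Y.obj ⟨p, g⟩) :
    Y.pushdown.map a (inc Y p g y) = inc Y p' (g * FreeGroup.of ⟨p, p', a⟩)
      (Y.map (p := ⟨p, g⟩) (q := ⟨p', g * FreeGroup.of ⟨p, p', a⟩⟩) ⟨a, rfl⟩ y) := by
  classical
  exact DirectSum.toModule_lof (M := fun g => Y.obj ⟨p, g⟩)
    (N := DirectSum (FreeGroup (Quiver.Total V)) fun g => Y.obj ⟨p', g⟩) ℂ g y

theorem pr_map {p p' : V} (a : p ⟶ p') (g : FreeGroup (Quiver.Total V)) (f : Y.pushdown.obj p) :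
    pr Y p' (g * FreeGroup.of ⟨p, p', a⟩) (Y.pushdown.map a f) =
      Y.map (p := ⟨p, g⟩) (q := ⟨p', g * FreeGroup.of ⟨p, p', a⟩⟩) ⟨a, rfl⟩ (pr Y p g f) := by
  refine LinearMap.congr_fun (f := (pr Y p' (g * FreeGroup.of ⟨p, p', a⟩)).comp (Y.pushdown.map a))
    (g := (Y.map (p := ⟨p, g⟩) (q := ⟨p', g * FreeGroup.of ⟨p, p', a⟩⟩) ⟨a, rfl⟩).comp (pr Y p g))
    (linearMap_ext Y fun g' y => ?_) f
  rw [LinearMap.comp_apply, LinearMap.comp_apply, map_inc]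
  by_cases h : g' = g
  · subst h
    rw [pr_inc_self, pr_inc_self]
  · rw [pr_inc_of_ne, pr_inc_of_ne _ _ h, map_zero]
    exact fun h' => h (mul_right_cancel h')

open Classical in
/-- The projection to the components over a set of vertices of the cover. -/
def cut (R : Set (UniversalCover V)) (p : V) : Y.pushdown.obj p →ₗ[ℂ] Y.pushdown.obj p :=
  DirectSum.toModule ℂ _ _ fun g => if (⟨p, g⟩ : UniversalCover V) ∈ R then inc Y p g else 0

theorem pr_cut (R : Set (UniversalCover V)) (p : V) (g : FreeGroup (Quiver.Total V))
    (f : Y.pushdown.obj p) : pr Y p g (cut Y R p f) =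
      open Classical in if (⟨p, g⟩ : UniversalCover V) ∈ R then pr Y p g f else 0 := by
  classical
  refine LinearMap.congr_fun (f := (pr Y p g).comp (cut Y R p))
    (g := if (⟨p, g⟩ : UniversalCover V) ∈ R then pr Y p g else 0)
    (linearMap_ext Y fun g' y => ?_) f |> Eq.trans <| ?_
  · have h1 : cut Y R p (inc Y p g' y) =
        (if (⟨p, g'⟩ : UniversalCover V) ∈ R then inc Y p g' else 0) y :=
      DirectSum.toModule_lof _ _ _
    rw [LinearMap.comp_apply, h1]
    by_cases h : g' = g
    · subst h
      split_ifs <;> simp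
    · split_ifs <;> simp [pr_inc_of_ne Y p h]
  · split_ifs <;> rfl

/-- The vectors that are supported on a set of vertices of the cover. -/
def supportedOn (R : Set (UniversalCover V)) (p : V) : Submodule ℂ (Y.pushdown.obj p) where
  carrier := {f | ∀ g, (⟨p, g⟩ : UniversalCover V) ∉ R → pr Y p g f = 0}
  zero_mem' g _ := map_zero _
  add_mem' {f f'} h h' g hg := by rw [map_add, h g hg, h' g hg, add_zero]
  smul_mem' c f h g hg := by rw [map_smul, h g hg, smul_zero]

theorem isSubrep_supportedOn {R : Set (UniversalCover V)}
    (h : ∀ {x y : UniversalCover V} (α : x ⟶ y), x ∈ R → y ∉ R → Y.map α = 0) :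
    Y.pushdown.IsSubrep (supportedOn Y R) := by
  intro p p' a f hf g hg
  obtain ⟨g, rfl⟩ : ∃ g', g' * FreeGroup.of ⟨p, p', a⟩ = g :=
    ⟨g * (FreeGroup.of ⟨p, p', a⟩)⁻¹, inv_mul_cancel_right _ _⟩
  rw [pr_map]
  by_cases hgR : (⟨p, g⟩ : UniversalCover V) ∈ R
  · rw [h _ hgR hg, LinearMap.zero_apply]
  · rw [hf g hgR, map_zero]

theorem isCompl_supportedOn (R : Set (UniversalCover V)) (p : V) :
    IsCompl (supportedOn Y R p) (supportedOn Y Rᶜ p) := by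
  classical
  refine IsCompl.of_eq ?_ ?_
  · refine (Submodule.eq_bot_iff _).2 fun f hf => ext_pr fun g => ?_
    rw [map_zero]
    by_cases hg : (⟨p, g⟩ : UniversalCover V) ∈ R
    · exact hf.2 g fun h => h hg
    · exact hf.1 g hg
  · refine Submodule.eq_top_iff'.2 fun f => Submodule.mem_sup.2
      ⟨cut Y R p f, fun g hg => ?_, f - cut Y R p f, fun g hg => ?_, add_sub_cancel _ _⟩
    · rw [pr_cut, if_neg hg]
    · rw [map_sub, pr_cut, if_pos (not_not.1 hg), sub_self]

/-- If the push-down is indecomposable, then a set of vertices of the cover that is not connected to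
its complement contains the support, or is disjoint to it. -/
theorem subsingleton_of_notMem
    (hY : ∀ U W : ∀ p, Submodule ℂ (Y.pushdown.obj p), Y.pushdown.IsSubrep U →
      Y.pushdown.IsSubrep W → (∀ p, IsCompl (U p) (W p)) → (∀ p, U p = ⊥) ∨ (∀ p, W p = ⊥))
    {R : Set (UniversalCover V)}
    (hR : ∀ {x y : UniversalCover V} (α : x ⟶ y), Y.map α ≠ 0 → (x ∈ R ↔ y ∈ R))
    {x₀ : UniversalCover V} (hx₀ : x₀ ∈ R) (h₀ : Nontrivial (Y.obj x₀)) {x : UniversalCover V}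
    (hx : x ∉ R) : Subsingleton (Y.obj x) := by
  rcases hY (supportedOn Y R) (supportedOn Y Rᶜ)
    (isSubrep_supportedOn Y fun α hx hy => by_contra fun h => hy ((hR α h).1 hx))
    (isSubrep_supportedOn Y (R := Rᶜ) fun α hx hy =>
      by_contra fun h => hy fun hy' => hx ((hR α h).2 hy'))
    (isCompl_supportedOn Y R) with h | h
  · obtain ⟨y, hy⟩ := exists_ne (0 : Y.obj x₀)
    refine absurd ?_ hy
    have h1 : inc Y x₀.base x₀.word y ∈ supportedOn Y R x₀.base := by
      intro g hg
      refine pr_inc_of_ne Y _ (fun h => hg ?_) y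
      rw [← h]
      exact hx₀
    rw [h, Submodule.mem_bot] at h1
    rw [← pr_inc_self Y x₀.base x₀.word y, h1, map_zero]
  · refine ⟨fun y y' => sub_eq_zero.1 ?_⟩
    have h1 : inc Y x.base x.word (y - y') ∈ supportedOn Y Rᶜ x.base := by
      intro g hg
      refine pr_inc_of_ne Y _ (fun h => hg ?_) _
      rw [← h]
      exact hx
    rw [h, Submodule.mem_bot] at h1
    rw [← pr_inc_self Y x.base x.word (y - y'), h1, map_zero]

theorem finite_support [Finite V] (hfin : ∀ p, Module.Finite ℂ (Y.pushdown.obj p)) :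
    {x | Nontrivial (Y.obj x)}.Finite := by
  have h : ∀ p, Finite (Σ g, Module.Free.ChooseBasisIndex ℂ (Y.obj ⟨p, g⟩)) := by
    intro p
    have := hfin p
    let b : Module.Basis _ ℂ (Y.pushdown.obj p) :=
      DFinsupp.basis fun g => Module.Free.chooseBasis ℂ (Y.obj ⟨p, g⟩)
    exact Module.Finite.finite_basis b
  refine Set.Finite.subset (Set.finite_range fun z : Σ p, Σ g,
    Module.Free.ChooseBasisIndex ℂ (Y.obj ⟨p, g⟩) => (⟨z.1, z.2.1⟩ : UniversalCover V)) ?_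
  rintro ⟨p, g⟩ hx
  have : Nontrivial (Y.obj ⟨p, g⟩) := hx
  obtain ⟨k⟩ := (Module.Free.chooseBasis ℂ (Y.obj ⟨p, g⟩)).index_nonempty
  exact ⟨⟨p, g, k⟩, rfl⟩

end pushdown

end QuiverRep

/-! ### Existence of a string basis -/

namespace QuiverRep

open Quiver

variable {V : Type u} [Quiver.{v} V]

namespace pushdown

variable (Y : QuiverRep.{max u v, v, w} (UniversalCover V))

theorem pr_map_hom {x y : UniversalCover V} (α : x ⟶ y) (f : Y.pushdown.obj x.base) :
    pr Y y.base y.word (Y.pushdown.map α.1 f) = Y.map α (pr Y x.base x.word f) := by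
  have h : ∀ {p p' : V} {g g' : FreeGroup (Quiver.Total V)}
      (α : p ⟶ p') (hα : g' = g * FreeGroup.of ⟨p, p', α⟩) (f : Y.pushdown.obj p),
      pr Y p' g' (Y.pushdown.map α f) =
        Y.map (p := ⟨p, g⟩) (q := ⟨p', g'⟩) ⟨α, hα⟩ (pr Y p g f) := by
    intro p p' g g' α hα f
    subst hα
    exact pr_map Y α g f
  exact h α.1 α.2 f

theorem pr_map_inc_of_ne {x y : UniversalCover V} (α : x.base ⟶ y.base)
    (h : y.word ≠ x.word * FreeGroup.of ⟨x.base, y.base, α⟩) (v : Y.obj x) :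
    pr Y y.base y.word (Y.pushdown.map α (inc Y x.base x.word v)) = 0 := by
  rw [map_inc, pr_inc_of_ne _ _ h.symm]

end pushdown

section lift

variable {X : QuiverRep.{u, v, w} V} {Y : QuiverRep.{max u v, v, w} (UniversalCover V)} {N : ℕ}

/-- A basis of a representation of the cover that is of dimension `1` over the vertices `s i` and
zero elsewhere, indexed by the `i`. -/
theorem exists_basis_of_support {s : Fin (N + 1) → UniversalCover V} (hs : Function.Injective s)
    (h1 : ∀ i, Module.finrank ℂ (Y.obj (s i)) = 1)
    (h0 : ∀ x, (∀ i, s i ≠ x) → Subsingleton (Y.obj x)) (x : UniversalCover V) :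
    Nonempty (Module.Basis {i // s i = x} ℂ (Y.obj x)) := by
  by_cases h : ∃ i, s i = x
  · obtain ⟨i, rfl⟩ := h
    let _ : Unique {j // s j = s i} := ⟨⟨⟨i, rfl⟩⟩, fun j => Subtype.ext (hs j.2)⟩
    exact ⟨Module.basisUnique _ (h1 i)⟩
  · push Not at h
    have := h0 x h
    have : IsEmpty {j // s j = x} := ⟨fun j => h j.1 j.2⟩
    exact ⟨Module.Basis.empty _⟩

/-- If a representation lifts to one of the cover that is of dimension `1` over the vertices `s i`
and zero elsewhere, then it has a basis whose coefficient quiver is the support of the lift. -/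
theorem Iso.exists_homBasis (e : X.Iso Y.pushdown) {s : Fin (N + 1) → UniversalCover V}
    (hs : Function.Injective s) (h1 : ∀ i, Module.finrank ℂ (Y.obj (s i)) = 1)
    (h0 : ∀ x, (∀ i, s i ≠ x) → Subsingleton (Y.obj x)) :
    ∃ (B : X.HomBasis) (b : Fin (N + 1) ≃ B.Vertex), (∀ i, (b i).base = (s i).base) ∧
      (∀ f : Quiver.Total B.Vertex, ∃ (i j : Fin (N + 1)) (α : s i ⟶ s j), Y.map α ≠ 0 ∧
        f.left = b i ∧ f.right = b j ∧ B.proj f = ⟨(s i).base, (s j).base, α.1⟩) ∧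
      ∀ (i j : Fin (N + 1)) (α : s i ⟶ s j), Y.map α ≠ 0 → Nonempty (b i ⟶ b j) := by
  classical
  have bas := fun x => (exists_basis_of_support hs h1 h0 x).some
  let D : ∀ p, Module.Basis (Σ g, {i // s i = ⟨p, g⟩}) ℂ (Y.pushdown.obj p) := fun p =>
    DFinsupp.basis fun g => bas ⟨p, g⟩
  let E : ∀ p, (Σ g, {i // s i = ⟨p, g⟩}) ≃ {i // (s i).base = p} := fun p =>
    { toFun := fun z => ⟨z.2.1, by rw [z.2.2]⟩
      invFun := fun i => ⟨(s i.1).word, i.1, by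
        obtain ⟨i, rfl⟩ := i
        rfl⟩
      left_inv := by
        rintro ⟨g, i, h⟩
        have h' : (s i).word = g := by rw [h]
        subst h'
        rfl
      right_inv := fun i => rfl }
  let B : X.HomBasis :=
    { index := fun p => {i // (s i).base = p}
      basis := fun p => ((D p).reindex (E p)).map (e.equiv p).symm }
  let b : Fin (N + 1) ≃ B.Vertex :=
    { toFun := fun i => ⟨(s i).base, i, rfl⟩
      invFun := fun x => x.elt.1
      left_inv := fun i => rfl
      right_inv := by
        rintro ⟨p, i, rfl⟩
        rfl }
  have hbasis : ∀ i, e.equiv (s i).base (B.basis (s i).base (b i).elt) =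
      pushdown.inc Y (s i).base (s i).word (bas (s i) ⟨i, rfl⟩) := by
    intro i
    have h : B.basis (s i).base (b i).elt =
        (e.equiv (s i).base).symm (D (s i).base ⟨(s i).word, i, rfl⟩) := by
      change (((D (s i).base).reindex (E (s i).base)).map (e.equiv (s i).base).symm) ⟨i, rfl⟩ = _
      rw [Module.Basis.map_apply, Module.Basis.reindex_apply]
      rfl
    rw [h, LinearEquiv.apply_symm_apply]
    refine (D (s i).base).ext_elem fun ⟨g, k⟩ => ?_
    have h' : ∀ f, (D (s i).base).repr f ⟨g, k⟩ =
        (bas ⟨(s i).base, g⟩).repr (pushdown.pr Y (s i).base g f) k := fun f => rfl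
    by_cases hg : (s i).word = g
    · subst hg
      obtain rfl : k = ⟨i, rfl⟩ := Subtype.ext (hs k.2)
      rw [h' (pushdown.inc _ _ _ _), Module.Basis.repr_self, pushdown.pr_inc_self,
        Module.Basis.repr_self, Finsupp.single_eq_same, Finsupp.single_eq_same]
    · rw [h' (pushdown.inc _ _ _ _), Module.Basis.repr_self, pushdown.pr_inc_of_ne Y _ hg,
        map_zero, Finsupp.zero_apply, Finsupp.single_eq_of_ne]
      exact fun h => hg (congrArg Sigma.fst h).symm
  have hrepr : ∀ (j) (z : X.obj (s j).base), (B.basis _).repr z (b j).elt =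
      (bas (s j)).repr (pushdown.pr Y (s j).base (s j).word (e.equiv _ z)) ⟨j, rfl⟩ :=
    fun j z => rfl
  have hunique : ∀ (j) (k : {i // s i = s j}), k = ⟨j, rfl⟩ := fun j k => Subtype.ext (hs k.2)
  have key : ∀ (i j) (α : s i ⟶ s j), (B.basis _).repr (X.map α.1 (B.basis _ (b i).elt))
      (b j).elt ≠ 0 ↔ Y.map α ≠ 0 := by
    intro i j α
    rw [not_iff_not, hrepr, e.comm, hbasis, pushdown.pr_map_hom, pushdown.pr_inc_self]
    constructor
    · intro h
      refine (bas (s i)).ext fun k => ?_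
      rw [hunique i k, LinearMap.zero_apply, ← (bas (s j)).repr.map_eq_zero_iff]
      ext l
      rw [hunique j l, h, Finsupp.zero_apply]
    · intro h
      rw [h, LinearMap.zero_apply, map_zero, Finsupp.zero_apply]
  refine ⟨B, b, fun i => rfl, ?_, fun i j α hα => ⟨⟨α.1, (key i j α).2 hα⟩⟩⟩
  rintro ⟨x, y, α, hα⟩
  obtain ⟨i, rfl⟩ := b.surjective x
  obtain ⟨j, rfl⟩ := b.surjective y
  by_cases h : (s j).word = (s i).word * FreeGroup.of ⟨(s i).base, (s j).base, α⟩
  · exact ⟨i, j, ⟨α, h⟩, (key i j ⟨α, h⟩).1 hα, rfl, rfl, rfl⟩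
  · have hα' : (B.basis (s j).base).repr (X.map (p := (s i).base) (q := (s j).base) α
        (B.basis (s i).base (b i).elt)) (b j).elt ≠ 0 := hα
    refine absurd ?_ hα'
    exact (hrepr j _).trans (by
      rw [e.comm, hbasis, pushdown.pr_map_inc_of_ne Y α h, map_zero, Finsupp.zero_apply])

end lift

namespace HomBasis

variable {X : QuiverRep.{u, v, w} V} {B : X.HomBasis} {N : ℕ}

theorem total_ext {f f' : Quiver.Total B.Vertex} (hl : f.left = f'.left) (hr : f.right = f'.right)
    (h : B.proj f = B.proj f') : f = f' := by
  obtain ⟨x, y, f⟩ := f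
  obtain ⟨x', y', f'⟩ := f'
  dsimp only at hl hr
  subst hl hr
  simp only [proj, Quiver.Total.mk.injEq, heq_eq_eq, true_and] at h ⊢
  exact Subtype.ext h

/-- If every arrow of the coefficient quiver connects consecutive elements of a list of the basis,
and lies over an arrow that is determined by the place in the list, then the basis is a string
basis. -/
theorem isString_of_consecutive (b : Fin (N + 1) ≃ B.Vertex) (c : ℕ → Quiver.Total V)
    (hbase : ∀ k : Fin N, (b k.castSucc).base ≠ (b k.succ).base) (hc : ∀ k, c k ≠ c (k + 1))
    (h1 : ∀ f : Quiver.Total B.Vertex, ∃ k : Fin N,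
      f.Joins (b k.castSucc) (b k.succ) ∧ B.proj f = c k)
    (h2 : ∀ k : Fin N, ∃ f : Quiver.Total B.Vertex, f.Joins (b k.castSucc) (b k.succ)) :
    B.IsString := by
  have hinj : ∀ {f : Quiver.Total B.Vertex} {k l : Fin N}, f.Joins (b k.castSucc) (b k.succ) →
      f.Joins (b l.castSucc) (b l.succ) → k = l := by
    intro f k l hk hl
    have h3 := hk.eq_or_eq hl
    have h4 := hk.symm.eq_or_eq hl
    simp only [b.injective.eq_iff, Fin.ext_iff, Fin.val_castSucc, Fin.val_succ] at h3 h4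
    exact Fin.ext (by omega)
  have hproj : ∀ {f : Quiver.Total B.Vertex} {k : Fin N}, f.Joins (b k.castSucc) (b k.succ) →
      B.proj f = c k := by
    intro f k hk
    obtain ⟨l, hl, hl'⟩ := h1 f
    rw [hl', hinj hk hl]
  choose a ha using h2
  refine ⟨N, b, Equiv.ofBijective a ⟨fun k l h => hinj (ha k) (h ▸ ha l), fun f => ?_⟩, ha, ?_⟩
  · obtain ⟨k, hk, hk'⟩ := h1 f
    refine ⟨k, ?_⟩
    have h3 : B.proj (a k) = B.proj f := (hproj (ha k)).trans hk'.symm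
    rcases ha k with ⟨h4, h5⟩ | ⟨h4, h5⟩ <;> rcases hk with ⟨h6, h7⟩ | ⟨h6, h7⟩
    · exact total_ext (h4.trans h6.symm) (h5.trans h7.symm) h3
    · refine absurd ?_ (hbase k)
      rw [← h4, ← h6]
      exact congrArg Quiver.Total.left h3
    · refine absurd ?_ (hbase k)
      rw [← h4, ← h6]
      exact (congrArg Quiver.Total.left h3).symm
    · exact total_ext (h4.trans h6.symm) (h5.trans h7.symm) h3
  · intro i j hij
    change B.proj (a i) ≠ B.proj (a j)
    rw [hproj (ha i), hproj (ha j), hij]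
    exact hc _

end HomBasis

/-- Two vertices that follow each other on the walk around the cycle are linked if one of the maps
between the components over these vertices is nonzero. -/
def Linked {n : ℕ} (q : ZMod n ≃ V) (a : ZMod n ≃ Quiver.Total V)
    (Y : QuiverRep.{max u v, v, w} (UniversalCover V)) (x : UniversalCover V) : Prop :=
  (∃ α : x ⟶ UniversalCover.next q a x, Y.map α ≠ 0) ∨
    ∃ α : UniversalCover.next q a x ⟶ x, Y.map α ≠ 0

section walk

variable {Y : QuiverRep.{max u v, v, w} (UniversalCover V)}

theorem nontrivial_of_map_ne_zero {x y : UniversalCover V} {α : x ⟶ y} (h : Y.map α ≠ 0) :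
    Nontrivial (Y.obj x) ∧ Nontrivial (Y.obj y) := by
  constructor <;> refine not_subsingleton_iff_nontrivial.1 fun hs => h ?_
  · exact LinearMap.ext fun z => by rw [Subsingleton.elim z 0, map_zero, map_zero]
  · exact LinearMap.ext fun z => Subsingleton.elim _ _

theorem Linked.nontrivial {n : ℕ} {q : ZMod n ≃ V} {a : ZMod n ≃ Quiver.Total V}
    {x : UniversalCover V} (h : Linked q a Y x) :
    Nontrivial (Y.obj x) ∧ Nontrivial (Y.obj (UniversalCover.next q a x)) := by
  rcases h with ⟨α, hα⟩ | ⟨α, hα⟩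
  · exact nontrivial_of_map_ne_zero hα
  · exact (nontrivial_of_map_ne_zero hα).symm

/-- A predicate on the integers with finite support holds on a maximal interval around `0`. -/
theorem exists_maximal_interval {P : ℤ → Prop} (hP : {k | P k}.Finite) :
    ∃ l N : ℕ, l ≤ N ∧ ¬ P (-(l : ℤ) - 1) ∧ ¬ P ((N : ℤ) - l) ∧
      ∀ i : ℕ, i < N → P ((i : ℤ) - l) := by
  classical
  have hex : ∀ φ : ℕ → ℤ, Function.Injective φ → ∃ k, ¬ P (φ k) := by
    intro φ hφ
    by_contra! h
    exact (Set.infinite_range_of_injective hφ).mono (Set.range_subset_iff.2 h) hP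
  have hr := hex (fun k => (k : ℤ)) Nat.cast_injective
  have hl := hex (fun k => -(k : ℤ) - 1) fun k l h => by
    dsimp only at h
    omega
  refine ⟨Nat.find hl, Nat.find hl + Nat.find hr, Nat.le_add_right _ _, Nat.find_spec hl, ?_, ?_⟩
  · have := Nat.find_spec hr
    rwa [Nat.cast_add, add_sub_cancel_left]
  · intro i hi
    rcases lt_or_ge i (Nat.find hl) with h | h
    · have := not_not.1 (Nat.find_min hl (m := Nat.find hl - 1 - i) (by omega))
      convert this using 1
      omega
    · have := not_not.1 (Nat.find_min hr (m := i - Nat.find hl) (by omega))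
      convert this using 1
      omega

/-- The support of an indecomposable push-down with components of dimension at most `1` is a walk
in the universal cover.  From a vertex of the support the walk is followed in both directions as
long as there are nonzero maps; the part of the representation reached in this way is a direct
summand. -/
theorem exists_walk {n : ℕ} (hn : 2 ≤ n) {q : ZMod n ≃ V} {a : ZMod n ≃ Quiver.Total V}
    (ha : ∀ i, (a i).Joins (q i) (q (i + 1)))
    (hY : ∀ U W : ∀ p, Submodule ℂ (Y.pushdown.obj p), Y.pushdown.IsSubrep U →
      Y.pushdown.IsSubrep W → (∀ p, IsCompl (U p) (W p)) → (∀ p, U p = ⊥) ∨ (∀ p, W p = ⊥))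
    (hfin : ∀ p, Module.Finite ℂ (Y.pushdown.obj p))
    {x₀ : UniversalCover V} (hx₀ : Nontrivial (Y.obj x₀)) :
    ∃ (N : ℕ) (s : ℕ → UniversalCover V), Function.Injective s ∧
      (∀ i, s (i + 1) = UniversalCover.next q a (s i)) ∧ (∀ i, i < N → Linked q a Y (s i)) ∧
      (∀ i, i ≤ N → Nontrivial (Y.obj (s i))) ∧
      ∀ x, (∀ i, i ≤ N → s i ≠ x) → Subsingleton (Y.obj x) := by
  have : NeZero n := ⟨by omega⟩
  have : Finite V := Finite.of_equiv _ q
  have hinj := UniversalCover.next_zpow_injective q a x₀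
  obtain ⟨l, N, hlN, hl, hN, hlink⟩ := exists_maximal_interval
    (P := fun k : ℤ => Linked q a Y ((UniversalCover.next q a ^ k) x₀))
    (((pushdown.finite_support Y hfin).preimage hinj.injOn).subset fun k hk => hk.nontrivial.1)
  let s : ℕ → UniversalCover V := fun i => (UniversalCover.next q a ^ ((i : ℤ) - l)) x₀
  have hs : Function.Injective s := fun i j h => by
    have := hinj h
    omega
  have hsucc : ∀ k : ℤ, (UniversalCover.next q a ^ (k + 1)) x₀ =
      UniversalCover.next q a ((UniversalCover.next q a ^ k) x₀) := by
    intro k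
    rw [add_comm, zpow_one_add, Equiv.Perm.mul_apply]
  have hs1 : ∀ i, s (i + 1) = UniversalCover.next q a (s i) := by
    intro i
    rw [← hsucc]
    simp only [s]
    congr 2
    push_cast
    ring
  have hsl : s l = x₀ := by simp [s]
  have hR : ∀ x, Linked q a Y x → ((∃ i, i ≤ N ∧ s i = x) ↔
      ∃ i, i ≤ N ∧ s i = UniversalCover.next q a x) := by
    intro x hx
    constructor
    · rintro ⟨i, hi, rfl⟩
      have hi' : i ≠ N := by
        rintro rfl
        exact hN hx
      exact ⟨i + 1, by omega, hs1 i⟩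
    · rintro ⟨i, hi, h⟩
      cases i with
      | zero =>
        refine absurd hx ?_
        have h2 := hsucc (-(l : ℤ) - 1)
        have h3 : s 0 = (UniversalCover.next q a ^ (-(l : ℤ) - 1 + 1)) x₀ := by simp [s]
        rw [← h3, h] at h2
        rw [(UniversalCover.next q a).injective h2]
        exact hl
      | succ i =>
        rw [hs1] at h
        exact ⟨i, by omega, (UniversalCover.next q a).injective h⟩
  refine ⟨N, s, hs, hs1, hlink, ?_, ?_⟩
  · intro i hi
    rcases hi.lt_or_eq with h | rfl
    · exact (hlink i h).nontrivial.1
    · cases i with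
      | zero =>
        rw [Nat.le_zero.1 hlN] at hsl
        rwa [hsl]
      | succ i =>
        rw [hs1]
        exact (hlink i (by omega)).nontrivial.2
  · intro x hx
    refine pushdown.subsingleton_of_notMem Y hY (R := {x | ∃ i, i ≤ N ∧ s i = x}) ?_
      ⟨l, hlN, hsl⟩ hx₀ fun ⟨i, hi, h⟩ => hx i hi h
    intro x y α hα
    rcases UniversalCover.eq_next_of_hom hn ha α with ⟨h, -⟩ | ⟨h, -⟩
    · subst h
      exact hR x (Or.inl ⟨α, hα⟩)
    · subst h
      exact (hR y (Or.inr ⟨α, hα⟩)).symm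

end walk

/-- An indecomposable string module has a string basis: the vertices of the support of a lift, in
the order of the walk in which they lie. -/
theorem IsIndecomposable.exists_isString {X : QuiverRep.{u, v, w} V} (hX : X.IsIndecomposable)
    (hV : Quiver.IsExtendedDynkinA V) (hfin : ∀ p, Module.Finite ℂ (X.obj p))
    (hstr : X.IsStringModule) : ∃ B : X.HomBasis, B.IsString := by
  obtain ⟨n, hn, q, a, ha⟩ := hV
  obtain ⟨Y, hrank, ⟨e⟩⟩ := hstr
  have : Fact (1 < n) := ⟨hn⟩
  have hfinY : ∀ p, Module.Finite ℂ (Y.pushdown.obj p) := fun p =>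
    have := hfin p
    Module.Finite.equiv (e.equiv p)
  obtain ⟨x₀, hx₀⟩ : ∃ x, Nontrivial (Y.obj x) := by
    by_contra! h
    obtain ⟨p, hp⟩ := hX.1
    obtain ⟨y, hy⟩ := exists_ne (0 : X.obj p)
    refine hy ((e.equiv p).map_eq_zero_iff.1 (pushdown.ext_pr fun g => ?_))
    have := h ⟨p, g⟩
    exact Subsingleton.elim _ _
  obtain ⟨N, s, hs, hs1, hlink, hne, hzero⟩ := exists_walk hn ha (e.isIndecomposable hX) hfinY hx₀
  have hbase : ∀ i, q.symm (s (i + 1)).base = q.symm (s i).base + 1 := by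
    intro i
    rw [hs1]
    simp [UniversalCover.next]
  obtain ⟨B, b, hb, h1, h2⟩ := e.exists_homBasis (s := fun i : Fin (N + 1) => s i)
    (fun i j h => Fin.ext (hs h)) (fun i => by
      have := hne i (by omega)
      exact Module.rank_eq_one_iff_finrank_eq_one.1
        (le_antisymm (hrank _) (Cardinal.one_le_iff_pos.2 rank_pos)))
    fun x hx => hzero x fun i hi => hx ⟨i, by omega⟩
  refine ⟨B, B.isString_of_consecutive b (fun i => a (q.symm (s i).base)) ?_ ?_ ?_ ?_⟩
  · intro k h
    rw [hb, hb] at h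
    have := hbase k
    rw [← Fin.val_succ, ← h] at this
    simp at this
  · intro k h
    have h3 := a.injective h
    rw [hbase] at h3
    simp at h3
  · intro f
    obtain ⟨i, j, α, -, hi, hj, hp⟩ := h1 f
    rcases UniversalCover.eq_next_of_hom hn ha α with ⟨h, h'⟩ | ⟨h, h'⟩
    · rw [← hs1] at h
      have h3 : (j : ℕ) = i + 1 := hs h
      refine ⟨⟨i, by omega⟩, Or.inl ⟨hi, hj.trans (congrArg b (Fin.ext h3))⟩, hp.trans h'⟩
    · rw [← hs1] at h
      have h3 : (i : ℕ) = j + 1 := hs h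
      refine ⟨⟨j, by omega⟩, Or.inr ⟨hi.trans (congrArg b (Fin.ext h3)), hj⟩, hp.trans h'⟩
  · intro k
    have h := hlink k k.2
    unfold Linked at h
    rw [← hs1] at h
    rcases h with ⟨α, hα⟩ | ⟨α, hα⟩
    · obtain ⟨f⟩ := h2 k.castSucc k.succ α hα
      exact ⟨⟨_, _, f⟩, Or.inl ⟨rfl, rfl⟩⟩
    · obtain ⟨f⟩ := h2 k.succ k.castSucc α hα
      exact ⟨⟨_, _, f⟩, Or.inr ⟨rfl, rfl⟩⟩

end QuiverRep
end

theorem mainTheorem2 {V : Type u} [Quiver.{v} V]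
    (hV : Quiver.IsExtendedDynkinA V) (hacyc : Quiver.IsAcyclic V)
    (X : QuiverRep.{u, v, w} V) (hfin : ∀ p, Module.Finite ℂ (X.obj p))
    (hind : X.IsIndecomposable) (hstr : X.IsStringModule) :
    (∃ B : X.HomBasis, B.IsString) ∧
    ∀ B : X.HomBasis, B.IsString → ∀ e : V → ℕ,
      (∃ C : B.SuccessorClosedOfType e → Set (X.quiverGr e),
        (X.quiverGrVar e).IsCellDecomposition C ∧
        ∀ β, ∃ U ∈ C β, U.1.1 = B.coordSpan β.1) ∧
      HasEulerChar (X.quiverGr e) (Nat.card (B.SuccessorClosedOfType e)) := by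
  exact ⟨hind.exists_isString hV hfin hstr, fun B hB e => hB.exists_cells hV e⟩
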